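/- Let $\gamma,\delta\in\mathbb R$ be not both zero. Let $\lambda_1,\dots,\lambda_k\in\mathbb C$ with $\lambda_i=\lambda_{iR}+\mathrm i\lambda_{iI}$, $\lambda_{iI}>0$, have orders $n_1,\dots,n_k\ge 1$, and let $a_i^{[j]}\in\mathbb C$ $(1\le i\le k,\ 0\le j<n_i)$ be constants; put $N=\sum_i n_i$. For $x,t\in\mathbb R$ let $$\theta^{[i]}(\lambda)=\mathrm i\lambda\big(x+(2\gamma\lambda+4\delta\lambda^2)t\big)+\sum_{j=0}^{n_i-1}a_i^{[j]}(\lambda-\lambda_i)^j-\tfrac{\mathrm i\pi}{4},\qquad \theta_i=\theta^{[i]}(\lambda_i),\qquad \Phi_i^{[m]}=\frac1{m!}\frac{\mathrm d^m}{\mathrm d\lambda^m}\begin{bmatrix}\mathrm e^{2\theta^{[i]}(\lambda)}\\1\end{bmatrix}_{\lambda=\lambda_i}.$$ Let $\mathbf Y$ be the $2\times N$ matrix with columns $\Phi_1^{[0]},\dots,\Phi_1^{[n_1-1]},\dots,\Phi_k^{[0]},\dots,\Phi_k^{[n_k-1]}$ and rows $\mathbf Y_1,\mathbf Y_2$. Let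 $\mathbf X=\mathrm{diag}(\mathbf X_1,\dots,\mathbf X_k)$, where $\mathbf X_i$ is the upper triangular block Toeplitz matrix with block $\Phi_i^{[b-p]}$ in row $p$ and column $b\ge p$ $(0\le p,b<n_i)$. Let $\mathbf S=(\mathbf S_{ij})$, where $\mathbf S_{ij}$ has the block $(-1)^p\binom{p+q}{p}(\lambda_i^*-\lambda_j)^{-(p+q+1)}\,\mathbb I_2$ in row $p$ and column $q$ $(0\le p<n_i,\ 0\le q<n_j)$. Put $\mathbf M=\mathbf X^\dagger\mathbf S\mathbf X$. The high-order soliton of the Hirota equation $\mathrm iq_t+\gamma(q_{xx}+2|q|^2q)+\mathrm i\delta(q_{xxx}+6|q|^2q_x)=0$ with these data is $$q^{[N]}(x,t)=2\,\mathbf Y_2\,\mathbf M^{-1}\,\mathbf Y_1^\dagger .$$ Put $v_i=-4(\lambda_{iR}\gamma-\lambda_{iI}^2\delta+3\lambda_{iR}^2\delta)$, $\mathscr C_i=16\delta\lambda_{iI}^2+8\mathrm i\gamma\lambda_{iI}+48\mathrm i\delta\lambda_{iR}\lambda_{iI}$, and, with $\arg$ the principal argument, $$L_i=\sum_{j\ne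 i}n_j\,\mathrm{sgn}(j-i)\log\left|\frac{\lambda_i-\lambda_j}{\lambda_i-\lambda_j^*}\right|,\qquad A_i=\sum_{j\ne i}n_j\,\mathrm{sgn}(j-i)\arg\frac{\lambda_i-\lambda_j^*}{\lambda_i-\lambda_j},$$ $$\Delta_{i,l}^{[\kappa]}=\log\frac{(n_i-\kappa)!}{(\kappa-1)!}-(n_i+1-2\kappa)\big(\log(2\lambda_{iI})+\log|\mathscr C_i|\big)-L_i,\qquad \Delta_{i,r}^{[\kappa]}=\log\frac{(n_i-\kappa)!}{(\kappa-1)!}-(n_i+1-2\kappa)\big(\log(2\lambda_{iI})+\log|\mathscr C_i|\big)+L_i,$$ $$s_{i,l,\pm}=x\mp\frac{n_i+1-2\kappa}{2\lambda_{iI}}\log|t|-v_it,\qquad s_{i,r,\pm}=x\pm\frac{n_i+1-2\kappa}{2\lambda_{iI}}\log|t|-v_it .$$ Suppose $v_1<v_2<\dots<v_k$. Then $\mathbf M$ is invertible for all $(x,t)\in\mathbb R^2$ (so $q^{[N]}$ is defined everywhere), and, as $t\to\pm\infty$, uniformly in $x\in\mathbb R$, $q^{[N]}$ decomposes into $N=\sum_i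 n_i$ single solitons: $$\begin{aligned}q^{[N]}(x,t)=&\sum_{i=1}^k\sum_{\kappa=1}^{[\frac{n_i+1}2]}2\lambda_{iI}\,\mathrm{sech}\Big(2\lambda_{iI}s_{i,l,\pm}\pm\Delta_{i,l}^{[\kappa]}-2\,\mathrm{Re}\,a_i^{[0]}\Big)\,\mathrm e^{-2\mathrm i\,\mathrm{Im}\,\theta_i\pm\mathrm i(n_i+1-2\kappa)\arg\mathscr C_i\pm\mathrm iA_i+\mathrm i\pi(\frac12+\kappa)}\\&+\sum_{i=1}^k\sum_{\kappa=1}^{[\frac{n_i}2]}2\lambda_{iI}\,\mathrm{sech}\Big(2\lambda_{iI}s_{i,r,\pm}\mp\Delta_{i,r}^{[\kappa]}-2\,\mathrm{Re}\,a_i^{[0]}\Big)\,\mathrm e^{-2\mathrm i\,\mathrm{Im}\,\theta_i\mp\mathrm i(n_i+1-2\kappa)\arg\mathscr C_i\pm\mathrm iA_i+\mathrm i\pi(n_i-\frac12+\kappa)}+O\Big(\frac{\log|t|}{|t|}\Big).\end{aligned}$$ -/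

import Mathlib

namespace Hirota

noncomputable section

/-! High-order solitons of the Hirota equation
`i q_t + γ (q_xx + 2 |q|² q) + i δ (q_xxx + 6 |q|² q_x) = 0`,
obtained from the zero seed by the generalised Darboux / Bäcklund transformation with `k` spectral
parameters `lam i` of orders `n i` and constants `a i j` (`j < n i`). -/

/-- The exponent `θ^{[i]}(z) = i z (x + (2 γ z + 4 δ z²) t) + ∑_{j < n_i} a_i^{[j]} (z - λ_i)^j - i π / 4`. -/
def theta {k : ℕ} (n : Fin k → ℕ) (lam : Fin k → ℂ) (a : Fin k → ℕ → ℂ) (γ δ x t : ℝ)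
    (i : Fin k) (z : ℂ) : ℂ :=
  Complex.I * z * ((x : ℂ) + (2 * (γ : ℂ) * z + 4 * (δ : ℂ) * z ^ 2) * (t : ℂ))
    + ∑ j ∈ Finset.range (n i), a i j * (z - lam i) ^ j
    - Complex.I / 4 * (Real.pi : ℂ)

/-- The vectors `Φ_i^{[m]} = (1 / m!) (d/dz)^m (e^{2 θ^{[i]}(z)}, 1)` at `z = λ_i`. -/
def Phi {k : ℕ} (n : Fin k → ℕ) (lam : Fin k → ℂ) (a : Fin k → ℕ → ℂ) (γ δ x t : ℝ)
    (i : Fin k) (m : ℕ) : Fin 2 → ℂ :=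
  ![(1 / (m.factorial : ℂ)) *
      iteratedDeriv m (fun z : ℂ => Complex.exp (2 * theta n lam a γ δ x t i z)) (lam i),
    if m = 0 then 1 else 0]

/-- Positions `(i, p)` with `i` the number of the spectral parameter and `0 ≤ p < n_i`;
there are `N = ∑ n_i` of them. -/
abbrev Idx {k : ℕ} (n : Fin k → ℕ) : Type := (i : Fin k) × Fin (n i)

/-- `Y_N = [Φ_1^{[0]}, …, Φ_1^{[n_1-1]}, …, Φ_k^{[0]}, …, Φ_k^{[n_k-1]}]`, a `2 × N` matrix. -/
def Y {k : ℕ} (n : Fin k → ℕ) (lam : Fin k → ℂ) (a : Fin k → ℕ → ℂ) (γ δ x t : ℝ) :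
    Matrix (Fin 2) (Idx n) ℂ :=
  Matrix.of fun c u => Phi n lam a γ δ x t u.1 u.2.val c

/-- The block diagonal matrix `X = diag(X_1, …, X_k)`; `X_i` is the upper triangular block
Toeplitz matrix whose block in row `p` and column `b ≥ p` is the column vector `Φ_i^{[b-p]}`. -/
def X {k : ℕ} (n : Fin k → ℕ) (lam : Fin k → ℂ) (a : Fin k → ℕ → ℂ) (γ δ x t : ℝ) :
    Matrix (Idx n × Fin 2) (Idx n) ℂ :=
  Matrix.of fun r u =>
    if r.1.1 = u.1 ∧ r.1.2.val ≤ u.2.val then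
      Phi n lam a γ δ x t u.1 (u.2.val - r.1.2.val) r.2
    else 0

/-- The matrix `S = (S_ij)`; with rows and columns counted from `0`, the block of `S_ij` in row `p`
and column `q` is `(-1)^p * binom(p+q, p) / (λ_i^* - λ_j)^{p+q+1}` times the `2 × 2` identity. -/
def S {k : ℕ} (n : Fin k → ℕ) (lam : Fin k → ℂ) : Matrix (Idx n × Fin 2) (Idx n × Fin 2) ℂ :=
  Matrix.of fun r s =>
    if r.2 = s.2 then
      (-1 : ℂ) ^ r.1.2.val * (Nat.choose (r.1.2.val + s.1.2.val) r.1.2.val : ℂ)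
        / ((starRingEnd ℂ) (lam r.1.1) - lam s.1.1) ^ (r.1.2.val + s.1.2.val + 1)
    else 0

/-- `M = X^† S X`. -/
def M {k : ℕ} (n : Fin k → ℕ) (lam : Fin k → ℂ) (a : Fin k → ℕ → ℂ) (γ δ x t : ℝ) :
    Matrix (Idx n) (Idx n) ℂ :=
  (X n lam a γ δ x t).conjTranspose * S n lam * X n lam a γ δ x t

/-- The high-order soliton `q^{[N]} = 2 Y_{N,2} M⁻¹ Y_{N,1}^†` (Bäcklund transformation of the
zero seed), where `Y_{N,1}`, `Y_{N,2}` are the first and second rows of `Y_N`. -/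
def soliton {k : ℕ} (n : Fin k → ℕ) (lam : Fin k → ℂ) (a : Fin k → ℕ → ℂ) (γ δ x t : ℝ) : ℂ :=
  2 * (Y n lam a γ δ x t 1 ⬝ᵥ
    ((M n lam a γ δ x t)⁻¹.mulVec (star (Y n lam a γ δ x t 0))))

/-- The velocity `v = -4 (λ_R γ - λ_I² δ + 3 λ_R² δ)` belonging to the spectral parameter `l`. -/
def velocity (γ δ : ℝ) (l : ℂ) : ℝ :=
  -4 * (l.re * γ - l.im ^ 2 * δ + 3 * l.re ^ 2 * δ)

/-- `𝒞 = 16 δ λ_I² + 8 i γ λ_I + 48 i δ λ_R λ_I`. -/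
def curlyC (γ δ : ℝ) (l : ℂ) : ℂ :=
  16 * (δ : ℂ) * (l.im : ℂ) ^ 2 + 8 * Complex.I * (γ : ℂ) * (l.im : ℂ)
    + 48 * Complex.I * (δ : ℂ) * (l.re : ℂ) * (l.im : ℂ)

/-- `sgn(j - i)`. -/
def sgn {k : ℕ} (j i : Fin k) : ℝ := Real.sign ((j.val : ℝ) - (i.val : ℝ))

/-- `∑_{j ≠ i} n_j sgn(j - i) log |(λ_i - λ_j) / (λ_i - λ_j^*)|`. -/
def positionShift {k : ℕ} (n : Fin k → ℕ) (lam : Fin k → ℂ) (i : Fin k) : ℝ :=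
  ∑ j ∈ Finset.univ.erase i, (n j : ℝ) * sgn j i *
    Real.log ‖(lam i - lam j) / (lam i - (starRingEnd ℂ) (lam j))‖

/-- `∑_{j ≠ i} n_j sgn(j - i) arg ((λ_i - λ_j^*) / (λ_i - λ_j))`. -/
def phaseShift {k : ℕ} (n : Fin k → ℕ) (lam : Fin k → ℂ) (i : Fin k) : ℝ :=
  ∑ j ∈ Finset.univ.erase i, (n j : ℝ) * sgn j i *
    Complex.arg ((lam i - (starRingEnd ℂ) (lam j)) / (lam i - lam j))

/-- The number `n_i + 1 - 2 κ`. -/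
def mu {k : ℕ} (n : Fin k → ℕ) (i : Fin k) (κ : ℕ) : ℝ := (n i : ℝ) + 1 - 2 * (κ : ℝ)

/-- `Δ_{i,l}^{[κ]}` -/
def DeltaL {k : ℕ} (n : Fin k → ℕ) (lam : Fin k → ℂ) (γ δ : ℝ) (i : Fin k) (κ : ℕ) : ℝ :=
  Real.log (((n i - κ).factorial : ℝ) / ((κ - 1).factorial : ℝ))
    - mu n i κ * (Real.log (2 * (lam i).im) + Real.log ‖curlyC γ δ (lam i)‖)
    - positionShift n lam i

/-- `Δ_{i,r}^{[κ]}` -/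
def DeltaR {k : ℕ} (n : Fin k → ℕ) (lam : Fin k → ℂ) (γ δ : ℝ) (i : Fin k) (κ : ℕ) : ℝ :=
  Real.log (((n i - κ).factorial : ℝ) / ((κ - 1).factorial : ℝ))
    - mu n i κ * (Real.log (2 * (lam i).im) + Real.log ‖curlyC γ δ (lam i)‖)
    + positionShift n lam i

/-- `s_{i,l,±} = x ∓ (n_i + 1 - 2 κ) / (2 λ_{iI}) log |t| - v_i t`; `σ = ±1` is the sign. -/
def sL {k : ℕ} (n : Fin k → ℕ) (lam : Fin k → ℂ) (γ δ σ : ℝ) (i : Fin k) (κ : ℕ) (x t : ℝ) : ℝ :=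
  x - σ * (mu n i κ / (2 * (lam i).im)) * Real.log |t| - velocity γ δ (lam i) * t

/-- `s_{i,r,±} = x ± (n_i + 1 - 2 κ) / (2 λ_{iI}) log |t| - v_i t`; `σ = ±1` is the sign. -/
def sR {k : ℕ} (n : Fin k → ℕ) (lam : Fin k → ℂ) (γ δ σ : ℝ) (i : Fin k) (κ : ℕ) (x t : ℝ) : ℝ :=
  x + σ * (mu n i κ / (2 * (lam i).im)) * Real.log |t| - velocity γ δ (lam i) * t

/-- The hyperbolic secant. -/
def sech (y : ℝ) : ℝ := 1 / Real.cosh y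

/-- The single soliton numbered `κ` on the left characteristic curve of `λ_i`. -/
def waveL {k : ℕ} (n : Fin k → ℕ) (lam : Fin k → ℂ) (a : Fin k → ℕ → ℂ) (γ δ σ : ℝ)
    (i : Fin k) (κ : ℕ) (x t : ℝ) : ℂ :=
  ((2 * (lam i).im *
      sech (2 * (lam i).im * sL n lam γ δ σ i κ x t + σ * DeltaL n lam γ δ i κ
        - 2 * (a i 0).re) : ℝ) : ℂ) *
    Complex.exp (Complex.I *
      ((-2 * (theta n lam a γ δ x t i (lam i)).im
        + σ * mu n i κ * Complex.arg (curlyC γ δ (lam i))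
        + σ * phaseShift n lam i
        + Real.pi * (1 / 2 + (κ : ℝ)) : ℝ) : ℂ))

/-- The single soliton numbered `κ` on the right characteristic curve of `λ_i`. -/
def waveR {k : ℕ} (n : Fin k → ℕ) (lam : Fin k → ℂ) (a : Fin k → ℕ → ℂ) (γ δ σ : ℝ)
    (i : Fin k) (κ : ℕ) (x t : ℝ) : ℂ :=
  ((2 * (lam i).im *
      sech (2 * (lam i).im * sR n lam γ δ σ i κ x t - σ * DeltaR n lam γ δ i κ
        - 2 * (a i 0).re) : ℝ) : ℂ) *
    Complex.exp (Complex.I *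
      ((-2 * (theta n lam a γ δ x t i (lam i)).im
        - σ * mu n i κ * Complex.arg (curlyC γ δ (lam i))
        + σ * phaseShift n lam i
        + Real.pi * ((n i : ℝ) - 1 / 2 + (κ : ℝ)) : ℝ) : ℂ))

/-- The superposition of the `∑ n_i` single solitons; `σ = 1` for `t → +∞`, `σ = -1` for
`t → -∞`. -/
def asymptotics {k : ℕ} (n : Fin k → ℕ) (lam : Fin k → ℂ) (a : Fin k → ℕ → ℂ) (γ δ σ x t : ℝ) :
    ℂ :=
  (∑ i, ∑ κ ∈ Finset.Icc 1 ((n i + 1) / 2), waveL n lam a γ δ σ i κ x t)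
    + (∑ i, ∑ κ ∈ Finset.Icc 1 (n i / 2), waveR n lam a γ δ σ i κ x t)

end

end Hirota

/-!
The matrix `-i S` is, up to the factor `𝕀₂`, the Gram matrix `G` (`gram`) of the functions
`(i s)^p e^{i λ_j s} / p!` in `L²(0, ∞)`. With the block Toeplitz matrix `E` (`expMat`) of the Taylor
coefficients of `exp (2 θ)` one has `M = i (G + E^† G E)`, so `M` is invertible, and the soliton is
`-2 i (e A₁) Γ⁻¹ (e A₂)^†` for `A₁ = 1`, `A₂ = E`, where `Γ = A₁^† G A₁ + A₂^† G A₂` and `e` is the row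
vector `evalVec` (`soliton_eq`). This expression, `projForm`, depends on the column space of
`[A₁; A₂]` only (`projForm_mul`), and it is Lipschitz as long as the columns stay bounded and
uniformly independent (`projForm_lipschitz`).

For large `t` the column space of `[1; E]` has, uniformly in `x`, a basis that is
`O(log t / t)`-close to mixed columns `(e_u, c_u e_{rev u})`, normalised (`exists_approx_columns`),
where `rev` reverses each block. Near the characteristic line of a block, within `O(log t)`, the
block of `E` is `exp (2 θ) D⁻¹ (exp J + O(log t / t)) D` with a nilpotent Jordan block `J` and
`D = diag ((c t)^p)`; the Bruhat decomposition of `exp J`, whose antidiagonal factor has the entries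
`(-1)^{q*} q*! / q!` with `q* = n_i - 1 - q`, gives the columns (`exists_mixed_columns`,
`expNilpotent_column`). Further away `exp (2 θ)` or its inverse is small enough to neglect one half of
the block (`blockApprox_far`).

The ratio `c_u` (`mixRatio`) has modulus `1` at a point `x = center u t`, decays exponentially to the
right of it and grows to the left of it. Two centres separate at least like `log t`
(`exists_center_gap`), so at each `x` only the column of the nearest centre `u₀` is really mixed: the
small part of all others is `O(1 / t)`. If it is replaced by zero, `projForm` can be evaluated
(`projForm_model`): the pure columns are eliminated by the Gram–Schmidt process, and the residual
vectors have explicit values and norms in terms of Blaschke products (`exists_residual`), which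
follow from the Sylvester equation `J^† G - G J = -i e^† e`. The result is a single soliton `profile` of
`waveRatio`, and the profiles of the other positions are `O(1 / t)` there, so the soliton is close
to the sum of all profiles (`soliton_near_sum`).

The profile at the position `q` of the block `i` is the single soliton number `κ = n_i - q` of the
theorem for `t → +∞`; for `t → -∞` the same result is applied with `-γ`, `-δ`, `-t`, which leaves
`θ` unchanged and reverses the velocities, and there `κ = q + 1` (`profile_waveRatio`). The right
family of solitons is the continuation of the left one to `κ > (n_i + 1) / 2` (`waveR_eq_waveL`).
-/


namespace Hirota

noncomputable section

open Matrix

/-! ### The Gram matrix and its Sylvester equation -/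

/-- The scalar confluent Cauchy matrix `-i S`: the Gram matrix, in `L²(0, ∞)`, of the functions
`(i s)^p / p! * e^{i λ_j s}`. -/
def gram {k : ℕ} (n : Fin k → ℕ) (lam : Fin k → ℂ) : Matrix (Idx n) (Idx n) ℂ :=
  Matrix.of fun u v => -Complex.I * ((-1 : ℂ) ^ u.2.val *
    (Nat.choose (u.2.val + v.2.val) u.2.val : ℂ)
        / ((starRingEnd ℂ) (lam u.1) - lam v.1) ^ (u.2.val + v.2.val + 1))

/-- The row vector that sums the coordinates at the positions `(i, 0)`. -/
def evalVec {k : ℕ} (n : Fin k → ℕ) : Idx n → ℂ := fun u => if u.2.val = 0 then 1 else 0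

/-- The Jordan matrix with one block of size `n_i` for each eigenvalue `λ_i`. -/
def jordan {k : ℕ} (n : Fin k → ℕ) (lam : Fin k → ℂ) : Matrix (Idx n) (Idx n) ℂ :=
  Matrix.of fun u v => if u = v then lam v.1 else
    if u.1 = v.1 ∧ u.2.val + 1 = v.2.val then 1 else 0

/-- The position before `(i, p)` in the same block, for `0 < p`. -/
def prevIdx {k : ℕ} {n : Fin k → ℕ} (u : Idx n) : Idx n :=
  ⟨u.1, ⟨u.2.val - 1, lt_of_le_of_lt (Nat.sub_le _ _) u.2.isLt⟩⟩

variable {k : ℕ} {n : Fin k → ℕ} {lam : Fin k → ℂ}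

theorem Idx.ext' {u v : Idx n} (h₁ : u.1 = v.1) (h₂ : u.2.val = v.2.val) : u = v := by
  obtain ⟨i, p⟩ := u
  obtain ⟨j, q⟩ := v
  obtain rfl : i = j := h₁
  obtain rfl : p = q := Fin.ext h₂
  rfl

theorem vecMul_jordan (f : Idx n → ℂ) (v : Idx n) :
    (f ᵥ* jordan n lam) v = lam v.1 * f v + (if 0 < v.2.val then f (prevIdx v) else 0) := by
  have key : ∀ u : Idx n, f u * jordan n lam u v =
      (if u = v then f u * lam v.1 else 0) +
        (if u = prevIdx v then (if 0 < v.2.val then f u else 0) else 0) := by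
    intro u
    simp only [jordan, Matrix.of_apply]
    by_cases h : u = v
    · subst h
      by_cases h2 : u = prevIdx u
      · have h3 : u.2.val = u.2.val - 1 := congrArg (fun w : Idx n => w.2.val) h2
        have : ¬ 0 < u.2.val := by omega
        simp [this]
      · simp [h2]
    · rw [if_neg h, if_neg h]
      by_cases h2 : u = prevIdx v
      · rw [if_pos h2]
        by_cases h3 : 0 < v.2.val
        · have : u.1 = v.1 ∧ u.2.val + 1 = v.2.val := by
            subst h2
            refine ⟨rfl, ?_⟩
            simp only [prevIdx]
            omega
          simp [this, h3]
        · have : ¬ (u.1 = v.1 ∧ u.2.val + 1 = v.2.val) := by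
            rintro ⟨-, h4⟩
            omega
          rw [if_neg this, if_neg h3]
          simp
      · have : ¬ (u.1 = v.1 ∧ u.2.val + 1 = v.2.val) := by
          rintro ⟨h4, h5⟩
          apply h2
          apply Idx.ext'
          · exact h4
          · simp only [prevIdx]; omega
        rw [if_neg this, if_neg h2]
        simp
  simp only [Matrix.vecMul, dotProduct, key, Finset.sum_add_distrib, Finset.sum_ite_eq',
    Finset.mem_univ, if_true]
  ring

theorem gram_mul_jordan (hlam : ∀ i, 0 < (lam i).im) (u v : Idx n) :
    (gram n lam u ᵥ* jordan n lam) v = (starRingEnd ℂ) (lam u.1) * gram n lam u v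
      + (if 0 < u.2.val then gram n lam (prevIdx u) v else 0)
      + Complex.I * (evalVec n u * evalVec n v) := by
  rw [vecMul_jordan]
  obtain ⟨i, p, hp⟩ := u
  obtain ⟨j, q, hq⟩ := v
  have hD : (starRingEnd ℂ) (lam i) - lam j ≠ 0 := by
    intro h
    have := congrArg Complex.im h
    simp at this
    have h1 := hlam i
    have h2 := hlam j
    linarith
  simp only [gram, prevIdx, evalVec, Matrix.of_apply]
  set D := (starRingEnd ℂ) (lam i) - lam j with hDdef
  have hl : (starRingEnd ℂ) (lam i) = D + lam j := by rw [hDdef]; ring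
  rw [hl]
  rcases p with _ | p <;> rcases q with _ | q
  · simp
    field_simp
    ring
  · simp
    field_simp
    ring
  · simp
    field_simp
    ring
  · have hc : ((p + 1 + (q + 1)).choose (p + 1) : ℂ)
        = ((p + 1 + q).choose (p + 1) : ℂ) + ((p + (q + 1)).choose p : ℂ) := by
      have : p + 1 + (q + 1) = (p + 1 + q) + 1 := by ring
      rw [this, Nat.choose_succ_succ]
      push_cast
      rw [show p + 1 + q = p + (q + 1) by ring]
      ring
    have e1 : p + 1 + (q + 1) + 1 = (p + q + 1) + 2 := by ring
    have e2 : p + 1 + q + 1 = (p + q + 1) + 1 := by ring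
    have e3 : p + (q + 1) + 1 = (p + q + 1) + 1 := by ring
    simp only [Nat.succ_pos, if_true, Nat.add_sub_cancel, hc, Nat.succ_ne_zero, if_false, e1, e2,
      e3]
    field_simp
    ring

theorem gram_mulVec_jordan (hlam : ∀ i, 0 < (lam i).im) (h : Idx n → ℂ) (u : Idx n) :
    (gram n lam *ᵥ (jordan n lam *ᵥ h)) u = (starRingEnd ℂ) (lam u.1) * (gram n lam *ᵥ h) u
      + (if 0 < u.2.val then (gram n lam *ᵥ h) (prevIdx u) else 0)
      + Complex.I * (evalVec n u * (evalVec n ⬝ᵥ h)) := by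
  have : (gram n lam *ᵥ (jordan n lam *ᵥ h)) u = (gram n lam u ᵥ* jordan n lam) ⬝ᵥ h := by
    rw [← Matrix.dotProduct_mulVec]; rfl
  rw [this]
  simp only [dotProduct, gram_mul_jordan hlam, add_mul, Finset.sum_add_distrib]
  congr 1
  · congr 1
    · simp only [Matrix.mulVec, dotProduct, Finset.mul_sum, mul_assoc]
    · split_ifs with h0
      · simp only [Matrix.mulVec, dotProduct]
      · simp
  · simp only [Finset.mul_sum, mul_assoc]

theorem gram_isHermitian : (gram n lam).IsHermitian := by
  ext u v
  simp only [Matrix.conjTranspose_apply, gram, Matrix.of_apply, RCLike.star_def, map_mul, map_neg,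
    Complex.conj_I, map_div₀, map_pow, map_one, Complex.conj_natCast, map_sub, Complex.conj_conj]
  have hD : lam v.1 - (starRingEnd ℂ) (lam u.1) = -1 * ((starRingEnd ℂ) (lam u.1) - lam v.1) := by
    ring
  rw [hD, mul_pow, show v.2.val + u.2.val = u.2.val + v.2.val by ring,
    ← Nat.choose_symm_of_eq_add (show u.2.val + v.2.val = u.2.val + v.2.val from rfl)]
  have h1 : ((-1 : ℂ)) ^ (u.2.val + v.2.val + 1) = -((-1) ^ u.2.val * (-1) ^ v.2.val) := by
    rw [pow_succ, pow_add]; ring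
  have hu : ((-1 : ℂ)) ^ u.2.val * (-1) ^ u.2.val = 1 := by
    rw [← mul_pow]; simp
  have hv : ((-1 : ℂ)) ^ v.2.val * (-1) ^ v.2.val = 1 := by
    rw [← mul_pow]; simp
  rw [h1]
  set A := ((-1 : ℂ)) ^ u.2.val
  set B := ((-1 : ℂ)) ^ v.2.val
  have hA : A⁻¹ = A := inv_eq_of_mul_eq_one_left hu
  have hB : B⁻¹ = B := inv_eq_of_mul_eq_one_left hv
  rw [div_eq_mul_inv, div_eq_mul_inv, mul_inv, inv_neg, mul_inv, hA, hB]
  linear_combination (-Complex.I * A * ((u.2.val + v.2.val).choose u.2.val : ℂ) *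
    (((starRingEnd ℂ) (lam u.1) - lam v.1) ^ (u.2.val + v.2.val + 1))⁻¹) * hv

theorem star_dotProduct_mulVec_comm {ι : Type*} [Fintype ι] {G : Matrix ι ι ℂ}
    (hG : G.IsHermitian) (a b : ι → ℂ) :
    star a ⬝ᵥ (G *ᵥ b) = star (star b ⬝ᵥ (G *ᵥ a)) := by
  rw [Matrix.star_dotProduct, Matrix.star_mulVec, hG.eq, Matrix.dotProduct_mulVec]

/-! ### Polynomials as functionals -/

/-- The value of the polynomial `Q` at the confluent point system `λ`, weighted with `h`:
`∑ h_{(j,p)} Q^{(p)}(λ_j) / p!`. -/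
def pairing (lam : Fin k → ℂ) (h : Idx n → ℂ) (Q : Polynomial ℂ) : ℂ :=
  (fun u : Idx n => (Polynomial.taylor (lam u.1) Q).coeff u.2.val) ⬝ᵥ h

theorem pairing_one (h : Idx n → ℂ) : pairing lam h 1 = evalVec n ⬝ᵥ h := by
  unfold pairing evalVec
  congr 1
  ext u
  simp [Polynomial.coeff_one]

theorem pairing_X_mul (h : Idx n → ℂ) (Q : Polynomial ℂ) :
    pairing lam h (Polynomial.X * Q) = pairing lam (jordan n lam *ᵥ h) Q := by
  unfold pairing
  rw [Matrix.dotProduct_mulVec]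
  congr 1
  ext u
  rw [vecMul_jordan]
  obtain ⟨i, p, hp⟩ := u
  simp only [prevIdx]
  rw [Polynomial.taylor_mul, Polynomial.taylor_X, add_mul, Polynomial.coeff_add]
  rcases p with _ | p
  · simp
  · simp [Polynomial.coeff_X_mul]
    ring

theorem pairing_add (h : Idx n → ℂ) (P Q : Polynomial ℂ) :
    pairing lam h (P + Q) = pairing lam h P + pairing lam h Q := by
  simp only [pairing, map_add, Polynomial.coeff_add, dotProduct, add_mul, Finset.sum_add_distrib]

theorem pairing_C_mul (h : Idx n → ℂ) (c : ℂ) (Q : Polynomial ℂ) :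
    pairing lam h (Polynomial.C c * Q) = c * pairing lam h Q := by
  simp only [pairing, Polynomial.taylor_mul, Polynomial.taylor_C, Polynomial.coeff_C_mul,
    dotProduct, mul_assoc, Finset.mul_sum]

theorem pairing_mul (h : Idx n → ℂ) (R Q : Polynomial ℂ) :
    pairing lam h (R * Q) = pairing lam (Polynomial.aeval (jordan n lam) R *ᵥ h) Q := by
  have hlin1 : ∀ (a b : Idx n → ℂ) , pairing lam (a + b) Q = pairing lam a Q + pairing lam b Q := by
    intro a b; simp [pairing, dotProduct_add]
  have hlin2 : ∀ (c : ℂ) (b : Idx n → ℂ) , pairing lam (c • b) Q = c * pairing lam b Q := by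
    intro a b; simp [pairing, dotProduct_smul]
  induction R using Polynomial.induction_on generalizing h with
  | C a =>
    rw [pairing_C_mul, Polynomial.aeval_C, Algebra.algebraMap_eq_smul_one, Matrix.smul_mulVec,
      Matrix.one_mulVec, hlin2]
  | add p q hp hq => rw [add_mul, pairing_add, hp, hq, map_add, Matrix.add_mulVec, hlin1]
  | monomial m a ih =>
    have : Polynomial.C a * Polynomial.X ^ (m + 1) * Q
      = Polynomial.X * ((Polynomial.C a * Polynomial.X ^ m) * Q) := by ring
    rw [this, pairing_X_mul, ih, pow_succ, ← mul_assoc,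
      map_mul (Polynomial.aeval (jordan n lam)) (_ * _) Polynomial.X, Polynomial.aeval_X,
      Matrix.mulVec_mulVec]

end

end Hirota

namespace Hirota

noncomputable section

open Matrix

variable {k : ℕ} {n : Fin k → ℕ} {lam : Fin k → ℂ}

/-! ### Residual vectors -/

theorem taylor_coeff_X_sub_C_pow_mul (c : ℂ) (m p : ℕ) (R : Polynomial ℂ) (hp : p ≤ m) :
    (Polynomial.taylor c ((Polynomial.X - Polynomial.C c) ^ m * R)).coeff p
      = if p = m then R.eval c else 0 := by
  rw [Polynomial.taylor_mul, Polynomial.taylor_pow, map_sub, Polynomial.taylor_X,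
    Polynomial.taylor_C, add_sub_cancel_right, Polynomial.coeff_X_pow_mul']
  by_cases h : p = m
  · subst h
    simp [Polynomial.taylor_coeff_zero]
  · rw [if_neg (by omega), if_neg h]

/-- The product `∏_{l ≠ j} (X - λ_l)^{n_l}`. -/
def otherFactors (n : Fin k → ℕ) (lam : Fin k → ℂ) (j : Fin k) : Polynomial ℂ :=
  ∏ l ∈ Finset.univ.erase j, (Polynomial.X - Polynomial.C (lam l)) ^ n l

theorem pairing_otherFactors (h : Idx n → ℂ) (u : Idx n)
    (hu : ∀ v : Idx n, v.1 = u.1 → u.2.val < v.2.val → h v = 0) :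
    pairing lam h ((Polynomial.X - Polynomial.C (lam u.1)) ^ u.2.val * otherFactors n lam u.1)
      = h u * ∏ l ∈ Finset.univ.erase u.1, (lam u.1 - lam l) ^ n l := by
  unfold pairing dotProduct
  rw [Finset.sum_eq_single u]
  · dsimp only
    rw [taylor_coeff_X_sub_C_pow_mul _ _ _ _ le_rfl, if_pos rfl, mul_comm]
    simp [otherFactors, Polynomial.eval_prod]
  · intro v _ hv
    dsimp only
    by_cases h1 : v.1 = u.1
    · rcases lt_trichotomy v.2.val u.2.val with h2 | h2 | h2
      · rw [show lam v.1 = lam u.1 by rw [h1], taylor_coeff_X_sub_C_pow_mul _ _ _ _ h2.le,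
          if_neg h2.ne, zero_mul]
      · exact absurd (Idx.ext' h1 h2) hv
      · rw [hu v h1 h2, mul_zero]
    · have : (Polynomial.X - Polynomial.C (lam u.1)) ^ u.2.val * otherFactors n lam u.1
        = (Polynomial.X - Polynomial.C (lam v.1)) ^ n v.1 *
          ((Polynomial.X - Polynomial.C (lam u.1)) ^ u.2.val *
            ∏ l ∈ (Finset.univ.erase u.1).erase v.1,
              (Polynomial.X - Polynomial.C (lam l)) ^ n l) := by
        rw [otherFactors, ← Finset.mul_prod_erase (Finset.univ.erase u.1) _
          (Finset.mem_erase.2 ⟨h1, Finset.mem_univ _⟩)]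
        ring
      rw [this, taylor_coeff_X_sub_C_pow_mul _ _ _ _ v.2.isLt.le, if_neg v.2.isLt.ne, zero_mul]
  · simp

theorem natDegree_X_sub_C_pow_mul_otherFactors (u : Idx n) :
    ((Polynomial.X - Polynomial.C (lam u.1)) ^ u.2.val * otherFactors n lam u.1).natDegree
      = u.2.val + ∑ l ∈ Finset.univ.erase u.1, n l := by
  have hm : (otherFactors n lam u.1).Monic :=
    Polynomial.monic_prod_of_monic _ _ fun l _ => (Polynomial.monic_X_sub_C _).pow _
  rw [((Polynomial.monic_X_sub_C (lam u.1)).pow u.2.val).natDegree_mul hm,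
    otherFactors, Polynomial.natDegree_prod_of_monic _ _
      (fun l _ => (Polynomial.monic_X_sub_C _).pow _)]
  simp

theorem pairing_of_natDegree_le (h : Idx n → ℂ) (d : ℕ)
    (hd : ∀ r < d, pairing lam h (Polynomial.X ^ r) = 0) (Q : Polynomial ℂ)
    (hQ : Q.natDegree ≤ d) :
    pairing lam h Q = Q.coeff d * pairing lam h (Polynomial.X ^ d) := by
  have hsum : ∀ s : Finset ℕ, pairing lam h
      (∑ r ∈ s, Polynomial.C (Q.coeff r) * Polynomial.X ^ r)
      = ∑ r ∈ s, Q.coeff r * pairing lam h (Polynomial.X ^ r) := by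
    intro s
    induction s using Finset.induction_on with
    | empty => simp [pairing, dotProduct]
    | insert a s ha ih => rw [Finset.sum_insert ha, Finset.sum_insert ha, pairing_add, ih,
        pairing_C_mul]
  conv_lhs => rw [Polynomial.as_sum_range_C_mul_X_pow' Q (Nat.lt_succ_of_le hQ)]
  rw [hsum, Finset.sum_range_succ, Finset.sum_eq_zero, zero_add]
  intro r hr
  rw [hd r (Finset.mem_range.1 hr), mul_zero]

/-- A functional on polynomials supported on the confluent points `λ` with total multiplicity `N`
that kills all powers below `X ^ (N - 1)`, and not that one: a divided difference. -/
theorem exists_pairing_eq_zero (hn : 0 < ∑ i, n i) (hinj : Function.Injective lam) :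
    ∃ h : Idx n → ℂ, (∀ r < ∑ i, n i - 1, pairing lam h (Polynomial.X ^ r) = 0) ∧
      pairing lam h (Polynomial.X ^ (∑ i, n i - 1)) ≠ 0 := by
  set d := ∑ i, n i - 1 with hdd
  let Φ : (Idx n → ℂ) →ₗ[ℂ] (Fin d → ℂ) :=
    { toFun := fun h r => pairing lam h (Polynomial.X ^ r.val)
      map_add' := by intro a b; ext r; simp [pairing, dotProduct_add]
      map_smul' := by intro a b; ext r; simp [pairing, dotProduct_smul] }
  have hker : Φ.ker ≠ ⊥ := by
    apply LinearMap.ker_ne_bot_of_finrank_lt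
    simp only [Module.finrank_fintype_fun_eq_card, Fintype.card_fin, Fintype.card_sigma]
    omega
  obtain ⟨h, hh, h0⟩ := (Submodule.ne_bot_iff _).1 hker
  have hΦ : ∀ r < d, pairing lam h (Polynomial.X ^ r) = 0 := by
    intro r hr
    exact congrFun (LinearMap.mem_ker.1 hh) ⟨r, hr⟩
  refine ⟨h, hΦ, fun hzero => h0 ?_⟩
  by_contra hne
  obtain ⟨u₀, hu₀⟩ := Function.ne_iff.1 hne
  obtain ⟨u, hu, hmax⟩ := Finset.exists_max_image (Finset.univ.filter fun u => h u ≠ 0)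
    (fun u : Idx n => u.2.val) ⟨u₀, by simpa using hu₀⟩
  have hdeg := natDegree_X_sub_C_pow_mul_otherFactors (lam := lam) u
  have hsum := Finset.add_sum_erase Finset.univ n (Finset.mem_univ u.1)
  have hlt := u.2.isLt
  have h1 := pairing_of_natDegree_le h d hΦ _ (by rw [hdeg]; omega :
    ((Polynomial.X - Polynomial.C (lam u.1)) ^ u.2.val * otherFactors n lam u.1).natDegree ≤ d)
  rw [hzero, mul_zero, pairing_otherFactors] at h1
  · have h2 : ∏ l ∈ Finset.univ.erase u.1, (lam u.1 - lam l) ^ n l ≠ 0 := by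
      rw [Finset.prod_ne_zero_iff]
      intro l hl
      exact pow_ne_zero _ (sub_ne_zero.2 fun h => (Finset.ne_of_mem_erase hl) (hinj h).symm)
    rcases mul_eq_zero.1 h1 with h3 | h3
    · exact (Finset.mem_filter.1 hu).2 h3
    · exact h2 h3
  · intro v _ hv
    by_contra hne
    exact absurd (hmax v (Finset.mem_filter.2 ⟨Finset.mem_univ _, hne⟩)) (not_le.2 hv)

theorem jordan_mulVec_top (w : Idx n → ℂ) (u : Idx n) (hu : u.2.val + 1 = n u.1) :
    (jordan n lam *ᵥ w) u = lam u.1 * w u := by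
  unfold Matrix.mulVec dotProduct
  rw [Finset.sum_eq_single u]
  · simp [jordan]
  · intro v _ hv
    have h1 : ¬ (u.1 = v.1 ∧ u.2.val + 1 = v.2.val) := by
      rintro ⟨h1, h2⟩
      have := lt_of_lt_of_eq v.2.isLt (congrArg n h1).symm
      omega
    simp [jordan, h1, Ne.symm hv]
  · simp

theorem aeval_jordan_mulVec_top (R : Polynomial ℂ) (w : Idx n → ℂ) (u : Idx n)
    (hu : u.2.val + 1 = n u.1) :
    (Polynomial.aeval (jordan n lam) R *ᵥ w) u = R.eval (lam u.1) * w u := by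
  induction R using Polynomial.induction_on generalizing w with
  | C a =>
    rw [Polynomial.aeval_C, Algebra.algebraMap_eq_smul_one, Matrix.smul_mulVec,
      Matrix.one_mulVec]
    simp
  | add p q hp hq => rw [map_add, Matrix.add_mulVec, Pi.add_apply, hp, hq, Polynomial.eval_add,
      add_mul]
  | monomial m a ih =>
    rw [pow_succ, ← mul_assoc,
      map_mul (Polynomial.aeval (jordan n lam)) (_ * _) Polynomial.X, Polynomial.aeval_X,
      ← Matrix.mulVec_mulVec, ih, jordan_mulVec_top _ _ hu]
    simp
    ring

/-- If `e (J - λ_j^*)^s h` vanishes for all `s < r`, then `(J - λ_j^*)^r h` is orthogonal to the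
first `r` basis vectors of the block `j`. -/
theorem gram_mulVec_pow_eq_zero (hlam : ∀ i, 0 < (lam i).im) (j : Fin k) (w : Idx n → ℂ) (r : ℕ)
    (hw : ∀ s < r, pairing lam w
      ((Polynomial.X - Polynomial.C ((starRingEnd ℂ) (lam j))) ^ s) = 0)
    (u : Idx n) (huj : u.1 = j) (hur : u.2.val < r) :
    (gram n lam *ᵥ (Polynomial.aeval (jordan n lam)
      ((Polynomial.X - Polynomial.C ((starRingEnd ℂ) (lam j))) ^ r) *ᵥ w)) u = 0 := by
  induction r generalizing u with
  | zero => omega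
  | succ r ih =>
    have ih' := ih fun s hs => hw s (by omega)
    set c := (starRingEnd ℂ) (lam j) with hc
    set y := Polynomial.aeval (jordan n lam) ((Polynomial.X - Polynomial.C c) ^ r) *ᵥ w with hy
    have hev : evalVec n ⬝ᵥ y = 0 := by
      rw [← pairing_one (lam := lam), hy, ← pairing_mul, mul_one]
      exact hw r (by omega)
    have hsplit : Polynomial.aeval (jordan n lam) ((Polynomial.X - Polynomial.C c) ^ (r + 1)) *ᵥ w
        = jordan n lam *ᵥ y - c • y := by
      rw [pow_succ', map_mul, ← Matrix.mulVec_mulVec, ← hy, map_sub, Polynomial.aeval_X,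
        Polynomial.aeval_C, Algebra.algebraMap_eq_smul_one, Matrix.sub_mulVec, Matrix.smul_mulVec,
        Matrix.one_mulVec]
    rw [hsplit, Matrix.mulVec_sub, Pi.sub_apply, gram_mulVec_jordan hlam, hev, Matrix.mulVec_smul,
      Pi.smul_apply, smul_eq_mul,
      show (starRingEnd ℂ) (lam u.1) = c by rw [hc, huj]]
    split_ifs with h0
    · rw [ih' (prevIdx u) huj (by simp only [prevIdx]; omega)]
      ring
    · ring

/-- The number `e g` for the residual `g` of the last basis vector of the block `i`: the product
of the Blaschke-type factors of all other positions. -/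
def blaschke (n : Fin k → ℕ) (lam : Fin k → ℂ) (i : Fin k) : ℂ :=
  (∏ j ∈ Finset.univ.erase i, (lam i - lam j) ^ n j) /
    ∏ j, (lam i - (starRingEnd ℂ) (lam j)) ^ Function.update n i (n i - 1) j

theorem sub_conj_ne_zero (hlam : ∀ i, 0 < (lam i).im) (i j : Fin k) :
    lam i - (starRingEnd ℂ) (lam j) ≠ 0 := by
  intro h
  have := congrArg Complex.im h
  simp at this
  have h1 := hlam i
  have h2 := hlam j
  linarith

/-- The norm of a residual vector, from the Sylvester equation paired with it. -/
theorem dotProduct_gram_self (hlam : ∀ i, 0 < (lam i).im) (g : Idx n → ℂ) (u : Idx n)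
    (hu : u.2.val + 1 = n u.1) (hg : ∀ v, v ≠ u → (gram n lam *ᵥ g) v = 0) :
    star g ⬝ᵥ (gram n lam *ᵥ g) =
      ((‖evalVec n ⬝ᵥ g‖ ^ 2 / (2 * (lam u.1).im) : ℝ) : ℂ) := by
  set s := star g ⬝ᵥ (gram n lam *ᵥ g) with hs
  have hsum : ∀ w : Idx n → ℂ, star w ⬝ᵥ (gram n lam *ᵥ g) = star (w u) * (gram n lam *ᵥ g) u := by
    intro w
    unfold dotProduct
    rw [Finset.sum_eq_single u]
    · rfl
    · intro v _ hv
      rw [hg v hv, mul_zero]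
    · simp
  have hherm := star_dotProduct_mulVec_comm (gram_isHermitian (n := n) (lam := lam))
  have hsr : star s = s := by rw [hs, ← hherm]
  have h1 : star g ⬝ᵥ (gram n lam *ᵥ (jordan n lam *ᵥ g)) = lam u.1 * s := by
    rw [hherm, hsum, jordan_mulVec_top _ _ hu, star_mul', star_star, mul_assoc]
    congr 1
    rw [← hsr, hs, hsum g, star_mul', star_star]
  have h2 : star g ⬝ᵥ (gram n lam *ᵥ (jordan n lam *ᵥ g)) = (starRingEnd ℂ) (lam u.1) * s
      + Complex.I * (star (evalVec n ⬝ᵥ g) * (evalVec n ⬝ᵥ g)) := by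
    have e1 : ∀ v, star (g v) * (gram n lam *ᵥ (jordan n lam *ᵥ g)) v =
        (starRingEnd ℂ) (lam u.1) * (star (g v) * (gram n lam *ᵥ g) v) +
        Complex.I * ((evalVec n v * star (g v)) * (evalVec n ⬝ᵥ g)) := by
      intro v
      rw [gram_mulVec_jordan hlam]
      have hp : (if 0 < v.2.val then (gram n lam *ᵥ g) (prevIdx v) else 0) = 0 := by
        split_ifs with h0
        · apply hg
          intro h
          have h3 : v.1 = u.1 := (congrArg Sigma.fst h : (prevIdx v).1 = u.1)
          have h4 : v.2.val - 1 = u.2.val := congrArg (fun w : Idx n => w.2.val) h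
          have := lt_of_lt_of_eq v.2.isLt (congrArg n h3)
          omega
        · rfl
      have hd : (starRingEnd ℂ) (lam v.1) * (gram n lam *ᵥ g) v =
          (starRingEnd ℂ) (lam u.1) * (gram n lam *ᵥ g) v := by
        by_cases hv : v = u
        · rw [hv]
        · rw [hg v hv, mul_zero, mul_zero]
      rw [hp, hd]
      ring
    have e2 : star (evalVec n ⬝ᵥ g) = ∑ v, evalVec n v * star (g v) := by
      unfold dotProduct
      rw [star_sum]
      refine Finset.sum_congr rfl fun v _ => ?_
      rw [star_mul']
      unfold evalVec
      split_ifs <;> simp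
    rw [hs, e2]
    unfold dotProduct
    simp only [Pi.star_apply, e1]
    rw [Finset.sum_add_distrib, ← Finset.mul_sum, ← Finset.mul_sum, ← Finset.sum_mul]
    rfl
  have h3 : (lam u.1 - (starRingEnd ℂ) (lam u.1)) * s =
      Complex.I * (star (evalVec n ⬝ᵥ g) * (evalVec n ⬝ᵥ g)) := by
    linear_combination h2 - h1
  rw [Complex.sub_conj] at h3
  have h4 : star (evalVec n ⬝ᵥ g) * (evalVec n ⬝ᵥ g) = ((‖evalVec n ⬝ᵥ g‖ ^ 2 : ℝ) : ℂ) := by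
    rw [RCLike.star_def, Complex.conj_mul']
    push_cast
    rfl
  rw [h4] at h3
  have h5 : ((2 * (lam u.1).im : ℝ) : ℂ) ≠ 0 := by
    exact_mod_cast (mul_pos two_pos (hlam u.1)).ne'
  rw [Complex.ofReal_div, eq_div_iff h5]
  apply mul_left_cancel₀ Complex.I_ne_zero
  rw [← h3]
  ring

/-- The residual of the last basis vector of a block. It is `∏_j (J - λ_j^*)^{m_j} h`, normalised,
with `m_j` the number of the other positions in the block `j` and `h` the divided difference
functional: each factor creates the orthogonality to one more basis vector. -/
theorem exists_residual_top (hlam : ∀ i, 0 < (lam i).im) (hinj : Function.Injective lam)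
    (u : Idx n) (hu : u.2.val + 1 = n u.1) :
    ∃ g : Idx n → ℂ, g u = 1 ∧ (∀ v, v ≠ u → (gram n lam *ᵥ g) v = 0) ∧
      evalVec n ⬝ᵥ g = blaschke n lam u.1 := by
  have hpos := u.2.isLt
  have hsum := Finset.add_sum_erase Finset.univ n (Finset.mem_univ u.1)
  obtain ⟨h, hh0, hh1⟩ := exists_pairing_eq_zero (n := n) (lam := lam) (by omega) hinj
  set d := ∑ i, n i - 1 with hd
  set κ := pairing lam h (Polynomial.X ^ d) with hκ
  set m := Function.update n u.1 (n u.1 - 1) with hm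
  have hmi : m u.1 = n u.1 - 1 := by simp [hm]
  have hmj : ∀ j, j ≠ u.1 → m j = n j := by intro j hj; simp [hm, hj]
  let f : Fin k → Polynomial ℂ := fun j =>
    (Polynomial.X - Polynomial.C ((starRingEnd ℂ) (lam j))) ^ m j
  have hfm : ∀ j, (f j).Monic := fun j => (Polynomial.monic_X_sub_C _).pow _
  set R : Polynomial ℂ := ∏ j, f j with hR
  have hsm : ∑ j, m j = d := by
    rw [← Finset.add_sum_erase Finset.univ m (Finset.mem_univ u.1), hmi,
      Finset.sum_congr rfl (fun j hj => hmj j (Finset.ne_of_mem_erase hj))]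
    exact (by omega : n u.1 - 1 + ∑ j ∈ Finset.univ.erase u.1, n j = d)
  have hRm : R.Monic := Polynomial.monic_prod_of_monic _ _ fun j _ => hfm j
  have hRd : R.natDegree = d := by
    rw [hR, Polynomial.natDegree_prod_of_monic _ _ fun j _ => hfm j, ← hsm]
    simp [f]
  have hRe : R.eval (lam u.1) = ∏ j, (lam u.1 - (starRingEnd ℂ) (lam j)) ^ m j := by
    simp [hR, f, Polynomial.eval_prod]
  have hRe0 : R.eval (lam u.1) ≠ 0 := by
    rw [hRe, Finset.prod_ne_zero_iff]
    exact fun j _ => pow_ne_zero _ (sub_conj_ne_zero hlam u.1 j)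
  set g₀ := Polynomial.aeval (jordan n lam) R *ᵥ h with hg₀
  have heg : evalVec n ⬝ᵥ g₀ = κ := by
    rw [← pairing_one (lam := lam), hg₀, ← pairing_mul, mul_one,
      pairing_of_natDegree_le h d hh0 R hRd.le]
    have : R.coeff d = 1 := by rw [← hRd]; exact hRm
    rw [this, one_mul]
  have htop : g₀ u = R.eval (lam u.1) * h u := aeval_jordan_mulVec_top R h u hu
  have hhu : h u * ∏ l ∈ Finset.univ.erase u.1, (lam u.1 - lam l) ^ n l = κ := by
    have hmon :
        ((Polynomial.X - Polynomial.C (lam u.1)) ^ u.2.val * otherFactors n lam u.1).Monic :=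
      ((Polynomial.monic_X_sub_C _).pow _).mul
        (Polynomial.monic_prod_of_monic _ _ fun l _ => (Polynomial.monic_X_sub_C _).pow _)
    have hdeg := natDegree_X_sub_C_pow_mul_otherFactors (lam := lam) u
    have hdeg' : u.2.val + ∑ l ∈ Finset.univ.erase u.1, n l = d := by omega
    rw [hdeg'] at hdeg
    rw [← pairing_otherFactors, pairing_of_natDegree_le h d hh0 _ hdeg.le, ← hκ]
    · have : ((Polynomial.X - Polynomial.C (lam u.1)) ^ u.2.val *
          otherFactors n lam u.1).coeff d = 1 := by
        rw [← hdeg]; exact hmon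
      rw [this, one_mul]
    · intro v hv1 hv2
      have := lt_of_lt_of_eq v.2.isLt (congrArg n hv1)
      omega
  have hu0 : h u ≠ 0 := by
    intro h0
    rw [h0, zero_mul] at hhu
    exact hh1 hhu.symm
  have horth : ∀ v, v ≠ u → (gram n lam *ᵥ g₀) v = 0 := by
    intro v hv
    have hvm : v.2.val < m v.1 := by
      by_cases h1 : v.1 = u.1
      · have hlt := lt_of_lt_of_eq v.2.isLt (congrArg n h1)
        refine lt_of_lt_of_eq (b := n u.1 - 1) ?_ (by rw [h1, hmi])
        have : v.2.val ≠ u.2.val := fun h2 => hv (Idx.ext' h1 h2)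
        omega
      · rw [hmj _ h1]
        exact v.2.isLt
    -- apply the factor of the block of `v` last
    have hRsplit : R = f v.1 * ∏ j ∈ Finset.univ.erase v.1, f j := by
      rw [Finset.mul_prod_erase _ _ (Finset.mem_univ _)]
    rw [hg₀, hRsplit, map_mul, ← Matrix.mulVec_mulVec]
    refine gram_mulVec_pow_eq_zero hlam v.1 _ (m v.1) ?_ v rfl hvm
    intro s hs
    rw [← pairing_mul]
    have hmon' : (∏ j ∈ Finset.univ.erase v.1, f j).Monic :=
      Polynomial.monic_prod_of_monic _ _ fun j _ => hfm j
    have hdeg : ((∏ j ∈ Finset.univ.erase v.1, f j) *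
        (Polynomial.X - Polynomial.C ((starRingEnd ℂ) (lam v.1))) ^ s).natDegree < d := by
      rw [hmon'.natDegree_mul ((Polynomial.monic_X_sub_C _).pow _),
        Polynomial.natDegree_prod_of_monic _ _ fun j _ => hfm j]
      have := Finset.add_sum_erase Finset.univ m (Finset.mem_univ v.1)
      simp only [f, Polynomial.natDegree_pow, Polynomial.natDegree_X_sub_C, mul_one]
      omega
    rw [pairing_of_natDegree_le h d hh0 _ hdeg.le, Polynomial.coeff_eq_zero_of_natDegree_lt hdeg,
      zero_mul]
  have hg0 : g₀ u ≠ 0 := by rw [htop]; exact mul_ne_zero hRe0 hu0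
  refine ⟨(g₀ u)⁻¹ • g₀, ?_, ?_, ?_⟩
  · simp [hg0]
  · intro v hv
    rw [Matrix.mulVec_smul, Pi.smul_apply, horth v hv, smul_zero]
  · rw [dotProduct_smul, heg, htop, blaschke, ← hm, ← hRe, ← hhu, smul_eq_mul]
    field_simp

end

end Hirota

namespace Hirota

noncomputable section

open Matrix

variable {k : ℕ} {n m : Fin k → ℕ} {lam : Fin k → ℂ}

/-! ### Sub-systems and positive definiteness -/

/-- Positions for smaller orders `m ≤ n`, as positions for the orders `n`. -/
def embIdx (hm : ∀ j, m j ≤ n j) (u : Idx m) : Idx n := ⟨u.1, Fin.castLE (hm u.1) u.2⟩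

/-- Extension by zero of a vector for the orders `m` to one for the orders `n`. -/
def extVec (n : Fin k → ℕ) (g : Idx m → ℂ) : Idx n → ℂ :=
  fun u => if h : u.2.val < m u.1 then g ⟨u.1, ⟨u.2.val, h⟩⟩ else 0

theorem embIdx_injective (hm : ∀ j, m j ≤ n j) : Function.Injective (embIdx hm) := by
  intro u v h
  exact Idx.ext' (congrArg Sigma.fst h : (embIdx hm u).1 = _)
    (congrArg (fun w : Idx n => w.2.val) h)

theorem extVec_embIdx (hm : ∀ j, m j ≤ n j) (g : Idx m → ℂ) (u : Idx m) :
    extVec n g (embIdx hm u) = g u := by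
  have : (embIdx hm u).2.val < m (embIdx hm u).1 := u.2.isLt
  rw [extVec, dif_pos this]
  rfl

theorem sum_extVec (hm : ∀ j, m j ≤ n j) (g : Idx m → ℂ) (f : Idx n → ℂ) :
    f ⬝ᵥ extVec n g = (fun u => f (embIdx hm u)) ⬝ᵥ g := by
  unfold dotProduct
  symm
  apply Fintype.sum_of_injective (embIdx hm) (embIdx_injective hm)
  · intro u hu
    rw [extVec, dif_neg, mul_zero]
    intro h
    exact hu ⟨⟨u.1, ⟨u.2.val, h⟩⟩, rfl⟩
  · intro u
    rw [extVec_embIdx]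

theorem gram_mulVec_extVec (hm : ∀ j, m j ≤ n j) (g : Idx m → ℂ) (u : Idx m) :
    (gram n lam *ᵥ extVec n g) (embIdx hm u) = (gram m lam *ᵥ g) u := by
  unfold Matrix.mulVec
  rw [sum_extVec hm]
  rfl

theorem evalVec_extVec (hm : ∀ j, m j ≤ n j) (g : Idx m → ℂ) :
    evalVec n ⬝ᵥ extVec n g = evalVec m ⬝ᵥ g := by
  rw [sum_extVec hm]
  rfl

theorem form_extVec (hm : ∀ j, m j ≤ n j) (g : Idx m → ℂ) :
    star (extVec n g) ⬝ᵥ (gram n lam *ᵥ extVec n g) = star g ⬝ᵥ (gram m lam *ᵥ g) := by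
  have h1 : star (extVec n g) = extVec n (star g) := by
    ext u
    simp only [extVec, Pi.star_apply]
    split_ifs <;> simp
  rw [h1, dotProduct_comm, sum_extVec hm, dotProduct_comm]
  congr 1
  ext u
  rw [gram_mulVec_extVec hm]

/-- Gram–Schmidt for the Gram matrix: the part of the last basis vector of the block `u.1` that is
orthogonal to the other basis vectors of the sub-system with orders `m`. -/
theorem exists_residual (hlam : ∀ i, 0 < (lam i).im) (hinj : Function.Injective lam)
    (hm : ∀ j, m j ≤ n j) (u : Idx n) (hu : u.2.val + 1 = m u.1) :
    ∃ g : Idx n → ℂ, g u = 1 ∧ (∀ v : Idx n, m v.1 ≤ v.2.val → g v = 0) ∧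
      (∀ v : Idx n, v ≠ u → v.2.val < m v.1 → (gram n lam *ᵥ g) v = 0) ∧
      evalVec n ⬝ᵥ g = blaschke m lam u.1 ∧
      star g ⬝ᵥ (gram n lam *ᵥ g) =
        ((‖blaschke m lam u.1‖ ^ 2 / (2 * (lam u.1).im) : ℝ) : ℂ) := by
  let u' : Idx m := ⟨u.1, ⟨u.2.val, by omega⟩⟩
  have hu' : embIdx hm u' = u := rfl
  obtain ⟨g, hg1, hg2, hg3⟩ := exists_residual_top hlam hinj u' hu
  refine ⟨extVec n g, ?_, ?_, ?_, ?_, ?_⟩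
  · rw [← hu', extVec_embIdx, hg1]
  · intro v hv
    rw [extVec, dif_neg (not_lt.2 hv)]
  · intro v hv hlt
    have : v = embIdx hm ⟨v.1, ⟨v.2.val, hlt⟩⟩ := rfl
    rw [this, gram_mulVec_extVec]
    apply hg2
    intro h
    apply hv
    rw [this, h, hu']
  · rw [evalVec_extVec hm, hg3]
  · rw [form_extVec hm, dotProduct_gram_self hlam g u' hu hg2, hg3]

theorem blaschke_ne_zero (hlam : ∀ i, 0 < (lam i).im) (hinj : Function.Injective lam)
    (i : Fin k) : blaschke m lam i ≠ 0 := by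
  apply div_ne_zero
  · rw [Finset.prod_ne_zero_iff]
    intro l hl
    exact pow_ne_zero _ (sub_ne_zero.2 fun h => (Finset.ne_of_mem_erase hl) (hinj h).symm)
  · rw [Finset.prod_ne_zero_iff]
    exact fun j _ => pow_ne_zero _ (sub_conj_ne_zero hlam i j)

theorem gram_pos (hlam : ∀ i, 0 < (lam i).im) (hinj : Function.Injective lam)
    (v : Idx n → ℂ) (hv : v ≠ 0) : 0 < (star v ⬝ᵥ (gram n lam *ᵥ v)).re := by
  obtain ⟨N, hN⟩ : ∃ N, N = ∑ i, n i := ⟨_, rfl⟩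
  induction N generalizing n with
  | zero =>
    exfalso
    apply hv
    ext u
    have h1 := u.2.isLt
    have h2 := Finset.single_le_sum (f := n) (fun i _ => Nat.zero_le _) (Finset.mem_univ u.1)
    omega
  | succ N ih =>
    obtain ⟨u₀, -⟩ := Function.ne_iff.1 hv
    have hpos := u₀.2.isLt
    let u : Idx n := ⟨u₀.1, ⟨n u₀.1 - 1, by omega⟩⟩
    have hu : u.2.val + 1 = n u.1 := by simp only [u]; omega
    obtain ⟨g, hg1, -, hg3, -, hg5⟩ := exists_residual hlam hinj (fun j => le_refl (n j)) u hu
    set m := Function.update n u.1 (n u.1 - 1) with hmdef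
    have hm : ∀ j, m j ≤ n j := by
      intro j
      by_cases h : j = u.1
      · rw [h]; simp [hmdef]
      · simp [hmdef, h]
    have hmN : N = ∑ i, m i := by
      have h1 := Finset.add_sum_erase Finset.univ n (Finset.mem_univ u.1)
      rw [← Finset.add_sum_erase Finset.univ m (Finset.mem_univ u.1),
        Finset.sum_congr rfl (g := n) (fun j hj => by
          simp [hmdef, Finset.ne_of_mem_erase hj])]
      have h2 : m u.1 = n u.1 - 1 := by simp [hmdef]
      exact (by omega : N = m u.1 + ∑ j ∈ Finset.univ.erase u.1, n j)
    set w := v - v u • g with hw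
    have hwu : w u = 0 := by simp [hw, hg1]
    set w' : Idx m → ℂ := fun x => w (embIdx hm x) with hw'
    have hww : w = extVec n w' := by
      ext x
      unfold extVec
      split_ifs with h
      · rfl
      · have : x = u := by
          have hx := x.2.isLt
          by_cases h1 : x.1 = u.1
          · apply Idx.ext' h1
            have h2 : m x.1 = n u.1 - 1 := by rw [h1]; simp [hmdef]
            have h3 := lt_of_lt_of_eq x.2.isLt (congrArg n h1)
            omega
          · have h2 : m x.1 = n x.1 := by simp [hmdef, h1]
            omega
        rw [this, hwu]
    have hgz : ∀ x, x ≠ u → (gram n lam *ᵥ g) x = 0 := fun x hx => hg3 x hx x.2.isLt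
    have hc1 : star w ⬝ᵥ (gram n lam *ᵥ g) = 0 := by
      unfold dotProduct
      apply Finset.sum_eq_zero
      intro x _
      by_cases hx : x = u
      · rw [hx, Pi.star_apply, hwu, star_zero, zero_mul]
      · rw [hgz x hx, mul_zero]
    have hc2 : star g ⬝ᵥ (gram n lam *ᵥ w) = 0 := by
      rw [star_dotProduct_mulVec_comm gram_isHermitian, hc1, star_zero]
    have hvw : v = w + v u • g := by rw [hw]; abel
    have hform : star v ⬝ᵥ (gram n lam *ᵥ v) = star w' ⬝ᵥ (gram m lam *ᵥ w') +
        (star (v u) * v u) * (star g ⬝ᵥ (gram n lam *ᵥ g)) := by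
      rw [← form_extVec hm, ← hww]
      conv_lhs => rw [hvw]
      rw [star_add, star_smul, Matrix.mulVec_add, Matrix.mulVec_smul, add_dotProduct,
        dotProduct_add, dotProduct_add, smul_dotProduct, smul_dotProduct, dotProduct_smul,
        dotProduct_smul, hc1, hc2]
      simp only [smul_eq_mul]
      ring
    have hreal : ((star (v u) * v u) * (star g ⬝ᵥ (gram n lam *ᵥ g))).re
        = ‖v u‖ ^ 2 * (‖blaschke n lam u.1‖ ^ 2 / (2 * (lam u.1).im)) := by
      rw [hg5, RCLike.star_def, Complex.conj_mul', Complex.re_mul_ofReal]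
      congr 1
      rw [← Complex.ofReal_pow, Complex.ofReal_re]
    have hb : 0 < ‖blaschke n lam u.1‖ ^ 2 / (2 * (lam u.1).im) := by
      have h1 := norm_pos_iff.2 (blaschke_ne_zero (m := n) hlam hinj u.1)
      have h2 := hlam u.1
      positivity
    rw [hform, Complex.add_re, hreal]
    by_cases hw0 : w' = 0
    · have hvu : v u ≠ 0 := by
        intro h0
        apply hv
        rw [hvw, hww, hw0, h0, zero_smul, add_zero]
        ext x
        simp [extVec]
      have := norm_pos_iff.2 hvu
      rw [hw0]
      simp only [star_zero, zero_dotProduct, Complex.zero_re, zero_add]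
      positivity
    · have h1 := ih w' hw0 hmN
      have h2 : 0 ≤ ‖v u‖ ^ 2 * (‖blaschke n lam u.1‖ ^ 2 / (2 * (lam u.1).im)) := by positivity
      linarith

end

end Hirota

namespace Hirota

noncomputable section

open Matrix
open scoped Matrix.Norms.Operator

variable {ι : Type*} [Fintype ι]

/-! ### The soliton as a function of a subspace -/

/-- The Gram matrix of the columns of `[A₁; A₂]` for the form `G ⊕ G`. -/
def pairGram (G A₁ A₂ : Matrix ι ι ℂ) : Matrix ι ι ℂ := A₁ᴴ * G * A₁ + A₂ᴴ * G * A₂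

/-- The number `(e A₁) Γ⁻¹ (e A₂)^†`, where `Γ` is the Gram matrix of the columns of `[A₁; A₂]`.
If `e` is represented by `f` for the form `G`, it is the matrix element of the orthogonal projection
onto the column space of `[A₁; A₂]` between `(f, 0)` and `(0, f)`. -/
def projForm [DecidableEq ι] (G : Matrix ι ι ℂ) (e : ι → ℂ) (A₁ A₂ : Matrix ι ι ℂ) : ℂ :=
  (e ᵥ* A₁) ⬝ᵥ ((pairGram G A₁ A₂)⁻¹ *ᵥ star (e ᵥ* A₂))

/-- `projForm` depends on the column space of `[A₁; A₂]` only. -/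
theorem projForm_mul [DecidableEq ι] (G : Matrix ι ι ℂ) (e : ι → ℂ) (A₁ A₂ C : Matrix ι ι ℂ)
    (hC : IsUnit C.det) :
    projForm G e (A₁ * C) (A₂ * C) = projForm G e A₁ A₂ := by
  have h1 : pairGram G (A₁ * C) (A₂ * C) = Cᴴ * pairGram G A₁ A₂ * C := by
    simp only [pairGram, Matrix.conjTranspose_mul, Matrix.mul_add, Matrix.add_mul, Matrix.mul_assoc]
  have hCH : IsUnit (Cᴴ).det := by
    rw [Matrix.det_conjTranspose]
    exact hC.star
  unfold projForm
  rw [h1, Matrix.mul_inv_rev, Matrix.mul_inv_rev, ← Matrix.vecMul_vecMul, ← Matrix.vecMul_vecMul,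
    Matrix.star_vecMul C, ← Matrix.dotProduct_mulVec, Matrix.mulVec_mulVec, Matrix.mulVec_mulVec,
    Matrix.mul_nonsing_inv_cancel_left _ _ hC, Matrix.mul_assoc, Matrix.nonsing_inv_mul _ hCH,
    Matrix.mul_one]

theorem star_dotProduct_pairGram (G A₁ A₂ : Matrix ι ι ℂ) (v w : ι → ℂ) :
    star v ⬝ᵥ (pairGram G A₁ A₂ *ᵥ w) =
      star (A₁ *ᵥ v) ⬝ᵥ (G *ᵥ (A₁ *ᵥ w)) + star (A₂ *ᵥ v) ⬝ᵥ (G *ᵥ (A₂ *ᵥ w)) := by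
  have h : ∀ A : Matrix ι ι ℂ, star v ⬝ᵥ ((Aᴴ * G * A) *ᵥ w) =
      star (A *ᵥ v) ⬝ᵥ (G *ᵥ (A *ᵥ w)) := by
    intro A
    rw [Matrix.star_mulVec, ← Matrix.dotProduct_mulVec, Matrix.mulVec_mulVec,
      Matrix.mulVec_mulVec, Matrix.mul_assoc]
  rw [pairGram, Matrix.add_mulVec, dotProduct_add, h, h]

theorem pairGram_isHermitian {G : Matrix ι ι ℂ} (hG : G.IsHermitian) (A₁ A₂ : Matrix ι ι ℂ) :
    (pairGram G A₁ A₂).IsHermitian := by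
  unfold pairGram Matrix.IsHermitian
  simp only [Matrix.conjTranspose_add, Matrix.conjTranspose_mul, Matrix.conjTranspose_conjTranspose,
    hG.eq, Matrix.mul_assoc]

theorem isUnit_det_of_pos [DecidableEq ι] {Γ : Matrix ι ι ℂ}
    (h : ∀ v, v ≠ 0 → 0 < (star v ⬝ᵥ (Γ *ᵥ v)).re) : IsUnit Γ.det := by
  rw [isUnit_iff_ne_zero]
  intro h0
  obtain ⟨v, hv, hv0⟩ := Matrix.exists_mulVec_eq_zero_iff.2 h0
  have := h v hv
  rw [hv0] at this
  simp at this

theorem pairGram_pos {G : Matrix ι ι ℂ} (hG : ∀ v, v ≠ 0 → 0 < (star v ⬝ᵥ (G *ᵥ v)).re)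
    (A₁ A₂ : Matrix ι ι ℂ) (hA : ∀ v, A₁ *ᵥ v = 0 → A₂ *ᵥ v = 0 → v = 0) (v : ι → ℂ) (hv : v ≠ 0) :
    0 < (star v ⬝ᵥ (pairGram G A₁ A₂ *ᵥ v)).re := by
  have hnn : ∀ w, 0 ≤ (star w ⬝ᵥ (G *ᵥ w)).re := by
    intro w
    by_cases hw : w = 0
    · simp [hw]
    · exact (hG w hw).le
  rw [star_dotProduct_pairGram, Complex.add_re]
  by_cases h1 : A₁ *ᵥ v = 0
  · have h2 : A₂ *ᵥ v ≠ 0 := fun h2 => hv (hA v h1 h2)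
    linarith [hnn (A₁ *ᵥ v), hG _ h2]
  · linarith [hnn (A₂ *ᵥ v), hG _ h1]

/-- A system of columns is split into columns of the first kind (`A₂` vanishes), columns of the
second kind (`A₁` vanishes) and one column `u₀`. If subtracting other columns from the column `u₀`
gives a column `(ξ g₁, η g₂)` orthogonal to all others, then only this one contributes. -/
theorem projForm_eq_of_mixed_column [DecidableEq ι] {G : Matrix ι ι ℂ} (hG : G.IsHermitian)
    (e : ι → ℂ) (A₁ A₂ : Matrix ι ι ℂ)
    (hpos : ∀ v, v ≠ 0 → 0 < (star v ⬝ᵥ (pairGram G A₁ A₂ *ᵥ v)).re)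
    (u₀ : ι) (P : ι → Prop) (hP1 : ∀ u, u ≠ u₀ → P u → ∀ w, A₂ w u = 0)
    (hP2 : ∀ u, u ≠ u₀ → ¬ P u → ∀ w, A₁ w u = 0)
    (y₀ : ι → ℂ) (hy₀ : y₀ u₀ = 1) (s : ℝ)
    (hs : pairGram G A₁ A₂ *ᵥ y₀ = Pi.single u₀ (s : ℂ)) :
    projForm G e A₁ A₂ = (e ⬝ᵥ (A₁ *ᵥ y₀)) * star (e ⬝ᵥ (A₂ *ᵥ y₀)) / s := by
  classical
  set Γ := pairGram G A₁ A₂ with hΓ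
  have hΓh : Γ.IsHermitian := pairGram_isHermitian hG A₁ A₂
  have hy0 : y₀ ≠ 0 := by
    intro h
    rw [h] at hy₀
    simp at hy₀
  have hs0 : (s : ℂ) ≠ 0 := by
    have h1 := hpos y₀ hy0
    rw [hs] at h1
    intro h0
    rw [h0] at h1
    simp at h1
  have hdet := isUnit_det_of_pos hpos
  set b := star (e ᵥ* A₂) with hb
  set x := Γ⁻¹ *ᵥ b with hx
  have hΓx : Γ *ᵥ x = b := by
    rw [hx, Matrix.mulVec_mulVec, Matrix.mul_nonsing_inv _ hdet, Matrix.one_mulVec]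
  have hsb : ∀ v, star v ⬝ᵥ b = star (e ⬝ᵥ (A₂ *ᵥ v)) := by
    intro v
    rw [hb, Matrix.dotProduct_mulVec, Matrix.star_dotProduct_star, dotProduct_comm]
  have hys : ∀ v, star v ⬝ᵥ (Γ *ᵥ y₀) = star (v u₀) * s := by
    intro v
    rw [hs, dotProduct_single]
    rfl
  have hxu : x u₀ = star (e ⬝ᵥ (A₂ *ᵥ y₀)) / s := by
    rw [eq_div_iff hs0, ← hsb, ← hΓx, star_dotProduct_mulVec_comm hΓh, hys, star_mul', star_star]
    simp
  set z := x - x u₀ • y₀ with hz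
  have hzu : z u₀ = 0 := by simp [hz, hy₀]
  set z₁ : ι → ℂ := fun u => if u ≠ u₀ ∧ P u then z u else 0 with hz₁
  set z₂ : ι → ℂ := fun u => if u ≠ u₀ ∧ ¬ P u then z u else 0 with hz₂
  have hz12 : z = z₁ + z₂ := by
    ext u
    simp only [hz₁, hz₂, Pi.add_apply]
    by_cases h1 : u = u₀
    · simp [h1, hzu]
    · by_cases h2 : P u <;> simp [h1, h2]
  have hA1z2 : A₁ *ᵥ z₂ = 0 := by
    ext w
    refine Finset.sum_eq_zero fun u _ => ?_
    simp only [hz₂]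
    split_ifs with h
    · rw [hP2 u h.1 h.2, zero_mul]
    · rw [mul_zero]
  have hA2z1 : A₂ *ᵥ z₁ = 0 := by
    ext w
    refine Finset.sum_eq_zero fun u _ => ?_
    simp only [hz₁]
    split_ifs with h
    · rw [hP1 u h.1 h.2, zero_mul]
    · rw [mul_zero]
  have hz1u : z₁ u₀ = 0 := by simp [hz₁]
  have hxz : x = z₁ + z₂ + x u₀ • y₀ := by rw [← hz12, hz]; abel
  have h11 : star z₁ ⬝ᵥ (Γ *ᵥ z₁) = 0 := by
    have h1 : star z₁ ⬝ᵥ (Γ *ᵥ x) = 0 := by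
      rw [hΓx, hsb, hA2z1, dotProduct_zero, star_zero]
    have h2 : star z₁ ⬝ᵥ (Γ *ᵥ z₂) = 0 := by
      rw [star_dotProduct_pairGram, hA1z2, hA2z1]
      simp
    rw [hxz, Matrix.mulVec_add, Matrix.mulVec_add, Matrix.mulVec_smul, dotProduct_add,
      dotProduct_add, dotProduct_smul, h2, hys, hz1u] at h1
    simpa using h1
  have hz10 : z₁ = 0 := by
    by_contra h
    have := hpos z₁ h
    rw [h11] at this
    simp at this
  have hfin : (e ᵥ* A₁) ⬝ᵥ x = x u₀ * (e ⬝ᵥ (A₁ *ᵥ y₀)) := by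
    rw [← Matrix.dotProduct_mulVec, hxz, hz10, zero_add, Matrix.mulVec_add, hA1z2, zero_add,
      Matrix.mulVec_smul, dotProduct_smul, smul_eq_mul, Pi.add_apply]
    simp [hz₂, hy₀]
  unfold projForm
  rw [← hΓ, ← hb, ← hx, hfin, hxu]
  ring

/-! ### Stability of the projection -/

theorem linfty_norm_le (A : Matrix ι ι ℂ) (ε : ℝ) (hε : 0 ≤ ε) (hA : ∀ i j, ‖A i j‖ ≤ ε) :
    ‖A‖ ≤ Fintype.card ι * ε := by
  lift ε to NNReal using hε
  have : ‖A‖₊ ≤ Fintype.card ι * ε := by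
    rw [Matrix.linfty_opNNNorm_def]
    refine Finset.sup_le fun i _ => ?_
    calc ∑ j, ‖A i j‖₊ ≤ ∑ _j : ι, ε := Finset.sum_le_sum fun j _ => hA i j
      _ = (Fintype.card ι : NNReal) * ε := by simp
  exact_mod_cast this

theorem norm_dotProduct_le' (v w : ι → ℂ) : ‖v ⬝ᵥ w‖ ≤ Fintype.card ι * ‖v‖ * ‖w‖ := by
  unfold dotProduct
  calc ‖∑ i, v i * w i‖ ≤ ∑ i : ι, ‖v i * w i‖ := norm_sum_le _ _
    _ ≤ ∑ i : ι, ‖v‖ * ‖w‖ := Finset.sum_le_sum fun i _ => by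
        rw [norm_mul]
        exact mul_le_mul (norm_le_pi_norm v i) (norm_le_pi_norm w i) (norm_nonneg _) (norm_nonneg _)
    _ = _ := by simp; ring

theorem inverse_perturbation [DecidableEq ι] {A B : Matrix ι ι ℂ} (hA : IsUnit A.det)
    (h : ‖A⁻¹‖ * ‖B - A‖ ≤ 1 / 2) :
    IsUnit B.det ∧ ‖B⁻¹‖ ≤ 2 * ‖A⁻¹‖ ∧ ‖B⁻¹ - A⁻¹‖ ≤ 2 * ‖A⁻¹‖ ^ 2 * ‖B - A‖ := by
  have hB : IsUnit B.det := by
    rw [isUnit_iff_ne_zero]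
    intro h0
    obtain ⟨v, hv, hv0⟩ := Matrix.exists_mulVec_eq_zero_iff.2 h0
    have h1 : v = -((A⁻¹ * (B - A)) *ᵥ v) := by
      rw [Matrix.mul_sub, Matrix.nonsing_inv_mul _ hA, Matrix.sub_mulVec, ← Matrix.mulVec_mulVec,
        hv0, Matrix.one_mulVec]
      simp
    have h2 : ‖v‖ ≤ 1 / 2 * ‖v‖ := by
      conv_lhs => rw [h1]
      rw [norm_neg]
      refine (Matrix.linfty_opNorm_mulVec _ _).trans ?_
      exact mul_le_mul_of_nonneg_right ((norm_mul_le _ _).trans h) (norm_nonneg _)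
    have h3 := norm_pos_iff.2 hv
    linarith
  have hid : B⁻¹ - A⁻¹ = -(A⁻¹ * (B - A) * B⁻¹) := by
    rw [Matrix.mul_sub, Matrix.sub_mul, Matrix.nonsing_inv_mul _ hA, Matrix.mul_assoc,
      Matrix.mul_nonsing_inv _ hB]
    simp
  have hn : ‖B⁻¹ - A⁻¹‖ ≤ ‖A⁻¹‖ * ‖B - A‖ * ‖B⁻¹‖ := by
    rw [hid, norm_neg]
    refine (norm_mul_le _ _).trans ?_
    exact mul_le_mul_of_nonneg_right (norm_mul_le _ _) (norm_nonneg _)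
  have h2 : ‖B⁻¹‖ ≤ 2 * ‖A⁻¹‖ := by
    have h3 : ‖B⁻¹‖ ≤ ‖B⁻¹ - A⁻¹‖ + ‖A⁻¹‖ := by
      simpa using norm_add_le (B⁻¹ - A⁻¹) A⁻¹
    have h4 := mul_le_mul_of_nonneg_right h (norm_nonneg B⁻¹)
    linarith
  refine ⟨hB, h2, hn.trans ?_⟩
  have := mul_le_mul_of_nonneg_left h2 (mul_nonneg (norm_nonneg A⁻¹) (norm_nonneg (B - A)))
  nlinarith

theorem norm_inv_le_of_coercive [DecidableEq ι] {Γ : Matrix ι ι ℂ} {c : ℝ} (hc : 0 < c)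
    (h : ∀ v, c * ∑ i, ‖v i‖ ^ 2 ≤ (star v ⬝ᵥ (Γ *ᵥ v)).re) :
    IsUnit Γ.det ∧ ‖Γ⁻¹‖ ≤ Fintype.card ι * (1 / c) := by
  have hdet : IsUnit Γ.det := by
    apply isUnit_det_of_pos
    intro v hv
    obtain ⟨i, hi⟩ := Function.ne_iff.1 hv
    refine lt_of_lt_of_le (mul_pos hc ?_) (h v)
    exact Finset.sum_pos' (fun i _ => by positivity)
      ⟨i, Finset.mem_univ _, by have := norm_pos_iff.2 hi; positivity⟩
  refine ⟨hdet, linfty_norm_le _ _ (by positivity) fun i j => ?_⟩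
  set x : ι → ℂ := Γ⁻¹ *ᵥ Pi.single j 1 with hx
  have hxi : ∀ i, Γ⁻¹ i j = x i := by intro i; simp [hx]
  have hΓx : Γ *ᵥ x = Pi.single j 1 := by
    rw [hx, Matrix.mulVec_mulVec, Matrix.mul_nonsing_inv _ hdet, Matrix.one_mulVec]
  have h1 := h x
  rw [hΓx, dotProduct_single, mul_one] at h1
  have h2 : (star x j).re ≤ ‖x j‖ := by
    rw [Pi.star_apply, ← norm_star (x j)]
    exact Complex.re_le_norm _
  have h3 : ∀ i, ‖x i‖ ^ 2 ≤ ∑ i, ‖x i‖ ^ 2 := fun i =>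
    Finset.single_le_sum (f := fun i => ‖x i‖ ^ 2) (fun i _ => by positivity) (Finset.mem_univ i)
  have h4 : c * ‖x j‖ ≤ 1 := by
    by_contra hcon
    push Not at hcon
    have := mul_le_mul_of_nonneg_left (h3 j) hc.le
    have hpos : 0 < ‖x j‖ := by
      by_contra h0
      have : ‖x j‖ = 0 := le_antisymm (not_lt.1 h0) (norm_nonneg _)
      rw [this] at hcon
      linarith
    nlinarith
  rw [hxi, le_div_iff₀ hc]
  have h5 := mul_le_mul_of_nonneg_left (h3 i) hc.le
  have h6 : (‖x i‖ * c) ^ 2 ≤ 1 := by nlinarith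
  nlinarith [norm_nonneg (x i)]

theorem coercive_of_pos {G : Matrix ι ι ℂ} (hG : ∀ v, v ≠ 0 → 0 < (star v ⬝ᵥ (G *ᵥ v)).re) :
    ∃ c > 0, ∀ v, c * ∑ i, ‖v i‖ ^ 2 ≤ (star v ⬝ᵥ (G *ᵥ v)).re := by
  rcases isEmpty_or_nonempty ι with hι | hι
  · exact ⟨1, one_pos, fun v => by simp [dotProduct]⟩
  have hcont : Continuous fun v : ι → ℂ => (star v ⬝ᵥ (G *ᵥ v)).re := by
    unfold dotProduct Matrix.mulVec dotProduct
    simp only [Pi.star_apply]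
    fun_prop
  obtain ⟨v₀, hv₀, hmin⟩ := (isCompact_sphere (0 : ι → ℂ) 1).exists_isMinOn
    (NormedSpace.sphere_nonempty.2 zero_le_one) hcont.continuousOn
  have hv₀1 : ‖v₀‖ = 1 := by simpa using hv₀
  have hm := hG v₀ (by intro h; rw [h] at hv₀1; simp at hv₀1)
  set μ := (star v₀ ⬝ᵥ (G *ᵥ v₀)).re with hμ
  have hN : (0 : ℝ) < Fintype.card ι := by exact_mod_cast Fintype.card_pos
  refine ⟨μ / Fintype.card ι, by positivity, fun v => ?_⟩
  by_cases hv : v = 0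
  · simp [hv]
  have hvn := norm_pos_iff.2 hv
  set w : ι → ℂ := ((‖v‖⁻¹ : ℝ) : ℂ) • v with hw
  have hw1 : ‖w‖ = 1 := by
    rw [hw, norm_smul, Complex.norm_real, norm_inv, norm_norm, inv_mul_cancel₀ hvn.ne']
  have h1 : μ ≤ (star w ⬝ᵥ (G *ᵥ w)).re := hmin (by simpa using hw1)
  have h2 : (star w ⬝ᵥ (G *ᵥ w)).re = (‖v‖⁻¹) ^ 2 * (star v ⬝ᵥ (G *ᵥ v)).re := by
    rw [hw, star_smul, Matrix.mulVec_smul, smul_dotProduct, dotProduct_smul, smul_eq_mul,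
      smul_eq_mul, RCLike.star_def, Complex.conj_ofReal, ← mul_assoc, ← Complex.ofReal_mul,
      Complex.re_ofReal_mul]
    ring
  have h3 : μ * ‖v‖ ^ 2 ≤ (star v ⬝ᵥ (G *ᵥ v)).re := by
    rw [h2, inv_pow, inv_mul_eq_div, le_div_iff₀ (by positivity)] at h1
    exact h1
  have h4 : ∑ i, ‖v i‖ ^ 2 ≤ Fintype.card ι * ‖v‖ ^ 2 := by
    calc ∑ i, ‖v i‖ ^ 2 ≤ ∑ i : ι, ‖v‖ ^ 2 := Finset.sum_le_sum fun i _ => by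
          have := norm_le_pi_norm v i
          gcongr
      _ = _ := by simp
  calc μ / Fintype.card ι * ∑ i, ‖v i‖ ^ 2 ≤ μ / Fintype.card ι * (Fintype.card ι * ‖v‖ ^ 2) := by
        gcongr
    _ = μ * ‖v‖ ^ 2 := by field_simp
    _ ≤ _ := h3

/-- `projForm` is Lipschitz near bounded, uniformly independent systems of columns. The constants
depend on `G`, `e` and the lower bound `c` only. -/
theorem projForm_lipschitz [DecidableEq ι] {G : Matrix ι ι ℂ}
    (hG : ∀ v, v ≠ 0 → 0 < (star v ⬝ᵥ (G *ᵥ v)).re) (e : ι → ℂ) {c : ℝ} (hc : 0 < c) :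
    ∃ K > 0, ∃ r > 0, ∀ A₁ A₂ B₁ B₂ : Matrix ι ι ℂ,
      (∀ i j, ‖A₁ i j‖ ≤ 1) → (∀ i j, ‖A₂ i j‖ ≤ 1) →
      (∀ v, c * ∑ i, ‖v i‖ ^ 2 ≤ ∑ i, ‖(A₁ *ᵥ v) i‖ ^ 2 + ∑ i, ‖(A₂ *ᵥ v) i‖ ^ 2) →
      ∀ ε, 0 ≤ ε → ε ≤ r → (∀ i j, ‖B₁ i j - A₁ i j‖ ≤ ε) → (∀ i j, ‖B₂ i j - A₂ i j‖ ≤ ε) →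
      ‖projForm G e B₁ B₂ - projForm G e A₁ A₂‖ ≤ K * ε := by
  obtain ⟨g₀, hg₀, hco⟩ := coercive_of_pos hG
  set N : ℝ := (Fintype.card ι : ℝ) with hN
  have hN0 : 0 ≤ N := by positivity
  set κ : ℝ := N * (1 / (g₀ * c)) with hκ
  have hκ0 : 0 ≤ κ := by positivity
  set L : ℝ := 6 * N ^ 2 * ‖G‖ with hL
  have hL0 : 0 ≤ L := by positivity
  set a := ‖e‖ with ha
  have ha0 : 0 ≤ a := norm_nonneg _
  set K : ℝ := N * (N * a) * (2 * κ * (N * 2 * a)) + N * (N * a) * (2 * κ ^ 2 * L * (N * 2 * a))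
    + N * (N * a) * (κ * (N * a)) with hK
  have hK0 : 0 ≤ K := by positivity
  refine ⟨K + 1, by positivity, 1 / (1 + 2 * κ * L), by positivity, ?_⟩
  intro A₁ A₂ B₁ B₂ hA₁ hA₂ hlow ε hε hεr hB₁ hB₂
  have hε1 : ε ≤ 1 := hεr.trans (by
    rw [div_le_one (by positivity)]
    have : 0 ≤ 2 * κ * L := by positivity
    linarith)
  have hco' : ∀ v, g₀ * c * ∑ i, ‖v i‖ ^ 2 ≤ (star v ⬝ᵥ (pairGram G A₁ A₂ *ᵥ v)).re := by
    intro v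
    rw [star_dotProduct_pairGram, Complex.add_re]
    have h1 := hco (A₁ *ᵥ v)
    have h2 := hco (A₂ *ᵥ v)
    have h3 := mul_le_mul_of_nonneg_left (hlow v) hg₀.le
    linarith
  obtain ⟨hdetA, hinvA⟩ := norm_inv_le_of_coercive (mul_pos hg₀ hc) hco'
  change _ ≤ κ at hinvA
  have hent : ∀ A B : Matrix ι ι ℂ, (∀ i j, ‖A i j‖ ≤ 1) → (∀ i j, ‖B i j - A i j‖ ≤ ε) →
      ∀ i j, ‖B i j‖ ≤ 2 := by
    intro A B h1 h2 i j
    have h3 : ‖B i j‖ ≤ ‖B i j - A i j‖ + ‖A i j‖ := by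
      simpa using norm_add_le (B i j - A i j) (A i j)
    linarith [h1 i j, h2 i j]
  have hquad : ∀ A B : Matrix ι ι ℂ, (∀ i j, ‖A i j‖ ≤ 1) → (∀ i j, ‖B i j - A i j‖ ≤ ε) →
      ‖Bᴴ * G * B - Aᴴ * G * A‖ ≤ 3 * N ^ 2 * ‖G‖ * ε := by
    intro A B h1 h2
    have h3 := hent A B h1 h2
    have e1 : Bᴴ * G * B - Aᴴ * G * A = Bᴴ * G * (B - A) + (B - A)ᴴ * G * A := by
      rw [Matrix.conjTranspose_sub, Matrix.mul_sub, Matrix.sub_mul, Matrix.sub_mul]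
      abel
    have b1 : ‖Bᴴ‖ ≤ N * 2 := linfty_norm_le _ _ (by norm_num) fun i j => by
      rw [Matrix.conjTranspose_apply, norm_star]; exact h3 j i
    have b2 : ‖B - A‖ ≤ N * ε := linfty_norm_le _ _ hε fun i j => h2 i j
    have b3 : ‖(B - A)ᴴ‖ ≤ N * ε := linfty_norm_le _ _ hε fun i j => by
      rw [Matrix.conjTranspose_apply, norm_star]; exact h2 j i
    have b4 : ‖A‖ ≤ N * 1 := linfty_norm_le _ _ (by norm_num) h1
    calc ‖Bᴴ * G * B - Aᴴ * G * A‖ ≤ ‖Bᴴ * G * (B - A)‖ + ‖(B - A)ᴴ * G * A‖ := by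
          rw [e1]; exact norm_add_le _ _
      _ ≤ ‖Bᴴ‖ * ‖G‖ * ‖B - A‖ + ‖(B - A)ᴴ‖ * ‖G‖ * ‖A‖ := by
          gcongr
          · exact (norm_mul_le _ _).trans (mul_le_mul_of_nonneg_right (norm_mul_le _ _)
              (norm_nonneg _))
          · exact (norm_mul_le _ _).trans (mul_le_mul_of_nonneg_right (norm_mul_le _ _)
              (norm_nonneg _))
      _ ≤ (N * 2) * ‖G‖ * (N * ε) + (N * ε) * ‖G‖ * (N * 1) := by gcongr
      _ = _ := by ring
  have hΓ : ‖pairGram G B₁ B₂ - pairGram G A₁ A₂‖ ≤ L * ε := by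
    have e1 : pairGram G B₁ B₂ - pairGram G A₁ A₂ =
        (B₁ᴴ * G * B₁ - A₁ᴴ * G * A₁) + (B₂ᴴ * G * B₂ - A₂ᴴ * G * A₂) := by
      unfold pairGram; abel
    rw [e1]
    refine (norm_add_le _ _).trans ?_
    have := hquad A₁ B₁ hA₁ hB₁
    have := hquad A₂ B₂ hA₂ hB₂
    rw [hL]
    linarith
  have hhalf : ‖(pairGram G A₁ A₂)⁻¹‖ * ‖pairGram G B₁ B₂ - pairGram G A₁ A₂‖ ≤ 1 / 2 := by
    calc _ ≤ κ * (L * ε) := by gcongr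
      _ ≤ κ * (L * (1 / (1 + 2 * κ * L))) := by gcongr
      _ ≤ 1 / 2 := by
        rw [← mul_assoc, mul_one_div, div_le_iff₀ (by positivity)]
        linarith
  obtain ⟨-, hinvB, hdiff⟩ := inverse_perturbation hdetA hhalf
  have hvec : ∀ (A : Matrix ι ι ℂ) (δ : ℝ), 0 ≤ δ → (∀ i j, ‖A i j‖ ≤ δ) →
      ‖e ᵥ* A‖ ≤ N * δ * a := by
    intro A δ hδ h
    rw [← Matrix.mulVec_transpose]
    refine (Matrix.linfty_opNorm_mulVec _ _).trans ?_
    exact mul_le_mul_of_nonneg_right (linfty_norm_le _ _ hδ fun i j => h j i) ha0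
  have r1A := hvec A₁ 1 zero_le_one hA₁
  have r1d := hvec (B₁ - A₁) ε hε hB₁
  have r2B := hvec B₂ 2 (by norm_num) (hent A₂ B₂ hA₂ hB₂)
  have r2d := hvec (B₂ - A₂) ε hε hB₂
  rw [← norm_star] at r2B r2d
  set ΓA := (pairGram G A₁ A₂)⁻¹
  set ΓB := (pairGram G B₁ B₂)⁻¹
  have hsplit : projForm G e B₁ B₂ - projForm G e A₁ A₂ =
      (e ᵥ* (B₁ - A₁)) ⬝ᵥ (ΓB *ᵥ star (e ᵥ* B₂))
      + (e ᵥ* A₁) ⬝ᵥ ((ΓB - ΓA) *ᵥ star (e ᵥ* B₂))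
      + (e ᵥ* A₁) ⬝ᵥ (ΓA *ᵥ star (e ᵥ* (B₂ - A₂))) := by
    simp only [projForm, Matrix.vecMul_sub, Matrix.sub_mulVec, Matrix.mulVec_sub, sub_dotProduct,
      dotProduct_sub, star_sub, ΓA, ΓB]
    ring
  have hinvB' : ‖ΓB‖ ≤ 2 * κ := hinvB.trans (by linarith)
  have hdiff' : ‖ΓB - ΓA‖ ≤ 2 * κ ^ 2 * (L * ε) := by
    refine hdiff.trans ?_
    gcongr
  rw [hsplit]
  calc _ ≤ ‖(e ᵥ* (B₁ - A₁)) ⬝ᵥ (ΓB *ᵥ star (e ᵥ* B₂))‖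
      + ‖(e ᵥ* A₁) ⬝ᵥ ((ΓB - ΓA) *ᵥ star (e ᵥ* B₂))‖
      + ‖(e ᵥ* A₁) ⬝ᵥ (ΓA *ᵥ star (e ᵥ* (B₂ - A₂)))‖ := norm_add₃_le
    _ ≤ N * (N * ε * a) * ((2 * κ) * (N * 2 * a))
      + N * (N * 1 * a) * ((2 * κ ^ 2 * (L * ε)) * (N * 2 * a))
      + N * (N * 1 * a) * (κ * (N * ε * a)) := by
        refine add_le_add (add_le_add ?_ ?_) ?_
        · refine (norm_dotProduct_le' _ _).trans ?_
          gcongr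
          refine (Matrix.linfty_opNorm_mulVec _ _).trans ?_
          gcongr
        · refine (norm_dotProduct_le' _ _).trans ?_
          gcongr
          refine (Matrix.linfty_opNorm_mulVec _ _).trans ?_
          gcongr
        · refine (norm_dotProduct_le' _ _).trans ?_
          gcongr
          refine (Matrix.linfty_opNorm_mulVec _ _).trans ?_
          gcongr
    _ = K * ε := by rw [hK]; ring
    _ ≤ (K + 1) * ε := by nlinarith

end

end Hirota

namespace Hirota

noncomputable section

open Finset

/-! ### Taylor coefficients of `exp (2 θ)` -/

theorem iteratedDeriv_exp_comp_succ {g : ℂ → ℂ} (hg : ContDiff ℂ ⊤ g) (m : ℕ) (z : ℂ) :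
    iteratedDeriv (m + 1) (fun w => Complex.exp (g w)) z =
      ∑ r ∈ range (m + 1), (m.choose r : ℂ) * iteratedDeriv (r + 1) g z *
        iteratedDeriv (m - r) (fun w => Complex.exp (g w)) z := by
  have hd : deriv (fun w => Complex.exp (g w)) = deriv g * fun w => Complex.exp (g w) := by
    ext w
    have h := ((hg.differentiable (by simp)) w).hasDerivAt.cexp
    rw [h.deriv, Pi.mul_apply, mul_comm]
  have hg' : ContDiff ℂ m (deriv g) := by
    have : ContDiff ℂ ((m : ℕ∞) + 1 : ℕ∞) g := hg.of_le (by exact le_top)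
    exact (contDiff_succ_iff_deriv.1 (by exact_mod_cast this)).2.2
  have he : ContDiff ℂ m fun w => Complex.exp (g w) := (hg.of_le le_top).cexp
  rw [iteratedDeriv_succ', hd, iteratedDeriv_mul hg'.contDiffAt he.contDiffAt]
  refine sum_congr rfl fun r _ => ?_
  rw [iteratedDeriv_succ']

/-- Growth of the derivatives of `exp ∘ g` when all derivatives of `g` are at most of order `H`:
the `m`-th one is of order `H ^ m`, with leading part `(g') ^ m`. -/
theorem exp_derivatives_growth (N : ℕ) (B : ℝ) (hB : 1 ≤ B) :
    ∃ K ≥ 1, ∀ (g F : ℕ → ℂ) (H : ℝ), 1 ≤ H → (∀ r, 1 ≤ r → r ≤ N → ‖g r‖ ≤ B * H) →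
      (∀ m < N, F (m + 1) = ∑ r ∈ range (m + 1), (m.choose r : ℂ) * g (r + 1) * F (m - r)) →
      ∀ m ≤ N, ‖F m‖ ≤ K * ‖F 0‖ * H ^ m ∧ ‖F m - g 1 ^ m * F 0‖ * H ≤ K * ‖F 0‖ * H ^ m := by
  induction N with
  | zero =>
    refine ⟨1, le_rfl, ?_⟩
    intro g F H hH _ _ m hm
    obtain rfl : m = 0 := by omega
    simp
  | succ N ih =>
    obtain ⟨K, hK, hKb⟩ := ih
    set C : ℝ := N * (2 ^ N * B * K) with hC
    have hC0 : 0 ≤ C := by positivity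
    refine ⟨K + C + B * K, by nlinarith, ?_⟩
    intro g F H hH hg hF m hm
    have hold := hKb g F H hH (fun r h1 h2 => hg r h1 (by omega)) (fun m hm => hF m (by omega))
    have hF0 := norm_nonneg (F 0)
    have hmono : ∀ m, K * ‖F 0‖ * H ^ m ≤ (K + C + B * K) * ‖F 0‖ * H ^ m := by
      intro m
      have : 0 ≤ B * K := by positivity
      gcongr
      linarith
    rcases Nat.lt_or_ge m (N + 1) with hlt | hge
    · obtain ⟨h1, h2⟩ := hold m (by omega)
      exact ⟨h1.trans (hmono m), h2.trans (hmono m)⟩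
    obtain rfl : m = N + 1 := by omega
    obtain ⟨hN1, hN2⟩ := hold N le_rfl
    have hrest : ‖F (N + 1) - g 1 * F N‖ ≤ C * ‖F 0‖ * H ^ N := by
      rw [hF N (by omega), sum_range_succ']
      simp only [Nat.choose_zero_right, Nat.cast_one, one_mul, zero_add, Nat.sub_zero,
        add_sub_cancel_right]
      calc _ ≤ ∑ r ∈ range N, ‖(N.choose (r + 1) : ℂ) * g (r + 1 + 1) * F (N - (r + 1))‖ :=
            norm_sum_le _ _
        _ ≤ ∑ r ∈ range N, (2 ^ N * B * K) * ‖F 0‖ * H ^ N := by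
            refine sum_le_sum fun r hr => ?_
            have hr := mem_range.1 hr
            have b1 : ‖(N.choose (r + 1) : ℂ)‖ ≤ 2 ^ N := by
              rw [Complex.norm_natCast]
              exact_mod_cast Nat.choose_le_two_pow N (r + 1)
            have b2 := hg (r + 1 + 1) (by omega) (by omega)
            have b3 := (hold (N - (r + 1)) (by omega)).1
            have b4 : H * H ^ (N - (r + 1)) ≤ H ^ N := by
              rw [← pow_succ']
              exact pow_le_pow_right₀ hH (by omega)
            rw [norm_mul, norm_mul]
            calc _ ≤ 2 ^ N * (B * H) * (K * ‖F 0‖ * H ^ (N - (r + 1))) := by gcongr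
              _ = (2 ^ N * B * K) * ‖F 0‖ * (H * H ^ (N - (r + 1))) := by ring
              _ ≤ _ := by gcongr
        _ = _ := by simp [hC]; ring
    have hg1 := hg 1 le_rfl (by omega)
    have hHN : H ^ N ≤ H ^ (N + 1) := pow_le_pow_right₀ hH (by omega)
    constructor
    · have e1 : F (N + 1) = (F (N + 1) - g 1 * F N) + g 1 * F N := by ring
      rw [e1]
      refine (norm_add_le _ _).trans ?_
      rw [norm_mul]
      calc _ ≤ C * ‖F 0‖ * H ^ N + (B * H) * (K * ‖F 0‖ * H ^ N) := by gcongr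
        _ ≤ C * ‖F 0‖ * H ^ (N + 1) + (B * H) * (K * ‖F 0‖ * H ^ N) := by gcongr
        _ = (C + B * K) * ‖F 0‖ * H ^ (N + 1) := by ring
        _ ≤ _ := by gcongr; linarith
    · have e1 : F (N + 1) - g 1 ^ (N + 1) * F 0
          = (F (N + 1) - g 1 * F N) + g 1 * (F N - g 1 ^ N * F 0) := by ring
      rw [e1]
      calc _ ≤ (‖F (N + 1) - g 1 * F N‖ + ‖g 1‖ * ‖F N - g 1 ^ N * F 0‖) * H := by
            gcongr
            refine (norm_add_le _ _).trans ?_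
            rw [norm_mul]
        _ = ‖F (N + 1) - g 1 * F N‖ * H + ‖g 1‖ * (‖F N - g 1 ^ N * F 0‖ * H) := by ring
        _ ≤ (C * ‖F 0‖ * H ^ N) * H + (B * H) * (K * ‖F 0‖ * H ^ N) := by gcongr
        _ = (C + B * K) * ‖F 0‖ * H ^ (N + 1) := by ring
        _ ≤ _ := by gcongr; linarith

theorem norm_pow_sub_pow_mul_le (a b : ℂ) (B H : ℝ) (hB : 1 ≤ B) (hH : 1 ≤ H)
    (ha : ‖a‖ ≤ B * H) (hb : ‖b‖ ≤ B * H) (m : ℕ) :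
    ‖a ^ m - b ^ m‖ * H ≤ m * B ^ m * H ^ m * ‖a - b‖ := by
  induction m with
  | zero => simp
  | succ m ih =>
    have e1 : a ^ (m + 1) - b ^ (m + 1) = a * (a ^ m - b ^ m) + (a - b) * b ^ m := by ring
    have hbm : ‖b‖ ^ m ≤ B ^ m * H ^ m := by
      rw [← mul_pow]; gcongr
    have hn := norm_nonneg (a - b)
    calc _ ≤ (‖a‖ * ‖a ^ m - b ^ m‖ + ‖a - b‖ * ‖b‖ ^ m) * H := by
          gcongr
          rw [e1]
          refine (norm_add_le _ _).trans ?_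
          rw [norm_mul, norm_mul, norm_pow]
      _ = ‖a‖ * (‖a ^ m - b ^ m‖ * H) + ‖a - b‖ * ‖b‖ ^ m * H := by ring
      _ ≤ (B * H) * (m * B ^ m * H ^ m * ‖a - b‖) + ‖a - b‖ * (B ^ m * H ^ m) * H := by gcongr
      _ ≤ (B * H) * (m * B ^ m * H ^ m * ‖a - b‖) + ‖a - b‖ * (B ^ (m + 1) * H ^ m) * H := by
          gcongr
          omega
      _ = _ := by push_cast; ring

variable {k : ℕ} (n : Fin k → ℕ) (lam : Fin k → ℂ) (a : Fin k → ℕ → ℂ) (γ δ : ℝ)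

theorem contDiff_two_mul_theta (x t : ℝ) (i : Fin k) :
    ContDiff ℂ ⊤ fun z => 2 * theta n lam a γ δ x t i z := by
  unfold theta
  fun_prop

/-- `c = -i 𝒞^*`, the coefficient of `t` in `2 θ'(λ_i)` along the characteristic line. -/
def charCoeff (γ δ : ℝ) (l : ℂ) : ℂ := -Complex.I * (starRingEnd ℂ) (curlyC γ δ l)

theorem charCoeff_eq (l : ℂ) : charCoeff γ δ l =
    2 * Complex.I * (4 * γ * l + 12 * δ * l ^ 2) + 2 * Complex.I * (velocity γ δ l : ℂ) := by
  unfold charCoeff curlyC velocity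
  apply Complex.ext
  · simp [pow_two]; ring
  · simp [pow_two]; ring

/-- The derivatives of `2 θ` at `λ_i` are affine in `x` and `t`. -/
theorem iteratedDeriv_two_mul_theta (i : Fin k) : ∃ A B D : ℕ → ℂ,
    (∀ (x t : ℝ) (r : ℕ), iteratedDeriv r (fun z => 2 * theta n lam a γ δ x t i z) (lam i)
      = A r * x + B r * t + D r) ∧ A 1 = 2 * Complex.I ∧
    B 1 = 2 * Complex.I * (4 * γ * lam i + 12 * δ * lam i ^ 2) := by
  let fA : ℂ → ℂ := fun z => 2 * Complex.I * z
  let fB : ℂ → ℂ := fun z => 2 * Complex.I * (2 * γ * z ^ 2 + 4 * δ * z ^ 3)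
  let fD : ℂ → ℂ := fun z => 2 * (∑ j ∈ Finset.range (n i), a i j * (z - lam i) ^ j
    - Complex.I / 4 * (Real.pi : ℂ))
  have hA : ContDiff ℂ ⊤ fA := by fun_prop
  have hB : ContDiff ℂ ⊤ fB := by fun_prop
  have hD : ContDiff ℂ ⊤ fD := by fun_prop
  refine ⟨fun r => iteratedDeriv r fA (lam i), fun r => iteratedDeriv r fB (lam i),
    fun r => iteratedDeriv r fD (lam i), ?_, ?_, ?_⟩
  · intro x t r
    have e1 : (fun z => 2 * theta n lam a γ δ x t i z) =
        ((fun z => (x : ℂ) * fA z) + fun z => (t : ℂ) * fB z) + fD := by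
      ext z
      simp only [theta, fA, fB, fD, Pi.add_apply]
      ring
    have hxA : ContDiff ℂ ⊤ (fun z => (x : ℂ) * fA z) := contDiff_const.mul hA
    have htB : ContDiff ℂ ⊤ (fun z => (t : ℂ) * fB z) := contDiff_const.mul hB
    have hxtB : ContDiff ℂ ⊤ ((fun z => (x : ℂ) * fA z) + fun z => (t : ℂ) * fB z) := hxA.add htB
    rw [e1, iteratedDeriv_add (hxtB.of_le le_top).contDiffAt
      (hD.of_le le_top).contDiffAt, iteratedDeriv_add (hxA.of_le le_top).contDiffAt
      (htB.of_le le_top).contDiffAt, iteratedDeriv_const_mul_field (x : ℂ) fA,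
      iteratedDeriv_const_mul_field (t : ℂ) fB]
    ring
  · simp only [iteratedDeriv_one, fA]
    rw [deriv_const_mul _ differentiableAt_fun_id]
    simp
  · simp only [iteratedDeriv_one, fB]
    have h : HasDerivAt (fun z : ℂ => 2 * Complex.I * (2 * γ * z ^ 2 + 4 * δ * z ^ 3))
        (2 * Complex.I * (2 * γ * (2 * lam i) + 4 * δ * (3 * lam i ^ 2))) (lam i) := by
      have h2 := (hasDerivAt_pow 2 (lam i)).const_mul (2 * (γ : ℂ))
      have h3 := (hasDerivAt_pow 3 (lam i)).const_mul (4 * (δ : ℂ))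
      have := (h2.add h3).const_mul (2 * Complex.I)
      simpa using this
    rw [h.deriv]
    ring

/-- `1 + |x - v_i t| + |t|`, the scale of the Taylor coefficients in the block `i`. -/
def blockScale (i : Fin k) (x t : ℝ) : ℝ := 1 + |x - velocity γ δ (lam i) * t| + |t|

/-- The Taylor coefficients of `exp (-2 θ^{[i]})` at `λ_i`. -/
def PhiInv (x t : ℝ) (i : Fin k) (m : ℕ) : ℂ :=
  (1 / (m.factorial : ℂ)) *
      iteratedDeriv m (fun z : ℂ => Complex.exp (-(2 * theta n lam a γ δ x t i z))) (lam i)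

theorem sum_Phi_mul_PhiInv (x t : ℝ) (i : Fin k) (m : ℕ) :
    ∑ r ∈ range (m + 1), Phi n lam a γ δ x t i r 0 * PhiInv n lam a γ δ x t i (m - r)
      = if m = 0 then 1 else 0 := by
  have hg := contDiff_two_mul_theta n lam a γ δ x t i
  have h1 : (fun z : ℂ => Complex.exp (2 * theta n lam a γ δ x t i z)) *
      (fun z : ℂ => Complex.exp (-(2 * theta n lam a γ δ x t i z))) = fun _ => 1 := by
    ext z
    simp [← Complex.exp_add]
  have h2 := iteratedDeriv_mul (n := m) (x := lam i) (hg.of_le le_top).cexp.contDiffAt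
    (hg.neg.of_le le_top).cexp.contDiffAt
  rw [h1, iteratedDeriv_const] at h2
  have h3 : ∀ r ∈ range (m + 1), Phi n lam a γ δ x t i r 0 * PhiInv n lam a γ δ x t i (m - r) =
      (1 / (m.factorial : ℂ)) * ((m.choose r : ℂ) *
      iteratedDeriv r (fun z : ℂ => Complex.exp (2 * theta n lam a γ δ x t i z)) (lam i) *
      iteratedDeriv (m - r) (fun z : ℂ => Complex.exp (-(2 * theta n lam a γ δ x t i z)))
        (lam i)) := by
    intro r hr
    have hr := Nat.lt_succ_iff.1 (mem_range.1 hr)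
    simp only [Phi, PhiInv, Matrix.cons_val_zero]
    have h4 : (m.choose r : ℂ) * r.factorial * (m - r).factorial = m.factorial := by
      exact_mod_cast Nat.choose_mul_factorial_mul_factorial hr
    have h5 : (r.factorial : ℂ) ≠ 0 := by exact_mod_cast r.factorial_ne_zero
    have h6 : ((m - r).factorial : ℂ) ≠ 0 := by exact_mod_cast (m - r).factorial_ne_zero
    have h7 : (m.factorial : ℂ) ≠ 0 := by exact_mod_cast m.factorial_ne_zero
    field_simp
    rw [← h4]
    ring
  rw [sum_congr rfl h3, ← mul_sum, ← h2]
  split_ifs with h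
  · subst h; simp
  · simp

/-- The Taylor coefficient number `m` of `exp (2 θ)` at `λ_i`, relative to `exp (2 θ(λ_i))`, is bounded
by the `m`-th power of the scale; near the characteristic line its leading part is `(c t)^m / m!`.
The coefficients of `exp (-2 θ)`, relative to `exp (-2 θ(λ_i))`, have the same bound. -/
theorem Phi_bounds (i : Fin k) : ∃ K ≥ 1, ∀ x t : ℝ, ∀ m ≤ n i,
    ‖Phi n lam a γ δ x t i m 0‖ ≤ K * ‖Complex.exp (2 * theta n lam a γ δ x t i (lam i))‖ *
      blockScale lam γ δ i x t ^ m ∧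
    ‖PhiInv n lam a γ δ x t i m‖ ≤ K * ‖Complex.exp (2 * theta n lam a γ δ x t i (lam i))‖⁻¹ *
      blockScale lam γ δ i x t ^ m ∧
    ‖Phi n lam a γ δ x t i m 0 - (charCoeff γ δ (lam i) * t) ^ m / (m.factorial : ℂ) *
      Complex.exp (2 * theta n lam a γ δ x t i (lam i))‖ * blockScale lam γ δ i x t ≤
      K * ‖Complex.exp (2 * theta n lam a γ δ x t i (lam i))‖ *
        (1 + |x - velocity γ δ (lam i) * t|) * blockScale lam γ δ i x t ^ m := by
  obtain ⟨A, B, D, hABD, hA1, hB1⟩ := iteratedDeriv_two_mul_theta n lam a γ δ i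
  set v := velocity γ δ (lam i) with hv
  set c := charCoeff γ δ (lam i) with hc
  set b : ℝ := 1 + ‖c‖ + ∑ r ∈ range (n i + 2), (‖A r‖ * (1 + |v|) + ‖B r‖ + ‖D r‖) with hb
  have hsum0 : ∀ r, 0 ≤ ‖A r‖ * (1 + |v|) + ‖B r‖ + ‖D r‖ := fun r => by positivity
  have hb1 : 1 ≤ b := by
    have : 0 ≤ ∑ r ∈ range (n i + 2), (‖A r‖ * (1 + |v|) + ‖B r‖ + ‖D r‖) :=
      sum_nonneg fun r _ => hsum0 r
    have := norm_nonneg c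
    linarith
  have hbr : ∀ r, r < n i + 2 → ‖A r‖ * (1 + |v|) + ‖B r‖ + ‖D r‖ ≤ b := by
    intro r hr
    have h1 := single_le_sum (f := fun r => ‖A r‖ * (1 + |v|) + ‖B r‖ + ‖D r‖)
      (fun r _ => hsum0 r) (mem_range.2 hr)
    have := norm_nonneg c
    linarith
  have hbc : ‖c‖ ≤ b := by
    have : 0 ≤ ∑ r ∈ range (n i + 2), (‖A r‖ * (1 + |v|) + ‖B r‖ + ‖D r‖) :=
      sum_nonneg fun r _ => hsum0 r
    linarith
  obtain ⟨K, hK, hKb⟩ := exp_derivatives_growth (n i) b hb1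
  set L : ℝ := (n i : ℝ) * b ^ (n i) * (2 + ‖D 1‖) with hL
  have hL0 : 0 ≤ L := by positivity
  refine ⟨K + L, by linarith, ?_⟩
  intro x t m hm
  set s := x - v * t with hs
  set H := blockScale lam γ δ i x t with hH
  have hHdef : H = 1 + |s| + |t| := rfl
  have hH1 : 1 ≤ H := by
    rw [hHdef]; have := abs_nonneg s; have := abs_nonneg t; linarith
  set ρ := Complex.exp (2 * theta n lam a γ δ x t i (lam i)) with hρ
  have hρ0 : 0 < ‖ρ‖ := norm_pos_iff.2 (Complex.exp_ne_zero _)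
  set g : ℕ → ℂ := fun r => iteratedDeriv r (fun z => 2 * theta n lam a γ δ x t i z) (lam i)
    with hgdef
  have hg : ∀ r, r < n i + 2 → ‖g r‖ ≤ b * H := by
    intro r hr
    have h1 : g r = A r * x + B r * t + D r := hABD x t r
    have hx : |x| ≤ (1 + |v|) * H := by
      have e : x = s + v * t := by rw [hs]; ring
      have h2 : |x| ≤ |s| + |v| * |t| := by
        conv_lhs => rw [e]
        exact (abs_add_le _ _).trans (by rw [abs_mul])
      have := abs_nonneg s; have := abs_nonneg t; have := abs_nonneg v
      rw [hHdef]
      nlinarith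
    have ht : |t| ≤ H := by rw [hHdef]; have := abs_nonneg s; linarith
    rw [h1]
    calc _ ≤ ‖A r‖ * |x| + ‖B r‖ * |t| + ‖D r‖ := by
          refine (norm_add_le _ _).trans (add_le_add_left ((norm_add_le _ _).trans ?_) _)
          rw [norm_mul, norm_mul, Complex.norm_real, Complex.norm_real, Real.norm_eq_abs,
            Real.norm_eq_abs]
      _ ≤ ‖A r‖ * ((1 + |v|) * H) + ‖B r‖ * H + ‖D r‖ * H := by
          gcongr
          exact le_mul_of_one_le_right (norm_nonneg _) hH1
      _ = (‖A r‖ * (1 + |v|) + ‖B r‖ + ‖D r‖) * H := by ring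
      _ ≤ _ := by
          gcongr
          exact hbr r hr
  have hcd := contDiff_two_mul_theta n lam a γ δ x t i
  set F : ℕ → ℂ := fun m => iteratedDeriv m
    (fun z : ℂ => Complex.exp (2 * theta n lam a γ δ x t i z)) (lam i) with hF
  set F' : ℕ → ℂ := fun m => iteratedDeriv m
    (fun z : ℂ => Complex.exp (-(2 * theta n lam a γ δ x t i z))) (lam i) with hF'
  have hF0 : F 0 = ρ := by simp [hF, hρ]
  have hF'0 : ‖F' 0‖ = ‖ρ‖⁻¹ := by simp [hF', hρ, Complex.exp_neg]
  obtain ⟨hb1', hb2'⟩ := hKb g F H hH1 (fun r _ hr => hg r (by omega))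
    (fun m _ => iteratedDeriv_exp_comp_succ hcd m (lam i)) m hm
  obtain ⟨hb3', -⟩ := hKb (fun r => - g r) F' H hH1
    (fun r _ hr => by rw [norm_neg]; exact hg r (by omega))
    (fun m _ => by
      have := iteratedDeriv_exp_comp_succ hcd.neg m (lam i)
      simp only [iteratedDeriv_fun_neg] at this
      exact this) m hm
  rw [hF0] at hb1' hb2'
  rw [hF'0] at hb3'
  have hfac : ‖(1 / (m.factorial : ℂ))‖ ≤ 1 := by
    rw [norm_div, norm_one, Complex.norm_natCast]
    exact div_le_one_of_le₀ (by exact_mod_cast Nat.succ_le_of_lt m.factorial_pos) (by positivity)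
  have hPhi : Phi n lam a γ δ x t i m 0 = (1 / (m.factorial : ℂ)) * F m := rfl
  have hPhiI : PhiInv n lam a γ δ x t i m = (1 / (m.factorial : ℂ)) * F' m := rfl
  have hHm : 0 < H ^ m := by positivity
  refine ⟨?_, ?_, ?_⟩
  · rw [hPhi, norm_mul]
    calc _ ≤ 1 * (K * ‖ρ‖ * H ^ m) := by gcongr
      _ ≤ (K + L) * ‖ρ‖ * H ^ m := by rw [one_mul]; gcongr; linarith
  · rw [hPhiI, norm_mul]
    calc _ ≤ 1 * (K * ‖ρ‖⁻¹ * H ^ m) := by gcongr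
      _ ≤ (K + L) * ‖ρ‖⁻¹ * H ^ m := by rw [one_mul]; gcongr; linarith
  · have hgc : g 1 - c * t = 2 * Complex.I * s + D 1 := by
      have h1 : g 1 = A 1 * x + B 1 * t + D 1 := hABD x t 1
      rw [h1, hA1, hB1, hc, charCoeff_eq, hs]
      push_cast
      rw [hv]
      ring
    have hgcn : ‖g 1 - c * t‖ ≤ (2 + ‖D 1‖) * (1 + |s|) := by
      rw [hgc]
      refine (norm_add_le _ _).trans ?_
      rw [norm_mul, norm_mul, Complex.norm_I, Complex.norm_real, Real.norm_eq_abs]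
      simp only [Complex.norm_ofNat, mul_one]
      have := abs_nonneg s
      have := norm_nonneg (D 1)
      nlinarith
    have hct : ‖c * t‖ ≤ b * H := by
      rw [norm_mul, Complex.norm_real, Real.norm_eq_abs]
      have ht : |t| ≤ H := by rw [hHdef]; have := abs_nonneg s; linarith
      gcongr
    have hpw := norm_pow_sub_pow_mul_le (g 1) (c * t) b H hb1 hH1 (hg 1 (by omega)) hct m
    have hpw' : ‖g 1 ^ m - (c * t) ^ m‖ * H ≤ L * (1 + |s|) * H ^ m := by
      refine hpw.trans ?_
      calc _ ≤ (n i : ℝ) * b ^ (n i) * H ^ m * ((2 + ‖D 1‖) * (1 + |s|)) := by gcongr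
        _ = _ := by rw [hL]; ring
    have e1 : Phi n lam a γ δ x t i m 0 - (c * t) ^ m / (m.factorial : ℂ) * ρ =
        (1 / (m.factorial : ℂ)) * ((F m - g 1 ^ m * ρ) + (g 1 ^ m - (c * t) ^ m) * ρ) := by
      rw [hPhi]; ring
    rw [e1, norm_mul]
    calc _ ≤ 1 * (‖F m - g 1 ^ m * ρ‖ + ‖g 1 ^ m - (c * t) ^ m‖ * ‖ρ‖) * H := by
          gcongr
          refine (norm_add_le _ _).trans ?_
          rw [norm_mul]
      _ = ‖F m - g 1 ^ m * ρ‖ * H + (‖g 1 ^ m - (c * t) ^ m‖ * H) * ‖ρ‖ := by ring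
      _ ≤ K * ‖ρ‖ * H ^ m + (L * (1 + |s|) * H ^ m) * ‖ρ‖ := by gcongr
      _ ≤ K * ‖ρ‖ * H ^ m * (1 + |s|) + (L * (1 + |s|) * H ^ m) * ‖ρ‖ := by
          refine add_le_add_left (le_mul_of_one_le_right (by positivity) ?_) _
          have := abs_nonneg s
          linarith
      _ = _ := by ring

theorem norm_exp_two_mul_theta (x t : ℝ) (i : Fin k) (hi : 1 ≤ n i) :
    ‖Complex.exp (2 * theta n lam a γ δ x t i (lam i))‖ =
      Real.exp (2 * (a i 0).re - 2 * (lam i).im * (x - velocity γ δ (lam i) * t)) := by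
  rw [Complex.norm_exp]
  congr 1
  have h1 : ∑ j ∈ Finset.range (n i), a i j * (lam i - lam i) ^ j = a i 0 := by
    rw [sum_eq_single 0]
    · simp
    · intro j _ hj
      simp [hj]
    · intro h
      exact absurd (mem_range.2 hi) h
  unfold theta velocity
  rw [h1]
  simp [pow_two]
  ring

end

end Hirota

namespace Hirota

noncomputable section

open Matrix
open scoped Matrix.Norms.Operator

/-! ### Bruhat decomposition of the unipotent Toeplitz matrix -/

/-- The matrix `exp J` for a nilpotent Jordan block `J` of size `N`. -/
def expNilpotent (N : ℕ) : Matrix (Fin N) (Fin N) ℂ :=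
  Matrix.of fun p r => if p.val ≤ r.val then 1 / ((r.val - p.val).factorial : ℂ) else 0

/-- The polynomial `∑ v_r X^r / r!`, on which `exp J` acts as the translation `X ↦ X + 1`. -/
def vecPoly {N : ℕ} (v : Fin N → ℂ) : Polynomial ℂ :=
  ∑ r : Fin N, Polynomial.C (v r / (r.val.factorial : ℂ)) * Polynomial.X ^ r.val

theorem coeff_vecPoly {N : ℕ} (v : Fin N → ℂ) (p : Fin N) :
    (vecPoly v).coeff p.val = v p / (p.val.factorial : ℂ) := by
  unfold vecPoly
  rw [Polynomial.finsetSum_coeff, Finset.sum_eq_single p]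
  · simp
  · intro r _ hr
    rw [Polynomial.coeff_C_mul, Polynomial.coeff_X_pow, if_neg, mul_zero]
    exact fun h => hr (Fin.ext h).symm
  · simp

theorem degree_vecPoly_lt {N : ℕ} (v : Fin N → ℂ) : (vecPoly v).degree < N := by
  exact Polynomial.degree_sum_fin_lt _

theorem taylor_vecPoly {N : ℕ} (v : Fin N → ℂ) (p : Fin N) :
    (Polynomial.taylor 1 (vecPoly v)).coeff p.val * (p.val.factorial : ℂ)
      = (expNilpotent N *ᵥ v) p := by
  unfold vecPoly Matrix.mulVec dotProduct
  rw [map_sum, Polynomial.finsetSum_coeff, Finset.sum_mul]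
  refine Finset.sum_congr rfl fun r _ => ?_
  rw [Polynomial.taylor_mul, Polynomial.taylor_C, Polynomial.taylor_pow, Polynomial.taylor_X,
    Polynomial.coeff_C_mul, Polynomial.C_1, Polynomial.coeff_X_add_one_pow]
  simp only [expNilpotent, Matrix.of_apply]
  split_ifs with h
  · have h4 : (r.val.choose p.val : ℂ) * p.val.factorial * (r.val - p.val).factorial =
        r.val.factorial := by
      exact_mod_cast Nat.choose_mul_factorial_mul_factorial h
    have h5 : (r.val.factorial : ℂ) ≠ 0 := by exact_mod_cast r.val.factorial_ne_zero
    have h6 : ((r.val - p.val).factorial : ℂ) ≠ 0 := by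
      exact_mod_cast (r.val - p.val).factorial_ne_zero
    field_simp
    rw [← h4]
    ring
  · rw [Nat.choose_eq_zero_of_lt (by omega)]
    simp

/-- The square linear system for the column `q` of the lower triangular factor: the coordinates
`p ≤ q` of `v`, followed by the first `N - 1 - q` coordinates of `P v`. -/
def columnSystem {N : ℕ} (P : Matrix (Fin N) (Fin N) ℂ) (q : Fin N) : Matrix (Fin N) (Fin N) ℂ :=
  Matrix.of fun p r => if p.val ≤ q.val then (if p = r then 1 else 0) else
    P ⟨p.val - q.val - 1, by omega⟩ r

theorem columnSystem_mulVec_of_le {N : ℕ} (P : Matrix (Fin N) (Fin N) ℂ) (q : Fin N)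
    (v : Fin N → ℂ) (p : Fin N) (h : p.val ≤ q.val) : (columnSystem P q *ᵥ v) p = v p := by
  simp only [columnSystem, Matrix.mulVec, dotProduct, Matrix.of_apply, if_pos h]
  simp

theorem columnSystem_mulVec_of_lt_rev {N : ℕ} (P : Matrix (Fin N) (Fin N) ℂ) (q : Fin N)
    (v : Fin N → ℂ) (p : Fin N) (h : p < Fin.rev q) :
    (columnSystem P q *ᵥ v) ⟨p.val + q.val + 1, by
      have := Fin.lt_def.1 h; rw [Fin.val_rev] at this; omega⟩ = (P *ᵥ v) p := by
  have h1 : ¬ (p.val + q.val + 1 ≤ q.val) := by omega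
  have h2 : (⟨p.val + q.val + 1 - q.val - 1, by omega⟩ : Fin N) = p := by
    apply Fin.ext
    simp only
    omega
  simp only [columnSystem, Matrix.mulVec, dotProduct, Matrix.of_apply, h1, if_false, h2]

theorem isUnit_det_columnSystem {N : ℕ} (q : Fin N) :
    IsUnit (columnSystem (expNilpotent N) q).det := by
  rw [isUnit_iff_ne_zero]
  intro h0
  obtain ⟨v, hv, hv0⟩ := Matrix.exists_mulVec_eq_zero_iff.2 h0
  apply hv
  have hX : Polynomial.X ^ (q.val + 1) ∣ vecPoly v := by
    rw [Polynomial.X_pow_dvd_iff]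
    intro d hd
    have hdN : d < N := by omega
    have h1 := columnSystem_mulVec_of_le (expNilpotent N) q v ⟨d, hdN⟩ (by simp only; omega)
    rw [hv0] at h1
    have h2 := coeff_vecPoly v ⟨d, hdN⟩
    rw [← h1] at h2
    simpa using h2
  have hX1 : (Polynomial.X - Polynomial.C 1) ^ (N - 1 - q.val) ∣ vecPoly v := by
    have h1 : Polynomial.X ^ (N - 1 - q.val) ∣ Polynomial.taylor 1 (vecPoly v) := by
      rw [Polynomial.X_pow_dvd_iff]
      intro d hd
      have hdN : d < N := by omega
      have hlt : (⟨d, hdN⟩ : Fin N) < Fin.rev q := by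
        rw [Fin.lt_def, Fin.val_rev]; simp only; omega
      have h2 := columnSystem_mulVec_of_lt_rev (expNilpotent N) q v ⟨d, hdN⟩ hlt
      rw [hv0, ← taylor_vecPoly] at h2
      have h3 : (d.factorial : ℂ) ≠ 0 := by exact_mod_cast d.factorial_ne_zero
      rcases mul_eq_zero.1 h2.symm with h4 | h4
      · exact h4
      · exact absurd h4 h3
    obtain ⟨R, hR⟩ := h1
    refine ⟨Polynomial.taylor (-1) R, ?_⟩
    have h2 := congrArg (Polynomial.taylor (-1)) hR
    rw [Polynomial.taylor_taylor, Polynomial.taylor_mul, Polynomial.taylor_pow,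
      Polynomial.taylor_X] at h2
    simpa [sub_eq_add_neg] using h2
  have hcop : IsCoprime ((Polynomial.X : Polynomial ℂ) ^ (q.val + 1))
      ((Polynomial.X - Polynomial.C 1) ^ (N - 1 - q.val)) := by
    apply IsCoprime.pow
    have := Polynomial.isCoprime_X_sub_C_of_isUnit_sub (R := ℂ) (a := 0) (b := 1) (by simp)
    simpa using this
  have hdvd := hcop.mul_dvd hX hX1
  have hdeg : ((Polynomial.X : Polynomial ℂ) ^ (q.val + 1) *
      (Polynomial.X - Polynomial.C 1) ^ (N - 1 - q.val)).degree = ((N : ℕ) : WithBot ℕ) := by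
    rw [Polynomial.degree_mul, Polynomial.degree_pow, Polynomial.degree_pow, Polynomial.degree_X,
      Polynomial.degree_X_sub_C]
    simp only [nsmul_eq_mul, mul_one]
    have := q.isLt
    norm_cast
    omega
  have hzero := Polynomial.eq_zero_of_dvd_of_degree_lt hdvd
    (by rw [hdeg]; exact degree_vecPoly_lt v)
  ext p
  have h1 := coeff_vecPoly v p
  rw [hzero, Polynomial.coeff_zero] at h1
  have h3 : (p.val.factorial : ℂ) ≠ 0 := by exact_mod_cast p.val.factorial_ne_zero
  rcases div_eq_zero_iff.1 h1.symm with h4 | h4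
  · exact h4
  · exact absurd h4 h3

/-- The nonzero entry `(-1)^{q*} q*! / q!`, `q* = N - 1 - q`, of the antidiagonal factor. -/
def antiEntry {N : ℕ} (q : Fin N) : ℂ :=
  (-1) ^ (Fin.rev q).val * ((Fin.rev q).val.factorial : ℂ) / (q.val.factorial : ℂ)

/-- The solution is `X^q (X - 1)^{q*}` up to a factor; its translate is `(X + 1)^q X^{q*}`. -/
theorem expNilpotent_column {N : ℕ} (q : Fin N) (v : Fin N → ℂ)
    (hv : columnSystem (expNilpotent N) q *ᵥ v = Pi.single q 1) :
    (expNilpotent N *ᵥ v) (Fin.rev q) = antiEntry q := by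
  set s := (Fin.rev q).val with hs
  have hqs : q.val + s + 1 = N := by rw [hs, Fin.val_rev]; omega
  set κ : ℂ := (-1) ^ s / (q.val.factorial : ℂ) with hκ
  set f : Polynomial ℂ := Polynomial.C κ *
    (Polynomial.X ^ q.val * (Polynomial.X - Polynomial.C 1) ^ s) with hf
  have hfd : f.natDegree < N := by
    refine lt_of_le_of_lt (Polynomial.natDegree_C_mul_le _ _) ?_
    rw [(Polynomial.monic_X_pow q.val).natDegree_mul ((Polynomial.monic_X_sub_C 1).pow s),
      Polynomial.natDegree_pow, Polynomial.natDegree_pow, Polynomial.natDegree_X,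
      Polynomial.natDegree_X_sub_C]
    omega
  let w : Fin N → ℂ := fun p => f.coeff p.val * (p.val.factorial : ℂ)
  have hwf : vecPoly w = f := by
    ext d
    by_cases hd : d < N
    · have h1 := coeff_vecPoly w ⟨d, hd⟩
      have h3 : (d.factorial : ℂ) ≠ 0 := by exact_mod_cast d.factorial_ne_zero
      simp only [w] at h1
      rw [h1, mul_div_cancel_right₀ _ h3]
    · rw [Polynomial.coeff_eq_zero_of_natDegree_lt (lt_of_lt_of_le hfd (not_lt.1 hd)),
        Polynomial.coeff_eq_zero_of_degree_lt]
      refine lt_of_lt_of_le (degree_vecPoly_lt w) ?_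
      exact_mod_cast not_lt.1 hd
  have htay : Polynomial.taylor 1 f = Polynomial.C κ *
      (Polynomial.X ^ s * (Polynomial.X + Polynomial.C 1) ^ q.val) := by
    rw [hf, Polynomial.taylor_mul, Polynomial.taylor_mul, Polynomial.taylor_C,
      Polynomial.taylor_pow, Polynomial.taylor_pow, map_sub, Polynomial.taylor_X,
      Polynomial.taylor_C, add_sub_cancel_right, mul_comm (Polynomial.X ^ s)]
  have htc : ∀ p : Fin N, p.val ≤ s → (expNilpotent N *ᵥ w) p =
      if p.val = s then antiEntry q else 0 := by
    intro p hp
    rw [← taylor_vecPoly, hwf, htay, Polynomial.coeff_C_mul, Polynomial.coeff_X_pow_mul']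
    split_ifs with h1 h2 h2
    · rw [h2, antiEntry, ← hs]
      simp [Polynomial.coeff_zero_eq_eval_zero, hκ]
      ring
    · omega
    · omega
    · ring
  have hw : columnSystem (expNilpotent N) q *ᵥ w = Pi.single q 1 := by
    ext p
    by_cases hp : p.val ≤ q.val
    · rw [columnSystem_mulVec_of_le _ _ _ _ hp]
      have hfc : f.coeff p.val = if p = q then κ * (-1) ^ s else 0 := by
        rw [hf, Polynomial.coeff_C_mul, Polynomial.coeff_X_pow_mul']
        split_ifs with h1 h2 h2
        · rw [h2]
          simp [Polynomial.coeff_zero_eq_eval_zero]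
        · exact absurd (Fin.ext (le_antisymm hp h1)) h2
        · rw [h2] at h1; omega
        · ring
      simp only [w, hfc]
      by_cases h : p = q
      · subst h
        have h3 : (p.val.factorial : ℂ) ≠ 0 := by exact_mod_cast p.val.factorial_ne_zero
        have h4 : ((-1 : ℂ)) ^ s * (-1) ^ s = 1 := by rw [← mul_pow]; simp
        rw [if_pos rfl, Pi.single_eq_same, hκ]
        field_simp
        linear_combination h4
      · rw [if_neg h, Pi.single_eq_of_ne h, zero_mul]
    · have hlt : (⟨p.val - q.val - 1, by omega⟩ : Fin N) < Fin.rev q := by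
        rw [Fin.lt_def, ← hs]
        have := p.isLt
        simp only
        omega
      have h1 := columnSystem_mulVec_of_lt_rev (expNilpotent N) q w _ hlt
      have h2 : (⟨p.val - q.val - 1 + q.val + 1, by omega⟩ : Fin N) = p := by
        apply Fin.ext; simp only; omega
      simp only [h2] at h1
      have hlt' := Fin.lt_def.1 hlt
      rw [h1, htc _ (by simp only; rw [← hs] at hlt'; simp only at hlt'; omega), if_neg,
        Pi.single_eq_of_ne]
      · intro h; rw [h] at hp; omega
      · simp only; rw [← hs] at hlt'; simp only at hlt'; omega
  have hvw : v = w := by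
    have hu := isUnit_det_columnSystem q
    have h1 : (columnSystem (expNilpotent N) q)⁻¹ *ᵥ (columnSystem (expNilpotent N) q *ᵥ v) =
      (columnSystem (expNilpotent N) q)⁻¹ *ᵥ (columnSystem (expNilpotent N) q *ᵥ w) := by
      rw [hv, hw]
    rwa [Matrix.mulVec_mulVec, Matrix.mulVec_mulVec, Matrix.nonsing_inv_mul _ hu,
      Matrix.one_mulVec, Matrix.one_mulVec] at h1
  rw [hvw, htc _ le_rfl, if_pos rfl]

/-- A column of the Bruhat decomposition of a matrix `P` near `exp J`: `v` vanishes above the entry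
`q`, and `P v` vanishes above the entry `q* = N - 1 - q`, which is close to that of `exp J`. -/
theorem exists_column_of_near {N : ℕ} (q : Fin N) :
    ∃ K > 0, ∀ (P : Matrix (Fin N) (Fin N) ℂ) (ε : ℝ), 0 ≤ ε → K * ε ≤ 1 →
      (∀ p r, ‖P p r - expNilpotent N p r‖ ≤ ε) →
      ∃ v : Fin N → ℂ, (∀ p, p < q → v p = 0) ∧ v q = 1 ∧ (∀ p, ‖v p‖ ≤ K) ∧
        (∀ p, p < Fin.rev q → (P *ᵥ v) p = 0) ∧ (∀ p, ‖(P *ᵥ v) p‖ ≤ K) ∧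
        ‖(P *ᵥ v) (Fin.rev q) - antiEntry q‖ ≤ K * ε := by
  set A := columnSystem (expNilpotent N) q with hA
  have hAu : IsUnit A.det := isUnit_det_columnSystem q
  set α := ‖A⁻¹‖ with hα
  have hα0 : 0 ≤ α := norm_nonneg _
  set M : ℝ := (N : ℝ) with hM
  have hM0 : 0 ≤ M := by positivity
  set K : ℝ := 1 + 2 * α * M + 2 * α + M * 2 * (2 * α) + (M * (2 * α) + M * (2 * α ^ 2 * M))
    with hK
  have hK1 : 1 ≤ K := by
    have h1 : 0 ≤ 2 * α * M + 2 * α + M * 2 * (2 * α) + (M * (2 * α) + M * (2 * α ^ 2 * M)) := by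
      positivity
    linarith
  refine ⟨K, by linarith, ?_⟩
  intro P ε hε hKε hP
  have hε1 : ε ≤ 1 := by nlinarith
  set B := columnSystem P q with hB
  have hcard : ((Fintype.card (Fin N) : ℕ) : ℝ) = M := by simp [hM]
  have hBA : ‖B - A‖ ≤ M * ε := by
    rw [← hcard]
    refine linfty_norm_le _ _ hε fun p r => ?_
    simp only [hA, hB, columnSystem, Matrix.sub_apply, Matrix.of_apply]
    split_ifs
    · simpa using hε
    · simpa using hε
    · exact hP _ _
  have hPP : ‖P - expNilpotent N‖ ≤ M * ε := by
    rw [← hcard]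
    exact linfty_norm_le _ _ hε fun p r => hP p r
  have hUent : ∀ p r, ‖expNilpotent N p r‖ ≤ 1 := by
    intro p r
    simp only [expNilpotent, Matrix.of_apply]
    split_ifs
    · rw [norm_div, norm_one, Complex.norm_natCast]
      exact div_le_one_of_le₀ (by exact_mod_cast Nat.succ_le_of_lt (Nat.factorial_pos _))
        (by positivity)
    · simp
  have hU : ‖expNilpotent N‖ ≤ M * 1 := by
    rw [← hcard]
    exact linfty_norm_le _ _ zero_le_one hUent
  have hPn : ‖P‖ ≤ M * 2 := by
    have h1 : ‖P‖ ≤ ‖P - expNilpotent N‖ + ‖expNilpotent N‖ := by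
      simpa using norm_add_le (P - expNilpotent N) (expNilpotent N)
    nlinarith
  have hhalf : ‖A⁻¹‖ * ‖B - A‖ ≤ 1 / 2 := by
    have h1 : 2 * α * M * ε ≤ K * ε := by
      apply mul_le_mul_of_nonneg_right _ hε
      have : 0 ≤ 1 + 2 * α + M * 2 * (2 * α) + (M * (2 * α) + M * (2 * α ^ 2 * M)) := by
        positivity
      linarith
    have h2 := mul_le_mul_of_nonneg_left hBA hα0
    nlinarith
  obtain ⟨hBu, hBn, hBd⟩ := inverse_perturbation hAu hhalf
  have hsingle : ‖(Pi.single q 1 : Fin N → ℂ)‖ ≤ 1 := by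
    rw [pi_norm_le_iff_of_nonneg zero_le_one]
    intro p
    by_cases h : p = q
    · subst h; simp
    · rw [Pi.single_eq_of_ne h]; simp
  set v := B⁻¹ *ᵥ (Pi.single q 1 : Fin N → ℂ) with hv
  set v₀ := A⁻¹ *ᵥ (Pi.single q 1 : Fin N → ℂ) with hv₀
  have hBv : B *ᵥ v = Pi.single q 1 := by
    rw [hv, Matrix.mulVec_mulVec, Matrix.mul_nonsing_inv _ hBu, Matrix.one_mulVec]
  have hAv : A *ᵥ v₀ = Pi.single q 1 := by
    rw [hv₀, Matrix.mulVec_mulVec, Matrix.mul_nonsing_inv _ hAu, Matrix.one_mulVec]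
  have hvn : ‖v‖ ≤ 2 * α := by
    refine (Matrix.linfty_opNorm_mulVec _ _).trans ?_
    calc _ ≤ (2 * α) * 1 := by gcongr
      _ = _ := by ring
  have hvd : ‖v - v₀‖ ≤ 2 * α ^ 2 * M * ε := by
    rw [hv, hv₀, ← Matrix.sub_mulVec]
    refine (Matrix.linfty_opNorm_mulVec _ _).trans ?_
    calc _ ≤ (2 * α ^ 2 * (M * ε)) * 1 := by
          gcongr
          refine hBd.trans ?_
          gcongr
      _ = _ := by ring
  have hPv : ∀ p, ‖(P *ᵥ v) p‖ ≤ M * 2 * (2 * α) := by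
    intro p
    refine (norm_le_pi_norm _ p).trans ((Matrix.linfty_opNorm_mulVec _ _).trans ?_)
    gcongr
  have hle : ∀ p, p.val ≤ q.val → v p = (Pi.single q 1 : Fin N → ℂ) p := by
    intro p hp
    rw [← hBv, hB, columnSystem_mulVec_of_le _ _ _ _ hp]
  refine ⟨v, ?_, ?_, ?_, ?_, ?_, ?_⟩
  · intro p hp
    rw [hle p hp.le, Pi.single_eq_of_ne hp.ne]
  · rw [hle q le_rfl, Pi.single_eq_same]
  · intro p
    refine (norm_le_pi_norm v p).trans (hvn.trans ?_)
    have : 0 ≤ 1 + 2 * α * M + M * 2 * (2 * α) + (M * (2 * α) + M * (2 * α ^ 2 * M)) := by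
      positivity
    linarith
  · intro p hp
    rw [← columnSystem_mulVec_of_lt_rev P q v p hp, ← hB, hBv, Pi.single_eq_of_ne]
    intro h
    have := congrArg Fin.val h
    simp only at this
    omega
  · intro p
    refine (hPv p).trans ?_
    have : 0 ≤ 1 + 2 * α * M + 2 * α + (M * (2 * α) + M * (2 * α ^ 2 * M)) := by positivity
    linarith
  · rw [← expNilpotent_column q v₀ hAv]
    have e1 : (P *ᵥ v) (Fin.rev q) - (expNilpotent N *ᵥ v₀) (Fin.rev q) =
        ((P - expNilpotent N) *ᵥ v + expNilpotent N *ᵥ (v - v₀)) (Fin.rev q) := by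
      rw [Matrix.sub_mulVec, Matrix.mulVec_sub]
      simp
    rw [e1]
    refine (norm_le_pi_norm _ _).trans ((norm_add_le _ _).trans ?_)
    calc _ ≤ (M * ε) * (2 * α) + (M * 1) * (2 * α ^ 2 * M * ε) := by
          refine add_le_add ?_ ?_
          · refine (Matrix.linfty_opNorm_mulVec _ _).trans ?_
            gcongr
          · refine (Matrix.linfty_opNorm_mulVec _ _).trans ?_
            gcongr
      _ = (M * (2 * α) + M * (2 * α ^ 2 * M)) * ε := by ring
      _ ≤ _ := by
          apply mul_le_mul_of_nonneg_right _ hε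
          have : 0 ≤ 1 + 2 * α * M + 2 * α + M * 2 * (2 * α) := by positivity
          linarith

end

end Hirota

namespace Hirota

noncomputable section

open Matrix

/-! ### Asymptotic column spaces of one block -/

theorem exists_columns_of_near (N : ℕ) :
    ∃ K > 0, ∀ (P : Matrix (Fin N) (Fin N) ℂ) (ε : ℝ), 0 ≤ ε → K * ε ≤ 1 →
      (∀ p r, ‖P p r - expNilpotent N p r‖ ≤ ε) → ∀ q,
      ∃ v : Fin N → ℂ, (∀ p, p < q → v p = 0) ∧ v q = 1 ∧ (∀ p, ‖v p‖ ≤ K) ∧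
        (∀ p, p < Fin.rev q → (P *ᵥ v) p = 0) ∧ (∀ p, ‖(P *ᵥ v) p‖ ≤ K) ∧
        ‖(P *ᵥ v) (Fin.rev q) - antiEntry q‖ ≤ K * ε := by
  choose K hK h using fun q : Fin N => exists_column_of_near q
  have hle : ∀ q, K q ≤ 1 + ∑ q, K q := by
    intro q
    have := Finset.single_le_sum (f := K) (fun q _ => (hK q).le) (Finset.mem_univ q)
    linarith
  have h0 : 0 ≤ ∑ q, K q := Finset.sum_nonneg fun q _ => (hK q).le
  refine ⟨1 + ∑ q, K q, by linarith, ?_⟩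
  intro P ε hε hKε hP q
  have h1 : K q * ε ≤ (1 + ∑ q, K q) * ε := mul_le_mul_of_nonneg_right (hle q) hε
  obtain ⟨v, a1, a2, a3, a4, a5, a6⟩ := h q P ε hε (h1.trans hKε) hP
  exact ⟨v, a1, a2, fun p => (a3 p).trans (hle q), a4, fun p => (a5 p).trans (hle q), a6.trans h1⟩

theorem antiEntry_ne_zero {N : ℕ} (q : Fin N) : antiEntry q ≠ 0 := by
  unfold antiEntry
  have h1 : ((Fin.rev q).val.factorial : ℂ) ≠ 0 := by exact_mod_cast Nat.factorial_ne_zero _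
  have h2 : (q.val.factorial : ℂ) ≠ 0 := by exact_mod_cast Nat.factorial_ne_zero _
  exact div_ne_zero (mul_ne_zero (pow_ne_zero _ (by norm_num)) h1) h2

theorem charCoeff_ne_zero {γ δ : ℝ} (hγδ : γ ≠ 0 ∨ δ ≠ 0) {l : ℂ} (hl : 0 < l.im) :
    charCoeff γ δ l ≠ 0 := by
  unfold charCoeff
  refine mul_ne_zero (neg_ne_zero.2 Complex.I_ne_zero) ?_
  rw [map_ne_zero]
  intro h
  have hre := congrArg Complex.re h
  have him := congrArg Complex.im h
  simp [curlyC, pow_two] at hre him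
  have hδ : δ = 0 := by
    rcases hre with h1 | h1
    · exact h1
    · exact absurd h1 hl.ne'
  rw [hδ] at him
  have : γ = 0 := by
    simp at him
    rcases him with h1 | h1
    · exact h1
    · exact absurd h1 hl.ne'
  rcases hγδ with h1 | h1
  · exact h1 this
  · exact h1 hδ

theorem one_le_log_of_three_le {t : ℝ} (ht : 3 ≤ t) : 1 ≤ Real.log t := by
  rw [Real.le_log_iff_exp_le (by linarith)]
  linarith [Real.exp_one_lt_d9]

variable {k : ℕ} (n : Fin k → ℕ) (lam : Fin k → ℂ) (a : Fin k → ℕ → ℂ) (γ δ : ℝ)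

/-- The diagonal block number `i` of the matrix of the multiplication by `exp (2 θ)`. -/
def expBlock (x t : ℝ) (i : Fin k) : Matrix (Fin (n i)) (Fin (n i)) ℂ :=
  Matrix.of fun p r => if p.val ≤ r.val then Phi n lam a γ δ x t i (r.val - p.val) 0 else 0

/-- The matrix of the multiplication by `exp (-2 θ)`. -/
def expBlockInv (x t : ℝ) (i : Fin k) : Matrix (Fin (n i)) (Fin (n i)) ℂ :=
  Matrix.of fun p r => if p.val ≤ r.val then PhiInv n lam a γ δ x t i (r.val - p.val) else 0

theorem expBlock_mul_expBlockInv (x t : ℝ) (i : Fin k) :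
    expBlock n lam a γ δ x t i * expBlockInv n lam a γ δ x t i = 1 := by
  ext p r
  rw [Matrix.mul_apply, Matrix.one_apply]
  let f : ℕ → ℂ := fun s => if p.val ≤ s ∧ s ≤ r.val then
    Phi n lam a γ δ x t i (s - p.val) 0 * PhiInv n lam a γ δ x t i (r.val - s) else 0
  have h1 : ∀ s : Fin (n i), expBlock n lam a γ δ x t i p s * expBlockInv n lam a γ δ x t i s r =
      f s.val := by
    intro s
    simp only [f, expBlock, expBlockInv, Matrix.of_apply]
    by_cases hp : p.val ≤ s.val <;> by_cases hr : s.val ≤ r.val <;> simp [hp, hr]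
  rw [Finset.sum_congr rfl fun s _ => h1 s, Fin.sum_univ_eq_sum_range f (n i)]
  simp only [f]
  rw [← Finset.sum_filter]
  have h2 : (Finset.range (n i)).filter (fun s => p.val ≤ s ∧ s ≤ r.val)
      = Finset.Ico p.val (r.val + 1) := by
    ext s
    simp only [Finset.mem_filter, Finset.mem_range, Finset.mem_Ico]
    have := r.isLt
    omega
  rw [h2, Finset.sum_Ico_eq_sum_range]
  by_cases hpr : p.val ≤ r.val
  · rw [show r.val + 1 - p.val = (r.val - p.val) + 1 by omega]
    have h3 := sum_Phi_mul_PhiInv n lam a γ δ x t i (r.val - p.val)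
    rw [Finset.sum_congr rfl (g := fun j => Phi n lam a γ δ x t i j 0 *
      PhiInv n lam a γ δ x t i (r.val - p.val - j)), h3]
    · congr 1
      rw [Fin.ext_iff]
      exact propext ⟨fun h => by omega, fun h => by omega⟩
    · intro j _
      rw [show p.val + j - p.val = j by omega,
        show r.val - (p.val + j) = r.val - p.val - j by omega]
  · rw [show r.val + 1 - p.val = 0 by omega, if_neg]
    · simp
    · intro h; rw [h] at hpr; exact hpr le_rfl

/-- The ratio of the two components of the mixed column number `u` of the limiting column space;
it has modulus `1` at the centre of the soliton `u`, up to a constant. -/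
def mixRatio (x t : ℝ) (u : Idx n) : ℂ :=
  Complex.exp (2 * theta n lam a γ δ x t u.1 (lam u.1)) * antiEntry u.2 *
    (charCoeff γ δ (lam u.1) * t) ^ u.2.val / (charCoeff γ δ (lam u.1) * t) ^ (Fin.rev u.2).val

/-- The normalising factor `1 / (1 + |c|)` of the column `(1, c)`. -/
def colScale (c : ℂ) : ℂ := ((1 / (1 + ‖c‖) : ℝ) : ℂ)

theorem norm_colScale (c : ℂ) : ‖colScale c‖ = 1 / (1 + ‖c‖) := by
  unfold colScale
  rw [Complex.norm_real, Real.norm_of_nonneg (by positivity)]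

theorem colScale_ne_zero (c : ℂ) : colScale c ≠ 0 := by
  rw [← norm_pos_iff, norm_colScale]
  positivity

theorem norm_colScale_le_one (c : ℂ) : ‖colScale c‖ ≤ 1 := by
  rw [norm_colScale, div_le_one (by positivity)]
  linarith [norm_nonneg c]

theorem norm_mul_colScale_le_one (c : ℂ) : ‖c * colScale c‖ ≤ 1 := by
  rw [norm_mul, norm_colScale, mul_one_div, div_le_one (by positivity)]
  linarith

theorem norm_mul_colScale_le (c : ℂ) : ‖c * colScale c‖ ≤ ‖c‖ := by
  rw [norm_mul]
  exact mul_le_of_le_one_right (norm_nonneg c) (norm_colScale_le_one c)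

theorem norm_colScale_le_inv (c : ℂ) (hc : c ≠ 0) : ‖colScale c‖ ≤ ‖c‖⁻¹ := by
  have := norm_pos_iff.2 hc
  rw [norm_colScale, ← one_div]
  exact one_div_le_one_div_of_le this (by linarith)

theorem norm_pow_div_pow_le {τ : ℂ} (hτ : 1 ≤ ‖τ‖) {p q : ℕ} (h : q < p) :
    ‖τ ^ q / τ ^ p‖ ≤ 1 / ‖τ‖ := by
  have h0 : 0 < ‖τ‖ := by linarith
  rw [norm_div, norm_pow, norm_pow, div_le_div_iff₀ (by positivity) h0, one_mul, ← pow_succ]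
  exact pow_le_pow_right₀ hτ h

/-- If `P` is close to `exp J`, the column space of `[1; ρ D⁻¹ P D]`, `D = diag (τ ^ p)`, has a
basis close to mixed columns, with an error that is small for large `τ`. -/
theorem exists_mixed_columns (N : ℕ) : ∃ K > 0, ∀ (ρ τ : ℂ) (P E : Matrix (Fin N) (Fin N) ℂ)
    (cc : Fin N → ℂ) (ε : ℝ), 1 ≤ ‖τ‖ → 0 ≤ ε → K * ε ≤ 1 →
    (∀ p r, ‖P p r - expNilpotent N p r‖ ≤ ε) →
    (∀ p r, E p r = ρ * (τ ^ r.val / τ ^ p.val) * P p r) →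
    (∀ q, cc q = ρ * antiEntry q * τ ^ q.val / τ ^ (Fin.rev q).val) →
    ∃ C : Matrix (Fin N) (Fin N) ℂ, IsUnit C.det ∧
    (∀ p q, ‖C p q - if p = q then colScale (cc q) else 0‖ ≤ K * (ε + 1 / ‖τ‖)) ∧
    (∀ p q, ‖(E * C) p q - if p = Fin.rev q then cc q * colScale (cc q) else 0‖
      ≤ K * (ε + 1 / ‖τ‖)) := by
  obtain ⟨Kc, hKc, hcol⟩ := exists_columns_of_near N
  set W : ℝ := 1 + ∑ q : Fin N, 1 / ‖antiEntry q‖ with hW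
  have hWq : ∀ q : Fin N, 1 / ‖antiEntry q‖ ≤ W := fun q => by
    have := Finset.single_le_sum (f := fun q : Fin N => 1 / ‖antiEntry q‖)
      (fun q _ => by positivity) (Finset.mem_univ q)
    linarith
  have hW1 : 1 ≤ W := by
    have : 0 ≤ ∑ q : Fin N, 1 / ‖antiEntry q‖ := Finset.sum_nonneg fun q _ => by positivity
    linarith
  clear_value W
  have hKW : Kc ≤ Kc * W := le_mul_of_one_le_right hKc.le hW1
  refine ⟨Kc * W, by positivity, ?_⟩
  intro ρ τ P E cc ε hτ1 hε0 hKε hP hE hcc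
  have hτ0 : τ ≠ 0 := by rw [← norm_pos_iff]; linarith
  have hKε' : Kc * ε ≤ 1 := (mul_le_mul_of_nonneg_right hKW hε0).trans hKε
  choose v hv1 hv2 hv3 hv4 hv5 hv6 using hcol P ε hε0 hKε' hP
  have hτi : 0 ≤ 1 / ‖τ‖ := by positivity
  have hyq : ∀ q, ‖ρ * (τ ^ q.val / τ ^ (Fin.rev q).val) * colScale (cc q)‖ ≤ W := by
    intro q
    refine le_trans ?_ (hWq q)
    have hw := norm_pos_iff.2 (antiEntry_ne_zero q)
    rw [le_div_iff₀ hw, ← norm_mul]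
    refine le_trans (le_of_eq ?_) (norm_mul_colScale_le_one (cc q))
    congr 1
    rw [hcc]
    ring
  obtain ⟨C, hC⟩ : ∃ C : Matrix (Fin N) (Fin N) ℂ, ∀ p q, C p q =
      v q p * (τ ^ q.val / τ ^ p.val) * colScale (cc q) := ⟨Matrix.of fun p q => _, fun p q => rfl⟩
  have hCqq : ∀ q, C q q = colScale (cc q) := by
    intro q
    rw [hC, hv2, div_self (pow_ne_zero _ hτ0)]
    ring
  have hClow : ∀ p q, p < q → C p q = 0 := by
    intro p q h
    rw [hC, hv1 q p h, zero_mul, zero_mul]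
  have hEC : ∀ p q, (E * C) p q =
      ρ * (τ ^ q.val / τ ^ p.val) * colScale (cc q) * (P *ᵥ v q) p := by
    intro p q
    rw [Matrix.mul_apply, Matrix.mulVec, dotProduct, Finset.mul_sum]
    refine Finset.sum_congr rfl fun r _ => ?_
    rw [hE, hC]
    field_simp
  have hb0 : 0 ≤ Kc * W * (ε + 1 / ‖τ‖) := by positivity
  have hb1 : Kc * (1 / ‖τ‖) ≤ Kc * W * (ε + 1 / ‖τ‖) := by
    have : 0 ≤ Kc * W * ε := by positivity
    have := mul_le_mul_of_nonneg_right hKW hτi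
    linarith
  have hb2 : W * (Kc * ε) ≤ Kc * W * (ε + 1 / ‖τ‖) := by
    have : 0 ≤ Kc * W * (1 / ‖τ‖) := by positivity
    linarith
  have hb3 : W * (1 / ‖τ‖) * Kc ≤ Kc * W * (ε + 1 / ‖τ‖) := by
    have : 0 ≤ Kc * W * ε := by positivity
    linarith
  refine ⟨C, ?_, ?_, ?_⟩
  · rw [Matrix.det_of_isLowerTriangular C (fun p q h => hClow p q h), isUnit_iff_ne_zero,
      Finset.prod_ne_zero_iff]
    intro q _
    rw [hCqq]
    exact colScale_ne_zero _
  · intro p q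
    rcases lt_trichotomy p q with h | h | h
    · rw [hClow p q h, if_neg h.ne]
      simpa using hb0
    · rw [if_pos h, h, hCqq]
      simpa using hb0
    · rw [if_neg h.ne', sub_zero, hC, norm_mul, norm_mul]
      refine le_trans ?_ hb1
      have b1 := hv3 q p
      have b2 := norm_pow_div_pow_le hτ1 (Fin.lt_def.1 h)
      have b3 := norm_colScale_le_one (cc q)
      calc _ ≤ Kc * (1 / ‖τ‖) * 1 := by gcongr
        _ = _ := by ring
  · intro p q
    rw [hEC]
    rcases lt_trichotomy p (Fin.rev q) with h | h | h
    · rw [hv4 q p h, if_neg h.ne]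
      simpa using hb0
    · rw [if_pos h, h]
      have e1 : ρ * (τ ^ q.val / τ ^ (Fin.rev q).val) * colScale (cc q) * (P *ᵥ v q) (Fin.rev q)
          - cc q * colScale (cc q) = ρ * (τ ^ q.val / τ ^ (Fin.rev q).val) * colScale (cc q) *
          ((P *ᵥ v q) (Fin.rev q) - antiEntry q) := by
        have e2 : cc q * colScale (cc q) = ρ * (τ ^ q.val / τ ^ (Fin.rev q).val) *
            colScale (cc q) * antiEntry q := by
          conv_lhs => rw [hcc q]
          rw [hcc q]
          ring
        rw [e2]
        ring
      rw [e1, norm_mul]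
      refine le_trans ?_ hb2
      have b1 := hyq q
      have b2 := hv6 q
      gcongr
    · rw [if_neg h.ne', sub_zero]
      have e1 : ρ * (τ ^ q.val / τ ^ p.val) * colScale (cc q) * (P *ᵥ v q) p =
          (ρ * (τ ^ q.val / τ ^ (Fin.rev q).val) * colScale (cc q)) *
          (τ ^ (Fin.rev q).val / τ ^ p.val) * (P *ᵥ v q) p := by
        field_simp
      rw [e1, norm_mul, norm_mul]
      refine le_trans ?_ hb3
      have b1 := hyq q
      have b2 := norm_pow_div_pow_le hτ1 (Fin.lt_def.1 h)
      have b3 := hv5 q p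
      gcongr

/-- The conclusion of the analysis of one block at one point: the column space of `[1; exp (2 θ)]`
has a basis that is `ε`-close to the mixed columns `(ξ e_q, η e_{q*})`. -/
def BlockApprox (x t : ℝ) (i : Fin k) (ε : ℝ) : Prop :=
  ∃ C : Matrix (Fin (n i)) (Fin (n i)) ℂ, IsUnit C.det ∧
    (∀ p q, ‖C p q - if p = q then colScale (mixRatio n lam a γ δ x t ⟨i, q⟩) else 0‖ ≤ ε) ∧
    (∀ p q, ‖(expBlock n lam a γ δ x t i * C) p q - if p = Fin.rev q then
      mixRatio n lam a γ δ x t ⟨i, q⟩ * colScale (mixRatio n lam a γ δ x t ⟨i, q⟩) else 0‖ ≤ ε)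

/-- Near the characteristic line the block of `exp (2 θ)` is, up to conjugation with
`diag ((c t) ^ p)`, close to a multiple of `exp J`. -/
theorem blockApprox_near (hγδ : γ ≠ 0 ∨ δ ≠ 0) (i : Fin k) (hlam : 0 < (lam i).im) (K₀ : ℝ)
    (hK₀ : 0 ≤ K₀) :
    ∃ K > 0, ∃ T ≥ 3, ∀ t ≥ T, ∀ x, |x - velocity γ δ (lam i) * t| ≤ K₀ * Real.log t →
      BlockApprox n lam a γ δ x t i (K * (Real.log t / t)) := by
  obtain ⟨K₁, hK₁, hPhi⟩ := Phi_bounds n lam a γ δ i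
  obtain ⟨Kc, hKc, hcol⟩ := exists_mixed_columns (n i)
  set c := charCoeff γ δ (lam i) with hc
  have hc0 : c ≠ 0 := charCoeff_ne_zero hγδ hlam
  have hcn : 0 < ‖c‖ := norm_pos_iff.2 hc0
  set N := n i with hN
  set κ : ℝ := 2 + K₀ with hκ
  set K₂ : ℝ := K₁ * (1 + K₀) * κ ^ N * (1 + 1 / ‖c‖) ^ N with hK₂
  have hK₂0 : 0 < K₂ := by positivity
  have hlim : Filter.Tendsto (fun t : ℝ => Kc * (K₂ * (Real.log t / t))) Filter.atTop (nhds 0) := by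
    have h1 : Filter.Tendsto (fun t : ℝ => Real.log t / t) Filter.atTop (nhds 0) := by
      simpa using Real.isLittleO_log_id_atTop.tendsto_div_nhds_zero
    simpa using (h1.const_mul K₂).const_mul Kc
  obtain ⟨T₀, hT₀⟩ := Filter.eventually_atTop.1 (hlim.eventually_le_const zero_lt_one)
  refine ⟨Kc * (K₂ + 1 / ‖c‖), by positivity,
    max (max T₀ 3) (1 / ‖c‖), le_max_of_le_left (le_max_right _ _), ?_⟩
  intro t ht x hx
  have htT₀ : T₀ ≤ t := (le_max_left _ _).trans ((le_max_left _ _).trans ht)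
  have ht3 : 3 ≤ t := (le_max_right _ _).trans ((le_max_left _ _).trans ht)
  have htc : 1 / ‖c‖ ≤ t := (le_max_right _ _).trans ht
  have ht0 : 0 < t := by linarith
  have hlog := one_le_log_of_three_le ht3
  have hlogt : Real.log t ≤ t := (Real.log_le_sub_one_of_pos ht0).trans (by linarith)
  set ε := K₂ * (Real.log t / t) with hε
  have hlt0 : 0 ≤ Real.log t / t := by positivity
  have hε0 : 0 ≤ ε := by positivity
  set s := x - velocity γ δ (lam i) * t with hs
  set H := blockScale lam γ δ i x t with hH
  have hHdef : H = 1 + |s| + |t| := rfl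
  have hHt : t ≤ H := by rw [hHdef, abs_of_pos ht0]; linarith [abs_nonneg s]
  have hHκ : H ≤ κ * t := by
    rw [hHdef, abs_of_pos ht0, hκ]
    have := mul_le_mul_of_nonneg_left hlogt hK₀
    linarith
  set ρ := Complex.exp (2 * theta n lam a γ δ x t i (lam i)) with hρ
  have hρ0 : ρ ≠ 0 := Complex.exp_ne_zero _
  have hρn : 0 < ‖ρ‖ := norm_pos_iff.2 hρ0
  set τ : ℂ := c * t with hτ
  have hτn : ‖τ‖ = ‖c‖ * t := by
    rw [hτ, norm_mul, Complex.norm_real, Real.norm_of_nonneg ht0.le]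
  have hτ1 : 1 ≤ ‖τ‖ := by
    rw [hτn]
    rw [div_le_iff₀ hcn] at htc
    linarith
  have hτ0 : τ ≠ 0 := by rw [← norm_pos_iff]; linarith
  have hτinv : 1 / ‖τ‖ ≤ (1 / ‖c‖) * (Real.log t / t) := by
    rw [hτn, ← one_div_mul_one_div]
    gcongr
  let P : Matrix (Fin N) (Fin N) ℂ := Matrix.of fun p r =>
    if p.val ≤ r.val then Phi n lam a γ δ x t i (r.val - p.val) 0 / (ρ * τ ^ (r.val - p.val)) else 0
  have hP : ∀ p r, ‖P p r - expNilpotent N p r‖ ≤ ε := by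
    intro p r
    simp only [P, expNilpotent, Matrix.of_apply]
    split_ifs with hpr
    · set m := r.val - p.val with hm
      have hmN : m ≤ N := by have := r.isLt; omega
      obtain ⟨-, -, h3⟩ := hPhi x t m hmN
      have hf : (m.factorial : ℂ) ≠ 0 := by exact_mod_cast m.factorial_ne_zero
      have e1 : Phi n lam a γ δ x t i m 0 / (ρ * τ ^ m) - 1 / (m.factorial : ℂ) =
          (Phi n lam a γ δ x t i m 0 - τ ^ m / (m.factorial : ℂ) * ρ) / (ρ * τ ^ m) := by
        field_simp
      rw [e1, norm_div, norm_mul, norm_pow, hτn, div_le_iff₀ (by positivity)]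
      have hs1 : 1 + |s| ≤ (1 + K₀) * Real.log t := by linarith
      have h4 : ‖Phi n lam a γ δ x t i m 0 - τ ^ m / (m.factorial : ℂ) * ρ‖ * t ≤
          K₁ * ‖ρ‖ * ((1 + K₀) * Real.log t) * (κ * t) ^ m := by
        refine (mul_le_mul_of_nonneg_left hHt (norm_nonneg _)).trans (h3.trans ?_)
        have : 0 ≤ H := by linarith
        gcongr
      have h5 : κ ^ m ≤ κ ^ N * ((1 + 1 / ‖c‖) ^ N * ‖c‖ ^ m) := by
        have b1 : κ ^ m ≤ κ ^ N := pow_le_pow_right₀ (by rw [hκ]; linarith) hmN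
        have b2 : 1 ≤ (1 + 1 / ‖c‖) ^ N * ‖c‖ ^ m := by
          have b3 : (1 / ‖c‖) ^ m ≤ (1 + 1 / ‖c‖) ^ N := by
            calc _ ≤ (1 + 1 / ‖c‖) ^ m := by gcongr; linarith
              _ ≤ _ := pow_le_pow_right₀ (by
                have : 0 ≤ 1 / ‖c‖ := by positivity
                linarith) hmN
          rw [div_pow, one_pow, div_le_iff₀ (by positivity)] at b3
          exact b3
        calc κ ^ m ≤ κ ^ N * 1 := by rw [mul_one]; exact b1
          _ ≤ _ := by gcongr
      rw [← le_div_iff₀ ht0] at h4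
      refine h4.trans ?_
      rw [hε, hK₂, mul_pow, mul_pow]
      calc _ = (K₁ * (1 + K₀) * ‖ρ‖ * (Real.log t / t) * t ^ m) * κ ^ m := by ring
        _ ≤ (K₁ * (1 + K₀) * ‖ρ‖ * (Real.log t / t) * t ^ m) *
            (κ ^ N * ((1 + 1 / ‖c‖) ^ N * ‖c‖ ^ m)) := by gcongr
        _ = _ := by ring
    · simpa using hε0
  have hE : ∀ p r, expBlock n lam a γ δ x t i p r = ρ * (τ ^ r.val / τ ^ p.val) * P p r := by
    intro p r
    simp only [expBlock, P, Matrix.of_apply]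
    split_ifs with hpr
    · have e1 : τ ^ r.val = τ ^ (r.val - p.val) * τ ^ p.val := by rw [← pow_add]; congr 1; omega
      rw [e1]
      field_simp
    · ring
  obtain ⟨C, hC1, hC2, hC3⟩ := hcol ρ τ P (expBlock n lam a γ δ x t i)
    (fun q => mixRatio n lam a γ δ x t ⟨i, q⟩) ε hτ1 hε0 (hT₀ t htT₀) hP hE (fun q => rfl)
  have hfin : Kc * (ε + 1 / ‖τ‖) ≤ Kc * (K₂ + 1 / ‖c‖) * (Real.log t / t) := by
    rw [mul_assoc, add_mul]
    gcongr
  exact ⟨C, hC1, fun p q => (hC2 p q).trans hfin, fun p q => (hC3 p q).trans hfin⟩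

end

end Hirota

namespace Hirota

noncomputable section

open Matrix

variable {k : ℕ} (n : Fin k → ℕ) (lam : Fin k → ℂ) (a : Fin k → ℕ → ℂ) (γ δ : ℝ)

/-- The exponential decay away from the characteristic line beats the growth of the Taylor
coefficients. -/
theorem pow_mul_exp_neg_le {K₀ t y : ℝ} (hK₀ : 0 ≤ K₀) (ht : 3 ≤ t) (hy : Real.log t ≤ y)
    {m N : ℕ} (hm : m ≤ N) :
    (1 + K₀ * y + t) ^ m * Real.exp (-((N + 1) * y)) ≤ (2 + K₀) ^ N / t := by
  have ht0 : 0 < t := by linarith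
  have hy0 : 1 ≤ y := (one_le_log_of_three_le ht).trans hy
  have hty : t ≤ Real.exp y := by rwa [Real.log_le_iff_le_exp ht0] at hy
  have hye : y + 1 ≤ Real.exp y := Real.add_one_le_exp y
  have h1 : 1 + K₀ * y + t ≤ (2 + K₀) * Real.exp y := by nlinarith
  calc _ ≤ ((2 + K₀) * Real.exp y) ^ m * Real.exp (-((N + 1) * y)) := by gcongr
    _ = (2 + K₀) ^ m * Real.exp (-((N - m) * y + y)) := by
        rw [mul_pow, mul_assoc, ← Real.exp_nat_mul, ← Real.exp_add]
        congr 2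
        ring
    _ ≤ (2 + K₀) ^ N * Real.exp (-Real.log t) := by
        have hmN : (m : ℝ) ≤ N := by exact_mod_cast hm
        gcongr
        · linarith
        · nlinarith
    _ = _ := by rw [Real.exp_neg, Real.exp_log ht0]; rfl

theorem BlockApprox.mono {x t : ℝ} {i : Fin k} {ε ε' : ℝ}
    (h : BlockApprox n lam a γ δ x t i ε) (hε : ε ≤ ε') : BlockApprox n lam a γ δ x t i ε' := by
  obtain ⟨C, h1, h2, h3⟩ := h
  exact ⟨C, h1, fun p q => (h2 p q).trans hε, fun p q => (h3 p q).trans hε⟩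

theorem mixRatio_ne_zero (hγδ : γ ≠ 0 ∨ δ ≠ 0) {x t : ℝ} (ht : t ≠ 0) (u : Idx n)
    (hlam : 0 < (lam u.1).im) : mixRatio n lam a γ δ x t u ≠ 0 := by
  have h1 : charCoeff γ δ (lam u.1) * t ≠ 0 :=
    mul_ne_zero (charCoeff_ne_zero hγδ hlam) (by exact_mod_cast ht)
  exact div_ne_zero (mul_ne_zero (mul_ne_zero (Complex.exp_ne_zero _) (antiEntry_ne_zero _))
    (pow_ne_zero _ h1)) (pow_ne_zero _ h1)

/-- Away from the characteristic line of the block `i`, the matrix of `exp (2 θ)` or its inverse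
is small. -/
theorem blockApprox_far (hγδ : γ ≠ 0 ∨ δ ≠ 0) (i : Fin k) (hi : 1 ≤ n i)
    (hlam : 0 < (lam i).im) :
    ∃ K > 0, ∃ T ≥ 3, ∀ t ≥ T, ∀ x,
      (n i + 1) / (2 * (lam i).im) * Real.log t ≤ |x - velocity γ δ (lam i) * t| →
      BlockApprox n lam a γ δ x t i (K * (Real.log t / t)) := by
  obtain ⟨K₁, hK₁, hPhi⟩ := Phi_bounds n lam a γ δ i
  set c := charCoeff γ δ (lam i) with hc
  have hc0 : c ≠ 0 := charCoeff_ne_zero hγδ hlam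
  have hcn : 0 < ‖c‖ := norm_pos_iff.2 hc0
  set N := n i with hN
  set K₀ : ℝ := (N + 1) / (2 * (lam i).im) with hK₀
  have hK₀0 : 0 < K₀ := by positivity
  set A : ℝ := Real.exp (2 * (a i 0).re) with hA
  set R : ℝ := (A + A⁻¹) * (2 + K₀) ^ N with hR
  have hR0 : 0 < R := by positivity
  set W : ℝ := ∑ q : Fin N, (‖antiEntry q‖ + ‖antiEntry q‖⁻¹) with hW
  have hWs : ∀ q : Fin N, ‖antiEntry q‖ + ‖antiEntry q‖⁻¹ ≤ W := fun q =>
    Finset.single_le_sum (f := fun q : Fin N => ‖antiEntry q‖ + ‖antiEntry q‖⁻¹)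
      (fun q _ => by positivity) (Finset.mem_univ q)
  have hW0 : 0 ≤ W := Finset.sum_nonneg fun q _ => by positivity
  have hW1 : ∀ q : Fin N, ‖antiEntry q‖ ≤ W := fun q => by
    have := hWs q
    have : 0 ≤ ‖antiEntry q‖⁻¹ := by positivity
    linarith
  have hW2 : ∀ q : Fin N, ‖antiEntry q‖⁻¹ ≤ W := fun q => by
    have := hWs q
    have : 0 ≤ ‖antiEntry q‖ := by positivity
    linarith
  clear_value W
  refine ⟨K₁ * R + W * (1 + ‖c‖) ^ N * R, by positivity, max 3 (1 / ‖c‖), le_max_left _ _, ?_⟩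
  intro t ht x hx
  have ht3 : 3 ≤ t := (le_max_left _ _).trans ht
  have htc : 1 / ‖c‖ ≤ t := (le_max_right _ _).trans ht
  have ht0 : 0 < t := by linarith
  have hlog := one_le_log_of_three_le ht3
  set s := x - velocity γ δ (lam i) * t with hs
  set H := blockScale lam γ δ i x t with hH
  set y := |s| / K₀ with hy
  have hsy : |s| = K₀ * y := by rw [hy]; field_simp
  have hly : Real.log t ≤ y := by rw [hy, le_div_iff₀ hK₀0]; linarith
  have hHy : H = 1 + K₀ * y + t := by
    rw [← hsy, hH, blockScale, abs_of_pos ht0]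
  have hy0 : 0 ≤ y := by positivity
  have hHt : t ≤ H := by rw [hHy]; nlinarith
  set ρ := Complex.exp (2 * theta n lam a γ δ x t i (lam i)) with hρ
  have hρn : ‖ρ‖ = A * Real.exp (-(2 * (lam i).im * s)) := by
    rw [hρ, norm_exp_two_mul_theta n lam a γ δ x t i hi, hA, ← Real.exp_add]
    congr 1
  have hKy : 2 * (lam i).im * |s| = (N + 1) * y := by
    rw [hsy, hK₀]; field_simp
  set τ : ℂ := c * t with hτ
  have hτn : ‖τ‖ = ‖c‖ * t := by
    rw [hτ, norm_mul, Complex.norm_real, Real.norm_of_nonneg ht0.le]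
  have hτ1 : 1 ≤ ‖τ‖ := by
    rw [hτn]
    rw [div_le_iff₀ hcn] at htc
    linarith
  have hτ0 : τ ≠ 0 := by rw [← norm_pos_iff]; linarith
  have hA0 : 0 < A := Real.exp_pos _
  have hbase : ∀ m ≤ N, ∀ B : ℝ, 0 ≤ B → B ≤ A + A⁻¹ →
      B * Real.exp (-((N + 1) * y)) * H ^ m ≤ R / t := by
    intro m hm B hB0 hB
    have h1 := pow_mul_exp_neg_le hK₀0.le ht3 hly hm
    rw [hHy]
    calc _ = B * ((1 + K₀ * y + t) ^ m * Real.exp (-((N + 1) * y))) := by ring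
      _ ≤ (A + A⁻¹) * ((2 + K₀) ^ N / t) := by gcongr
      _ = _ := by rw [hR]; ring
  have hτpow : ∀ p q : Fin N, ‖τ‖ ^ p.val / ‖τ‖ ^ q.val ≤ (1 + ‖c‖) ^ N * H ^ p.val := by
    intro p q
    have h1 : 1 ≤ ‖τ‖ ^ q.val := one_le_pow₀ hτ1
    refine (div_le_self (by positivity) h1).trans ?_
    rw [hτn, mul_pow]
    have h2 : ‖c‖ ^ p.val ≤ (1 + ‖c‖) ^ N := by
      calc _ ≤ (1 + ‖c‖) ^ p.val := by gcongr; linarith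
        _ ≤ _ := pow_le_pow_right₀ (by linarith) p.isLt.le
    gcongr
  set cc : Fin N → ℂ := fun q => mixRatio n lam a γ δ x t ⟨i, q⟩ with hcc
  have hccn : ∀ q, ‖cc q‖ = ‖ρ‖ * ‖antiEntry q‖ * (‖τ‖ ^ q.val / ‖τ‖ ^ (Fin.rev q).val) := by
    intro q
    simp only [hcc, mixRatio]
    rw [norm_div, norm_mul, norm_mul, norm_pow, norm_pow]
    ring
  have hcc0 : ∀ q, cc q ≠ 0 := fun q => mixRatio_ne_zero n lam a γ δ hγδ ht0.ne' ⟨i, q⟩ hlam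
  have hlogt : ∀ B : ℝ, 0 ≤ B → B / t ≤ B * (Real.log t / t) := by
    intro B hB
    rw [div_eq_mul_one_div]
    gcongr
  have hE0 : 0 ≤ K₁ * R + W * (1 + ‖c‖) ^ N * R := by positivity
  rcases le_total 0 s with hs0 | hs0
  · have hρ1 : ‖ρ‖ = A * Real.exp (-((N + 1) * y)) := by
      rw [hρn, ← hKy, abs_of_nonneg hs0]
    have hρH : ∀ m ≤ N, ‖ρ‖ * H ^ m ≤ R / t := fun m hm => by
      rw [hρ1]
      exact hbase m hm A hA0.le (by have := inv_pos.2 hA0; linarith)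
    have hccb : ∀ q, ‖cc q‖ ≤ W * (1 + ‖c‖) ^ N * R / t := by
      intro q
      rw [hccn]
      calc _ ≤ ‖ρ‖ * W * ((1 + ‖c‖) ^ N * H ^ q.val) := by
            have := hW1 q
            have := hτpow q (Fin.rev q)
            gcongr
        _ = W * (1 + ‖c‖) ^ N * (‖ρ‖ * H ^ q.val) := by ring
        _ ≤ W * (1 + ‖c‖) ^ N * (R / t) := by gcongr; exact hρH _ q.isLt.le
        _ = _ := by ring
    have hEb : ∀ p q, ‖expBlock n lam a γ δ x t i p q‖ ≤ K₁ * R / t := by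
      intro p q
      simp only [expBlock, Matrix.of_apply]
      split_ifs with h
      · have hm : q.val - p.val ≤ N := by have := q.isLt; omega
        refine ((hPhi x t _ hm).1).trans ?_
        calc _ = K₁ * (‖ρ‖ * H ^ (q.val - p.val)) := by ring
          _ ≤ K₁ * (R / t) := by gcongr; exact hρH _ hm
          _ = _ := by ring
      · rw [norm_zero]; positivity
    refine ⟨Matrix.diagonal fun q => colScale (cc q), ?_, ?_, ?_⟩
    · rw [Matrix.det_diagonal, isUnit_iff_ne_zero, Finset.prod_ne_zero_iff]
      exact fun q _ => colScale_ne_zero _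
    · intro p q
      rw [Matrix.diagonal_apply]
      have : ‖(if p = q then colScale (cc p) else 0) - if p = q then colScale (cc q) else 0‖
          = 0 := by
        split_ifs with h
        · rw [h, sub_self, norm_zero]
        · simp
      refine this.le.trans ?_
      positivity
    · intro p q
      rw [Matrix.mul_diagonal]
      refine le_trans ?_ (hlogt _ hE0)
      rw [add_div]
      refine (norm_sub_le _ _).trans (add_le_add ?_ ?_)
      · rw [norm_mul]
        exact (mul_le_of_le_one_right (norm_nonneg _) (norm_colScale_le_one _)).trans (hEb p q)
      · split_ifs
        · exact (norm_mul_colScale_le _).trans (hccb q)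
        · rw [norm_zero]; positivity
  · have hρ1 : ‖ρ‖⁻¹ = A⁻¹ * Real.exp (-((N + 1) * y)) := by
      rw [hρn, ← hKy, abs_of_nonpos hs0, mul_inv]
      congr 1
      rw [← Real.exp_neg]
      congr 1
      ring
    have hρH : ∀ m ≤ N, ‖ρ‖⁻¹ * H ^ m ≤ R / t := fun m hm => by
      rw [hρ1]
      exact hbase m hm A⁻¹ (by positivity) (by linarith)
    have hccb : ∀ q, ‖cc q‖⁻¹ ≤ W * (1 + ‖c‖) ^ N * R / t := by
      intro q
      rw [hccn, mul_inv, mul_inv, inv_div]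
      calc _ ≤ ‖ρ‖⁻¹ * W * ((1 + ‖c‖) ^ N * H ^ (Fin.rev q).val) := by
            have := hW2 q
            have := hτpow (Fin.rev q) q
            gcongr
        _ = W * (1 + ‖c‖) ^ N * (‖ρ‖⁻¹ * H ^ (Fin.rev q).val) := by ring
        _ ≤ W * (1 + ‖c‖) ^ N * (R / t) := by gcongr; exact hρH _ (Fin.rev q).isLt.le
        _ = _ := by ring
    have hEb : ∀ p q, ‖expBlockInv n lam a γ δ x t i p q‖ ≤ K₁ * R / t := by
      intro p q
      simp only [expBlockInv, Matrix.of_apply]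
      split_ifs with h
      · have hm : q.val - p.val ≤ N := by have := q.isLt; omega
        refine ((hPhi x t _ hm).2.1).trans ?_
        calc _ = K₁ * (‖ρ‖⁻¹ * H ^ (q.val - p.val)) := by ring
          _ ≤ K₁ * (R / t) := by gcongr; exact hρH _ hm
          _ = _ := by ring
      · rw [norm_zero]; positivity
    obtain ⟨D, hD⟩ : ∃ D : Matrix (Fin N) (Fin N) ℂ, ∀ p q, D p q =
        if p = Fin.rev q then cc q * colScale (cc q) else 0 :=
      ⟨Matrix.of fun p q => _, fun _ _ => rfl⟩
    have hEE := expBlock_mul_expBlockInv n lam a γ δ x t i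
    have hDu : IsUnit D.det := by
      rw [isUnit_iff_ne_zero]
      intro h0
      obtain ⟨v, hv, hv0⟩ := Matrix.exists_mulVec_eq_zero_iff.2 h0
      apply hv
      ext q
      have h1 := congrFun hv0 (Fin.rev q)
      have h2 : (D *ᵥ v) (Fin.rev q) = cc q * colScale (cc q) * v q := by
        unfold Matrix.mulVec dotProduct
        rw [Finset.sum_eq_single q]
        · change D (Fin.rev q) q * v q = _
          rw [hD, if_pos rfl]
        · intro r _ hr
          change D (Fin.rev q) r * v r = 0
          rw [hD, if_neg (fun h => hr (Fin.rev_injective h).symm), zero_mul]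
        · simp
      rw [h2] at h1
      exact (mul_eq_zero.1 h1).resolve_left (mul_ne_zero (hcc0 q) (colScale_ne_zero _))
    refine ⟨expBlockInv n lam a γ δ x t i * D, ?_, ?_, ?_⟩
    · rw [Matrix.det_mul]
      exact (Matrix.isUnit_det_of_left_inverse hEE).mul hDu
    · intro p q
      have h1 : (expBlockInv n lam a γ δ x t i * D) p q =
          expBlockInv n lam a γ δ x t i p (Fin.rev q) * (cc q * colScale (cc q)) := by
        rw [Matrix.mul_apply, Finset.sum_eq_single (Fin.rev q)]
        · rw [hD, if_pos rfl]
        · intro r _ hr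
          rw [hD, if_neg hr, mul_zero]
        · simp
      rw [h1]
      refine le_trans ?_ (hlogt _ hE0)
      rw [add_div]
      refine (norm_sub_le _ _).trans (add_le_add ?_ ?_)
      · rw [norm_mul]
        exact (mul_le_of_le_one_right (norm_nonneg _) (norm_mul_colScale_le_one _)).trans
          (hEb p _)
      · split_ifs
        · exact (norm_colScale_le_inv _ (hcc0 q)).trans (hccb q)
        · rw [norm_zero]; positivity
    · intro p q
      rw [← Matrix.mul_assoc, hEE, Matrix.one_mul, hD]
      change ‖(if p = Fin.rev q then cc q * colScale (cc q) else 0) -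
        if p = Fin.rev q then cc q * colScale (cc q) else 0‖ ≤ _
      rw [sub_self, norm_zero]
      positivity

theorem exists_blockApprox (hγδ : γ ≠ 0 ∨ δ ≠ 0) (hn : ∀ i, 1 ≤ n i)
    (hlam : ∀ i, 0 < (lam i).im) :
    ∃ K > 0, ∃ T ≥ 3, ∀ t ≥ T, ∀ x i, BlockApprox n lam a γ δ x t i (K * (Real.log t / t)) := by
  have h : ∀ i, ∃ K > 0, ∃ T ≥ 3, ∀ t ≥ T, ∀ x,
      BlockApprox n lam a γ δ x t i (K * (Real.log t / t)) := by
    intro i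
    obtain ⟨K₁, hK₁, T₁, hT₁, h₁⟩ := blockApprox_far n lam a γ δ hγδ i (hn i) (hlam i)
    have hl := hlam i
    obtain ⟨K₂, hK₂, T₂, hT₂, h₂⟩ := blockApprox_near n lam a γ δ hγδ i (hlam i)
      ((n i + 1) / (2 * (lam i).im)) (by positivity)
    refine ⟨K₁ + K₂, by positivity, max T₁ T₂, le_max_of_le_left hT₁, ?_⟩
    intro t ht x
    have ht₁ : T₁ ≤ t := (le_max_left _ _).trans ht
    have ht₂ : T₂ ≤ t := (le_max_right _ _).trans ht
    have hlt : 0 ≤ Real.log t / t := by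
      have := one_le_log_of_three_le (hT₁.trans ht₁)
      have : 3 ≤ t := hT₁.trans ht₁
      positivity
    rcases le_total ((n i + 1) / (2 * (lam i).im) * Real.log t)
      |x - velocity γ δ (lam i) * t| with hx | hx
    · exact (h₁ t ht₁ x hx).mono n lam a γ δ (mul_le_mul_of_nonneg_right (by linarith) hlt)
    · exact (h₂ t ht₂ x hx).mono n lam a γ δ (mul_le_mul_of_nonneg_right (by linarith) hlt)
  choose K hK T hT h using h
  have hKs : ∀ i, K i ≤ 1 + ∑ i, K i := fun i => by
    have := Finset.single_le_sum (f := K) (fun q _ => (hK q).le) (Finset.mem_univ i)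
    linarith
  have hTs : ∀ i, T i ≤ 3 + ∑ i, T i := fun i => by
    have := Finset.single_le_sum (f := T) (fun q _ => by linarith [hT q]) (Finset.mem_univ i)
    linarith
  have hK0 : 0 ≤ ∑ i, K i := Finset.sum_nonneg fun i _ => (hK i).le
  have hT0 : 0 ≤ ∑ i, T i := Finset.sum_nonneg fun i _ => by linarith [hT i]
  refine ⟨1 + ∑ i, K i, by linarith, 3 + ∑ i, T i, by linarith, ?_⟩
  intro t ht x i
  refine (h i t ((hTs i).trans ht) x).mono n lam a γ δ (mul_le_mul_of_nonneg_right (hKs i) ?_)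
  have ht3 : 3 ≤ t := by linarith
  have := one_le_log_of_three_le ht3
  positivity

/-- The position with the same block and the reversed index in the block. -/
def revIdx {n : Fin k → ℕ} (u : Idx n) : Idx n := ⟨u.1, Fin.rev u.2⟩

/-- The matrix of the multiplication by `exp (2 θ)`. -/
def expMat (x t : ℝ) : Matrix (Idx n) (Idx n) ℂ :=
  Matrix.blockDiagonal' fun i => expBlock n lam a γ δ x t i

theorem isUnit_det_blockDiagonal' (C : ∀ i, Matrix (Fin (n i)) (Fin (n i)) ℂ)
    (hC : ∀ i, IsUnit (C i).det) : IsUnit (Matrix.blockDiagonal' C).det := by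
  apply Matrix.isUnit_det_of_left_inverse (B := Matrix.blockDiagonal' fun i => (C i)⁻¹)
  rw [← Matrix.blockDiagonal'_mul]
  have : (fun i => (C i)⁻¹ * C i) = fun i => 1 := by
    ext1 i
    exact Matrix.nonsing_inv_mul _ (hC i)
  rw [this]
  exact Matrix.blockDiagonal'_one

/-- For large `t`, uniformly in `x`, the column space of `[1; expMat]` has a basis that is close to
mixed columns: multiples of `(e_v, mixRatio e_{rev v})`. -/
theorem exists_approx_columns (hγδ : γ ≠ 0 ∨ δ ≠ 0) (hn : ∀ i, 1 ≤ n i)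
    (hlam : ∀ i, 0 < (lam i).im) :
    ∃ K > 0, ∃ T ≥ 3, ∀ t ≥ T, ∀ x, ∃ C : Matrix (Idx n) (Idx n) ℂ, IsUnit C.det ∧
      (∀ u v, ‖C u v - if u = v then colScale (mixRatio n lam a γ δ x t v) else 0‖
        ≤ K * (Real.log t / t)) ∧
      (∀ u v, ‖(expMat n lam a γ δ x t * C) u v - if u = revIdx v then
        mixRatio n lam a γ δ x t v * colScale (mixRatio n lam a γ δ x t v) else 0‖
        ≤ K * (Real.log t / t)) := by
  obtain ⟨K, hK, T, hT, h⟩ := exists_blockApprox n lam a γ δ hγδ hn hlam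
  refine ⟨K, hK, T, hT, ?_⟩
  intro t ht x
  have ht3 : 3 ≤ t := hT.trans ht
  have hε : 0 ≤ K * (Real.log t / t) := by
    have := one_le_log_of_three_le ht3
    positivity
  choose C hC1 hC2 hC3 using fun i => h t ht x i
  refine ⟨Matrix.blockDiagonal' C, isUnit_det_blockDiagonal' n C hC1, ?_, ?_⟩
  · rintro ⟨i, p⟩ ⟨j, q⟩
    by_cases hij : i = j
    · subst hij
      rw [Matrix.blockDiagonal'_apply_eq]
      convert hC2 i p q using 4
      simp
    · rw [Matrix.blockDiagonal'_apply_ne _ _ _ hij, if_neg]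
      · simpa using hε
      · intro h; exact hij (congrArg Sigma.fst h)
  · rintro ⟨i, p⟩ ⟨j, q⟩
    rw [expMat, ← Matrix.blockDiagonal'_mul]
    by_cases hij : i = j
    · subst hij
      rw [Matrix.blockDiagonal'_apply_eq]
      convert hC3 i p q using 4
      simp [revIdx]
    · rw [Matrix.blockDiagonal'_apply_ne _ _ _ hij, if_neg]
      · simpa using hε
      · intro h; exact hij (congrArg Sigma.fst h)

end

end Hirota

namespace Hirota

noncomputable section

open Matrix

variable {k : ℕ} (n : Fin k → ℕ) (lam : Fin k → ℂ) (a : Fin k → ℕ → ℂ) (γ δ : ℝ)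

/-! ### The soliton in terms of the Gram matrix -/

theorem X_zero (x t : ℝ) (u v : Idx n) :
    X n lam a γ δ x t (u, 0) v = expMat n lam a γ δ x t u v := by
  obtain ⟨i, p⟩ := u
  obtain ⟨j, q⟩ := v
  rw [expMat]
  by_cases hij : i = j
  · subst hij
    rw [Matrix.blockDiagonal'_apply_eq]
    simp [X, expBlock]
  · rw [Matrix.blockDiagonal'_apply_ne _ _ _ hij]
    simp [X, hij]

theorem X_one (x t : ℝ) (u v : Idx n) :
    X n lam a γ δ x t (u, 1) v = (1 : Matrix (Idx n) (Idx n) ℂ) u v := by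
  rw [Matrix.one_apply]
  simp only [X, Matrix.of_apply, Phi, Matrix.cons_val_one]
  by_cases huv : u = v
  · subst huv
    simp
  · rw [if_neg huv]
    split_ifs with h h2
    · exact absurd (Idx.ext' h.1 (by have := h.2; omega)) huv
    · rfl
    · rfl

theorem S_apply (u v : Idx n) (c d : Fin 2) :
    S n lam (u, c) (v, d) = if c = d then Complex.I * gram n lam u v else 0 := by
  simp only [S, gram, Matrix.of_apply]
  split_ifs
  · rw [← mul_assoc]
    simp
  · rfl

/-- The first components of `X` form `expMat` and the second ones the identity matrix. -/
theorem M_eq (x t : ℝ) : M n lam a γ δ x t =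
    Complex.I • pairGram (gram n lam) 1 (expMat n lam a γ δ x t) := by
  ext u v
  simp only [M, pairGram, Matrix.mul_apply, Fintype.sum_prod_type, Fin.sum_univ_two, S_apply,
    Matrix.conjTranspose_apply, X_zero, X_one, Matrix.smul_apply, Matrix.add_apply, smul_eq_mul,
    mul_add, Finset.mul_sum, Finset.sum_mul, Finset.sum_add_distrib, if_true, zero_ne_one,
    one_ne_zero, if_false, mul_zero, Finset.sum_const_zero, add_zero, zero_add]
  rw [add_comm]
  congr 1 <;>
  · refine Finset.sum_congr rfl fun r _ => Finset.sum_congr rfl fun s _ => ?_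
    ring

theorem pairGram_one_pos (hlam : ∀ i, 0 < (lam i).im) (hinj : Function.Injective lam)
    (E : Matrix (Idx n) (Idx n) ℂ) (v : Idx n → ℂ) (hv : v ≠ 0) :
    0 < (star v ⬝ᵥ (pairGram (gram n lam) 1 E *ᵥ v)).re :=
  pairGram_pos (gram_pos hlam hinj) 1 E (fun w hw _ => by simpa using hw) v hv

theorem isUnit_det_M (hlam : ∀ i, 0 < (lam i).im) (hinj : Function.Injective lam) (x t : ℝ) :
    IsUnit (M n lam a γ δ x t).det := by
  rw [M_eq, Matrix.det_smul]
  exact ((isUnit_iff_ne_zero.2 Complex.I_ne_zero).pow _).mul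
    (isUnit_det_of_pos (pairGram_one_pos n lam hlam hinj _))

theorem Y_one (x t : ℝ) : Y n lam a γ δ x t 1 = evalVec n := by
  ext u
  simp [Y, Phi, evalVec]

theorem Y_zero (x t : ℝ) :
    Y n lam a γ δ x t 0 = evalVec n ᵥ* expMat n lam a γ δ x t := by
  ext ⟨i, p⟩
  have hn : 0 < n i := p.pos
  change _ = ∑ w, evalVec n w * expMat n lam a γ δ x t w ⟨i, p⟩
  rw [Finset.sum_eq_single (⟨i, ⟨0, hn⟩⟩ : Idx n)]
  · rw [← X_zero]
    simp [Y, X, evalVec]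
  · rintro ⟨j, q⟩ _ hjq
    by_cases hq : q.val = 0
    · have hij : j ≠ i := by
        rintro rfl
        exact hjq (Idx.ext' rfl hq)
      rw [expMat, Matrix.blockDiagonal'_apply_ne _ _ _ hij, mul_zero]
    · simp [evalVec, hq]
  · simp

/-- The soliton depends on the column space of `[1; expMat]` only. -/
theorem soliton_eq (hlam : ∀ i, 0 < (lam i).im) (hinj : Function.Injective lam) (x t : ℝ) :
    soliton n lam a γ δ x t = -2 * Complex.I *
      projForm (gram n lam) (evalVec n) 1 (expMat n lam a γ δ x t) := by
  have hu := isUnit_det_of_pos (pairGram_one_pos n lam hlam hinj (expMat n lam a γ δ x t))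
  have h1 : (Complex.I • pairGram (gram n lam) 1 (expMat n lam a γ δ x t))⁻¹ =
      (-Complex.I) • (pairGram (gram n lam) 1 (expMat n lam a γ δ x t))⁻¹ := by
    apply Matrix.inv_eq_left_inv
    rw [Matrix.smul_mul, Matrix.mul_smul, smul_smul, Matrix.nonsing_inv_mul _ hu]
    simp
  rw [soliton, projForm, M_eq, h1, Y_one, Y_zero, Matrix.vecMul_one, Matrix.smul_mulVec,
    dotProduct_smul, smul_eq_mul]
  ring

end

end Hirota

namespace Hirota

noncomputable section

open Matrix

variable {k : ℕ} {n : Fin k → ℕ} {lam : Fin k → ℂ}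

/-! ### The model column space with one mixed column -/

/-- The matrix with the columns `ξ_v e_v`. -/
def lowColumns (ξ : Idx n → ℂ) : Matrix (Idx n) (Idx n) ℂ :=
  Matrix.of fun u v => if u = v then ξ v else 0

/-- The matrix with the columns `η_v e_{rev v}`. -/
def highColumns (η : Idx n → ℂ) : Matrix (Idx n) (Idx n) ℂ :=
  Matrix.of fun u v => if u = revIdx v then η v else 0

theorem revIdx_revIdx (u : Idx n) : revIdx (revIdx u) = u := by
  simp [revIdx]

theorem eq_revIdx_iff {u v : Idx n} : u = revIdx v ↔ revIdx u = v :=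
  ⟨fun h => by rw [h, revIdx_revIdx], fun h => by rw [← h, revIdx_revIdx]⟩

theorem lowColumns_mulVec (ξ v : Idx n → ℂ) (u : Idx n) :
    (lowColumns ξ *ᵥ v) u = ξ u * v u := by
  change ∑ w, (if u = w then ξ w else 0) * v w = _
  simp

theorem highColumns_mulVec (η v : Idx n → ℂ) (u : Idx n) :
    (highColumns η *ᵥ v) u = η (revIdx u) * v (revIdx u) := by
  change ∑ w, (if u = revIdx w then η w else 0) * v w = _
  simp [eq_revIdx_iff]

theorem lowColumns_conjTranspose_mulVec (ξ v : Idx n → ℂ) (u : Idx n) :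
    ((lowColumns ξ)ᴴ *ᵥ v) u = star (ξ u) * v u := by
  change ∑ w, star (if w = u then ξ u else 0) * v w = _
  rw [Finset.sum_eq_single u]
  · simp
  · intro w _ hw
    simp [hw]
  · simp

theorem highColumns_conjTranspose_mulVec (η v : Idx n → ℂ) (u : Idx n) :
    ((highColumns η)ᴴ *ᵥ v) u = star (η u) * v (revIdx u) := by
  change ∑ w, star (if w = revIdx u then η u else 0) * v w = _
  rw [Finset.sum_eq_single (revIdx u)]
  · simp
  · intro w _ hw
    simp [hw]
  · simp

/-- The form of a vector that is orthogonal to all positions in its support but one. -/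
theorem star_dotProduct_eq_of_orthogonal {m : Fin k → ℕ} {g : Idx n → ℂ} {u : Idx n}
    (hu : g u = 1) (h0 : ∀ v : Idx n, m v.1 ≤ v.2.val → g v = 0) {f : Idx n → ℂ}
    (h : ∀ v : Idx n, v ≠ u → v.2.val < m v.1 → f v = 0) : star g ⬝ᵥ f = f u := by
  change ∑ v, star (g v) * f v = _
  rw [Finset.sum_eq_single u]
  · simp [hu]
  · intro v _ hv
    rcases lt_or_ge v.2.val (m v.1) with hm | hm
    · rw [h v hv hm, mul_zero]
    · rw [h0 v hm, star_zero, zero_mul]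
  · simp

theorem model_injective {ξ η : Idx n → ℂ} (h : ∀ u, ξ u ≠ 0 ∨ η u ≠ 0) (v : Idx n → ℂ)
    (h1 : lowColumns ξ *ᵥ v = 0) (h2 : highColumns η *ᵥ v = 0) : v = 0 := by
  ext u
  have e1 := congrFun h1 u
  have e2 := congrFun h2 (revIdx u)
  rw [lowColumns_mulVec] at e1
  rw [highColumns_mulVec, revIdx_revIdx] at e2
  rcases h u with h | h
  · exact (mul_eq_zero.1 e1).resolve_left h
  · exact (mul_eq_zero.1 e2).resolve_left h

/-- The value of `projForm` on a model column space: at each position but `u₀` the column is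
of one of the two pure kinds. The pure columns contribute Blaschke factors only. -/
theorem projForm_model (hlam : ∀ i, 0 < (lam i).im) (hinj : Function.Injective lam)
    {m₁ m₂ : Fin k → ℕ} (hm₁ : ∀ j, m₁ j ≤ n j) (hm₂ : ∀ j, m₂ j ≤ n j) (u₀ : Idx n)
    (hu₁ : u₀.2.val + 1 = m₁ u₀.1) (hu₂ : (Fin.rev u₀.2).val + 1 = m₂ u₀.1)
    (hm : ∀ j, j ≠ u₀.1 → m₁ j + m₂ j = n j) (ξ η : Idx n → ℂ)
    (h₁ : ∀ u : Idx n, u ≠ u₀ → u.2.val < m₁ u.1 → ξ u ≠ 0 ∧ η u = 0)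
    (h₂ : ∀ u : Idx n, u ≠ u₀ → m₁ u.1 ≤ u.2.val → ξ u = 0 ∧ η u ≠ 0)
    (h₀ : ξ u₀ ≠ 0) :
    projForm (gram n lam) (evalVec n) (lowColumns ξ) (highColumns η) =
      (ξ u₀ * blaschke m₁ lam u₀.1) * star (η u₀ * blaschke m₂ lam u₀.1) /
        ((‖ξ u₀‖ ^ 2 * (‖blaschke m₁ lam u₀.1‖ ^ 2 / (2 * (lam u₀.1).im)) +
          ‖η u₀‖ ^ 2 * (‖blaschke m₂ lam u₀.1‖ ^ 2 / (2 * (lam u₀.1).im)) : ℝ) : ℂ) := by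
  obtain ⟨g₁, hg1, hg1s, hg1o, hg1e, hg1q⟩ := exists_residual hlam hinj hm₁ u₀ hu₁
  obtain ⟨g₂, hg2, hg2s, hg2o, hg2e, hg2q⟩ := exists_residual hlam hinj hm₂ (revIdx u₀) hu₂
  rw [star_dotProduct_eq_of_orthogonal hg1 hg1s hg1o] at hg1q
  rw [star_dotProduct_eq_of_orthogonal hg2 hg2s hg2o] at hg2q
  change evalVec n ⬝ᵥ g₂ = blaschke m₂ lam u₀.1 at hg2e
  change _ = ((‖blaschke m₂ lam u₀.1‖ ^ 2 / (2 * (lam u₀.1).im) : ℝ) : ℂ) at hg2q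
  -- the columns of the second kind are those whose reversed position is covered by `m₂`
  have hrev : ∀ u : Idx n, u ≠ u₀ → (m₁ u.1 ≤ u.2.val ↔ (revIdx u).2.val < m₂ u.1) := by
    intro u hu
    have hlt := u.2.isLt
    have hr : (revIdx u).2.val = n u.1 - (u.2.val + 1) := Fin.val_rev _
    by_cases hj : u.1 = u₀.1
    · have hne : u.2.val ≠ u₀.2.val := fun h => hu (Idx.ext' hj h)
      have h3 := u₀.2.isLt
      rw [Fin.val_rev] at hu₂
      have e : n u.1 = n u₀.1 := by rw [hj]
      have e₁ : m₁ u.1 = m₁ u₀.1 := by rw [hj]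
      have e₂ : m₂ u.1 = m₂ u₀.1 := by rw [hj]
      omega
    · have := hm u.1 hj
      omega
  -- subtracting pure columns replaces the parts of the mixed column by residual vectors
  set y₀ : Idx n → ℂ := fun u => if u = u₀ then 1 else
    if u.2.val < m₁ u.1 then ξ u₀ * g₁ u / ξ u else η u₀ * g₂ (revIdx u) / η u with hy
  have hy0 : y₀ u₀ = 1 := by simp [hy]
  have hA₁ : lowColumns ξ *ᵥ y₀ = ξ u₀ • g₁ := by
    ext u
    rw [lowColumns_mulVec, Pi.smul_apply, smul_eq_mul]
    by_cases hu : u = u₀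
    · rw [hu, hy0, hg1]
    · rcases lt_or_ge u.2.val (m₁ u.1) with hlt | hge
      · simp only [hy, if_neg hu, if_pos hlt]
        have := (h₁ u hu hlt).1
        field_simp
      · rw [(h₂ u hu hge).1, hg1s u hge, zero_mul, mul_zero]
  have hA₂ : highColumns η *ᵥ y₀ = η u₀ • g₂ := by
    ext w
    obtain ⟨u, rfl⟩ : ∃ u, w = revIdx u := ⟨revIdx w, (revIdx_revIdx w).symm⟩
    rw [highColumns_mulVec, Pi.smul_apply, smul_eq_mul, revIdx_revIdx]
    by_cases hu : u = u₀
    · rw [hu, hy0, hg2]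
    · rcases lt_or_ge u.2.val (m₁ u.1) with hlt | hge
      · have h3 : m₂ u.1 ≤ (revIdx u).2.val := by
          by_contra h
          exact absurd ((hrev u hu).2 (not_le.1 h)) (not_le.2 hlt)
        rw [(h₁ u hu hlt).2, hg2s (revIdx u) h3, zero_mul, mul_zero]
      · simp only [hy, if_neg hu, if_neg (not_lt.2 hge)]
        have := (h₂ u hu hge).2
        field_simp
  have hΓ : pairGram (gram n lam) (lowColumns ξ) (highColumns η) *ᵥ y₀ = Pi.single u₀
      ((‖ξ u₀‖ ^ 2 * (‖blaschke m₁ lam u₀.1‖ ^ 2 / (2 * (lam u₀.1).im)) +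
          ‖η u₀‖ ^ 2 * (‖blaschke m₂ lam u₀.1‖ ^ 2 / (2 * (lam u₀.1).im)) : ℝ) : ℂ) := by
    rw [pairGram, Matrix.add_mulVec, ← Matrix.mulVec_mulVec, ← Matrix.mulVec_mulVec,
      ← Matrix.mulVec_mulVec, ← Matrix.mulVec_mulVec, hA₁, hA₂, Matrix.mulVec_smul,
      Matrix.mulVec_smul, Matrix.mulVec_smul, Matrix.mulVec_smul]
    ext u
    rw [Pi.add_apply, Pi.smul_apply, Pi.smul_apply, smul_eq_mul, smul_eq_mul,
      lowColumns_conjTranspose_mulVec, highColumns_conjTranspose_mulVec]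
    by_cases hu : u = u₀
    · subst hu
      rw [Pi.single_eq_same, hg1q, hg2q, ← mul_assoc, ← mul_assoc,
        mul_comm (ξ u), mul_comm (η u)]
      have e : ∀ z : ℂ, star z * z = ((‖z‖ ^ 2 : ℝ) : ℂ) := fun z => by
        rw [mul_comm, Complex.star_def, Complex.mul_conj, Complex.normSq_eq_norm_sq]
      rw [e, e]
      push_cast
      ring
    · rw [Pi.single_eq_of_ne hu]
      rcases lt_or_ge u.2.val (m₁ u.1) with hlt | hge
      · rw [hg1o u hu hlt, (h₁ u hu hlt).2]
        simp
      · have hne : revIdx u ≠ revIdx u₀ := fun h => hu (by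
          rw [← revIdx_revIdx u, h, revIdx_revIdx])
        rw [hg2o (revIdx u) hne ((hrev u hu).1 hge), (h₂ u hu hge).1]
        simp
  have hpos := pairGram_pos (gram_pos hlam hinj) (lowColumns ξ) (highColumns η)
    (model_injective fun u => by
      by_cases hu : u = u₀
      · exact Or.inl (hu ▸ h₀)
      · rcases lt_or_ge u.2.val (m₁ u.1) with hlt | hge
        · exact Or.inl (h₁ u hu hlt).1
        · exact Or.inr (h₂ u hu hge).2)
  rw [projForm_eq_of_mixed_column (gram_isHermitian) (evalVec n) _ _ hpos u₀
    (fun u => u.2.val < m₁ u.1) ?_ ?_ y₀ hy0 _ hΓ, hA₁, hA₂, dotProduct_smul, dotProduct_smul,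
    hg1e, hg2e, smul_eq_mul, smul_eq_mul]
  · intro u hu hP w
    simp only [highColumns, Matrix.of_apply]
    split_ifs
    · exact (h₁ u hu hP).2
    · rfl
  · intro u hu hP w
    simp only [lowColumns, Matrix.of_apply]
    split_ifs
    · exact (h₂ u hu (not_lt.1 hP)).1
    · rfl

theorem model_coercive {ξ η : Idx n → ℂ} {c : ℝ} (h : ∀ u, c ≤ ‖ξ u‖ ^ 2 + ‖η u‖ ^ 2)
    (v : Idx n → ℂ) : c * ∑ u, ‖v u‖ ^ 2 ≤
      ∑ u, ‖(lowColumns ξ *ᵥ v) u‖ ^ 2 + ∑ u, ‖(highColumns η *ᵥ v) u‖ ^ 2 := by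
  have h2 : ∑ u, ‖(highColumns η *ᵥ v) u‖ ^ 2 = ∑ u, ‖η u * v u‖ ^ 2 := by
    simp only [highColumns_mulVec]
    exact Equiv.sum_comp (Function.Involutive.toPerm revIdx revIdx_revIdx)
      fun u => ‖η u * v u‖ ^ 2
  rw [h2, ← Finset.sum_add_distrib, Finset.mul_sum]
  refine Finset.sum_le_sum fun u _ => ?_
  rw [lowColumns_mulVec, norm_mul, norm_mul, mul_pow, mul_pow, ← add_mul]
  have := h u
  gcongr

/-- The orders of the sub-system that is to the left of the soliton `u`, including `u`, if the
velocities are `v`. -/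
def lowOrders (v : Fin k → ℝ) (u : Idx n) (j : Fin k) : ℕ :=
  if v j < v u.1 then n j else if j = u.1 then u.2.val + 1 else 0

/-- The orders of the sub-system that is to the right of the soliton `u`, including `u`. -/
def highOrders (v : Fin k → ℝ) (u : Idx n) : Fin k → ℕ :=
  lowOrders (fun j => -v j) (revIdx u)

theorem lowOrders_le (v : Fin k → ℝ) (u : Idx n) (j : Fin k) : lowOrders v u j ≤ n j := by
  unfold lowOrders
  split_ifs with h h2
  · exact le_rfl
  · subst h2
    exact u.2.isLt
  · exact Nat.zero_le _

theorem lowOrders_self (v : Fin k → ℝ) (u : Idx n) : lowOrders v u u.1 = u.2.val + 1 := by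
  simp [lowOrders]

theorem highOrders_self (v : Fin k → ℝ) (u : Idx n) :
    highOrders v u u.1 = (Fin.rev u.2).val + 1 :=
  lowOrders_self _ (revIdx u)

theorem lowOrders_add_highOrders {v : Fin k → ℝ} (hv : Function.Injective v) (u : Idx n)
    {j : Fin k} (hj : j ≠ u.1) : lowOrders v u j + highOrders v u j = n j := by
  have h1 : v j ≠ v u.1 := fun h => hj (hv h)
  have e : highOrders v u j = if v u.1 < v j then n j else 0 := by
    change (if -v j < -v u.1 then n j else if j = u.1 then (revIdx u).2.val + 1 else 0) = _
    simp only [if_neg hj, neg_lt_neg_iff]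
  rw [e]
  unfold lowOrders
  rw [if_neg hj]
  rcases lt_or_gt_of_ne h1 with h | h
  · rw [if_pos h, if_neg (not_lt.2 h.le), add_zero]
  · rw [if_neg (not_lt.2 h.le), if_pos h, zero_add]

end

noncomputable section

open Matrix

variable {k : ℕ} (n : Fin k → ℕ) (lam : Fin k → ℂ) (a : Fin k → ℕ → ℂ) (γ δ : ℝ)

/-- The profile `-4 i λ_I c^* / (1 + |c|²)` of a single soliton; `c` is the exponential of a
complex phase. -/
def profile (l c : ℂ) : ℂ :=
  -4 * Complex.I * l.im * (starRingEnd ℂ) c / ((1 + ‖c‖ ^ 2 : ℝ) : ℂ)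

/-- The exponential of the phase of the soliton `u`, corrected by the interaction with all other
solitons. -/
def waveRatio (x t : ℝ) (u : Idx n) : ℂ :=
  mixRatio n lam a γ δ x t u *
    (blaschke (highOrders (fun j => velocity γ δ (lam j)) u) lam u.1 /
      blaschke (lowOrders (fun j => velocity γ δ (lam j)) u) lam u.1)

/-- Where all columns but `u₀` are close to pure ones, the soliton is close to the single
soliton `u₀`. -/
theorem soliton_near_profile (hγδ : γ ≠ 0 ∨ δ ≠ 0) (hn : ∀ i, 1 ≤ n i)
    (hlam : ∀ i, 0 < (lam i).im)
    (hv : Function.Injective fun j => velocity γ δ (lam j)) (R : ℝ) (hR : 0 < R) :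
    ∃ K > 0, ∃ T ≥ 3, ∀ t ≥ T, ∀ x, ∀ u₀ : Idx n,
      (∀ u : Idx n, u ≠ u₀ → u.2.val < lowOrders (fun j => velocity γ δ (lam j)) u₀ u.1 →
        ‖mixRatio n lam a γ δ x t u‖ ≤ R / t) →
      (∀ u : Idx n, u ≠ u₀ → lowOrders (fun j => velocity γ δ (lam j)) u₀ u.1 ≤ u.2.val →
        ‖mixRatio n lam a γ δ x t u‖⁻¹ ≤ R / t) →
      ‖soliton n lam a γ δ x t - profile (lam u₀.1) (waveRatio n lam a γ δ x t u₀)‖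
        ≤ K * (Real.log t / t) := by
  have hinj : Function.Injective lam := fun i j h => hv (by simp only [h])
  obtain ⟨K₁, hK₁, T₁, hT₁, happ⟩ := exists_approx_columns n lam a γ δ hγδ hn hlam
  obtain ⟨K₂, hK₂, r, hr, hlip⟩ := projForm_lipschitz (gram_pos (n := n) hlam hinj) (evalVec n)
    (c := 1 / 4) (by norm_num)
  have hlim : Filter.Tendsto (fun t : ℝ => (K₁ + R) * (Real.log t / t)) Filter.atTop
      (nhds ((K₁ + R) * 0)) :=
    (Real.isLittleO_log_id_atTop.tendsto_div_nhds_zero).const_mul _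
  rw [mul_zero] at hlim
  obtain ⟨T₂, hT₂⟩ := Filter.eventually_atTop.1 (hlim.eventually (ge_mem_nhds hr))
  refine ⟨2 * K₂ * (K₁ + R), by positivity, max (max T₁ T₂) R,
    le_max_of_le_left (le_max_of_le_left hT₁), ?_⟩
  intro t ht x u₀ hlow hhigh
  have ht₁ : T₁ ≤ t := ((le_max_left _ _).trans (le_max_left _ _)).trans ht
  have ht₂ : T₂ ≤ t := ((le_max_right _ _).trans (le_max_left _ _)).trans ht
  have htR : R ≤ t := (le_max_right _ _).trans ht
  have ht3 : 3 ≤ t := hT₁.trans ht₁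
  have ht0 : 0 < t := by linarith
  have hlog := one_le_log_of_three_le ht3
  have hR1 : R / t ≤ 1 := (div_le_one ht0).2 htR
  have hRlog : R / t ≤ R * (Real.log t / t) := by
    rw [mul_div_assoc']
    gcongr
    nlinarith
  have hL0 : 0 ≤ Real.log t / t := by positivity
  have hK₁L : 0 ≤ K₁ * (Real.log t / t) := by positivity
  obtain ⟨C, hC, hC1, hC2⟩ := happ t ht₁ x
  set v : Fin k → ℝ := fun j => velocity γ δ (lam j) with hvdef
  set c := mixRatio n lam a γ δ x t with hc
  have hc0 : ∀ u, c u ≠ 0 := fun u => mixRatio_ne_zero n lam a γ δ hγδ ht0.ne' u (hlam u.1)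
  -- the model columns: the small part of every column but `u₀` is replaced by zero
  set ξ : Idx n → ℂ := fun u =>
    if u ≠ u₀ ∧ lowOrders v u₀ u.1 ≤ u.2.val then 0 else colScale (c u) with hξ
  set η : Idx n → ℂ := fun u =>
    if u ≠ u₀ ∧ u.2.val < lowOrders v u₀ u.1 then 0 else c u * colScale (c u) with hη
  have hξ₀ : ξ u₀ = colScale (c u₀) := by simp [hξ]
  have hη₀ : η u₀ = c u₀ * colScale (c u₀) := by simp [hη]
  have hξ1 : ∀ u, ‖ξ u‖ ≤ 1 := by
    intro u
    simp only [hξ]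
    split_ifs
    · simp
    · exact norm_colScale_le_one _
  have hη1 : ∀ u, ‖η u‖ ≤ 1 := by
    intro u
    simp only [hη]
    split_ifs
    · simp
    · exact norm_mul_colScale_le_one _
  have hξd : ∀ u, ‖colScale (c u) - ξ u‖ ≤ R * (Real.log t / t) := by
    intro u
    simp only [hξ]
    split_ifs with h
    · rw [sub_zero]
      exact ((norm_colScale_le_inv _ (hc0 u)).trans (hhigh u h.1 h.2)).trans hRlog
    · rw [sub_self, norm_zero]
      positivity
  have hηd : ∀ u, ‖c u * colScale (c u) - η u‖ ≤ R * (Real.log t / t) := by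
    intro u
    simp only [hη]
    split_ifs with h
    · rw [sub_zero]
      exact ((norm_mul_colScale_le _).trans (hlow u h.1 h.2)).trans hRlog
    · rw [sub_self, norm_zero]
      positivity
  -- one of the numbers `1 / (1 + |c|)`, `|c| / (1 + |c|)` is at least `1 / 2`
  have hhalf1 : ∀ u, ‖c u‖ ≤ 1 → 1 / 4 ≤ ‖colScale (c u)‖ ^ 2 := by
    intro u hu
    rw [norm_colScale]
    have : (1 : ℝ) / 2 ≤ 1 / (1 + ‖c u‖) :=
      one_div_le_one_div_of_le (by positivity) (by linarith)
    nlinarith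
  have hhalf2 : ∀ u, 1 ≤ ‖c u‖ → 1 / 4 ≤ ‖c u * colScale (c u)‖ ^ 2 := by
    intro u hu
    rw [norm_mul, norm_colScale, mul_one_div]
    have : (1 : ℝ) / 2 ≤ ‖c u‖ / (1 + ‖c u‖) := by
      rw [div_le_div_iff₀ (by norm_num) (by positivity)]
      linarith
    nlinarith
  have hlb : ∀ u, 1 / 4 ≤ ‖ξ u‖ ^ 2 + ‖η u‖ ^ 2 := by
    intro u
    by_cases hu : u = u₀
    · subst hu
      rw [hξ₀, hη₀]
      rcases le_total ‖c u‖ 1 with h | h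
      · have := hhalf1 u h
        nlinarith [sq_nonneg ‖colScale (c u)‖, sq_nonneg ‖c u * colScale (c u)‖]
      · have := hhalf2 u h
        nlinarith [sq_nonneg ‖colScale (c u)‖, sq_nonneg ‖c u * colScale (c u)‖]
    · rcases lt_or_ge u.2.val (lowOrders v u₀ u.1) with h | h
      · have h1 := hhalf1 u ((hlow u hu h).trans hR1)
        have h2 : ξ u = colScale (c u) := by
          simp only [hξ]
          rw [if_neg (fun h3 => absurd h3.2 (not_le.2 h))]
        rw [h2]
        have := sq_nonneg ‖η u‖
        linarith
      · have h0 := (hhigh u hu h).trans hR1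
        have h1 := hhalf2 u ((inv_le_one₀ (norm_pos_iff.2 (hc0 u))).1 h0)
        have h2 : η u = c u * colScale (c u) := by
          simp only [hη]
          rw [if_neg (fun h3 => absurd h3.2 (not_lt.2 h))]
        rw [h2]
        have := sq_nonneg ‖ξ u‖
        linarith
  have hmodel := projForm_model hlam hinj (lowOrders_le v u₀)
    (lowOrders_le (fun j => -v j) (revIdx u₀)) u₀ (lowOrders_self v u₀).symm
    (highOrders_self v u₀).symm
    (fun j hj => lowOrders_add_highOrders hv u₀ hj) ξ η
    (fun u hu h => by
      simp only [hξ, hη]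
      rw [if_neg (fun h3 => absurd h3.2 (not_le.2 h)), if_pos ⟨hu, h⟩]
      exact ⟨colScale_ne_zero _, rfl⟩)
    (fun u hu h => by
      simp only [hξ, hη]
      rw [if_pos ⟨hu, h⟩, if_neg (fun h3 => absurd h3.2 (not_lt.2 h))]
      exact ⟨rfl, mul_ne_zero (hc0 u) (colScale_ne_zero _)⟩)
    (by rw [hξ₀]; exact colScale_ne_zero _)
  have hε : 0 ≤ (K₁ + R) * (Real.log t / t) := by positivity
  have hB := hlip (lowColumns ξ) (highColumns η) C (expMat n lam a γ δ x t * C)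
    (fun u w => by
      simp only [lowColumns, Matrix.of_apply]
      split_ifs
      · exact hξ1 w
      · simp)
    (fun u w => by
      simp only [highColumns, Matrix.of_apply]
      split_ifs
      · exact hη1 w
      · simp)
    (model_coercive hlb) ((K₁ + R) * (Real.log t / t)) hε (hT₂ t ht₂)
    (fun u w => by
      have h1 := hC1 u w
      simp only [lowColumns, Matrix.of_apply]
      split_ifs at h1 ⊢ with huw
      · calc ‖C u w - ξ w‖ = ‖(C u w - colScale (c w)) + (colScale (c w) - ξ w)‖ := by
              congr 1; ring
          _ ≤ _ := (norm_add_le _ _).trans (by linarith [hξd w])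
      · refine h1.trans ?_
        gcongr
        linarith)
    (fun u w => by
      have h1 := hC2 u w
      simp only [highColumns, Matrix.of_apply]
      split_ifs at h1 ⊢ with huw
      · calc ‖(expMat n lam a γ δ x t * C) u w - η w‖ =
            ‖((expMat n lam a γ δ x t * C) u w - c w * colScale (c w)) +
              (c w * colScale (c w) - η w)‖ := by
              congr 1; ring
          _ ≤ _ := (norm_add_le _ _).trans (by linarith [hηd w])
      · refine h1.trans ?_
        gcongr
        linarith)
  have hsol := soliton_eq n lam a γ δ hlam hinj x t
  rw [← projForm_mul _ _ _ _ C hC, Matrix.one_mul] at hsol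
  have hprof : profile (lam u₀.1) (waveRatio n lam a γ δ x t u₀) = -2 * Complex.I *
      projForm (gram n lam) (evalVec n) (lowColumns ξ) (highColumns η) := by
    rw [hmodel, hξ₀, hη₀]
    change profile _ (c u₀ * (blaschke (highOrders v u₀) lam u₀.1 /
      blaschke (lowOrders v u₀) lam u₀.1)) = _
    change _ = -2 * Complex.I * (colScale (c u₀) * blaschke (lowOrders v u₀) lam u₀.1 *
      star (c u₀ * colScale (c u₀) * blaschke (highOrders v u₀) lam u₀.1) /
      ((‖colScale (c u₀)‖ ^ 2 * (‖blaschke (lowOrders v u₀) lam u₀.1‖ ^ 2 / (2 * (lam u₀.1).im)) +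
        ‖c u₀ * colScale (c u₀)‖ ^ 2 *
          (‖blaschke (highOrders v u₀) lam u₀.1‖ ^ 2 / (2 * (lam u₀.1).im)) : ℝ) : ℂ))
    have hβ : blaschke (lowOrders v u₀) lam u₀.1 ≠ 0 := blaschke_ne_zero hlam hinj u₀.1
    have hs0 : (1 / (1 + ‖c u₀‖) : ℝ) ≠ 0 := by positivity
    have hsc : colScale (c u₀) = ((1 / (1 + ‖c u₀‖) : ℝ) : ℂ) := rfl
    generalize (1 / (1 + ‖c u₀‖) : ℝ) = s at hs0 hsc
    rw [hsc]
    generalize blaschke (lowOrders v u₀) lam u₀.1 = β₁ at hβ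
    generalize blaschke (highOrders v u₀) lam u₀.1 = β₂
    generalize c u₀ = z
    have hl := hlam u₀.1
    generalize (lam u₀.1) = l at hl
    have hl' : (l.im : ℂ) ≠ 0 := by exact_mod_cast hl.ne'
    have hs' : (s : ℂ) ≠ 0 := by exact_mod_cast hs0
    have hD : (0:ℝ) < ‖β₁‖ ^ 2 + ‖z‖ ^ 2 * ‖β₂‖ ^ 2 := by positivity
    have hb1 : β₁ * (starRingEnd ℂ) β₁ = ((‖β₁‖ ^ 2 : ℝ) : ℂ) := by
      rw [Complex.mul_conj, Complex.normSq_eq_norm_sq]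
    have hcb : (starRingEnd ℂ) β₁ ≠ 0 := (map_ne_zero _).2 hβ
    have e1 : ((1 + ‖z * (β₂ / β₁)‖ ^ 2 : ℝ) : ℂ) =
        ((‖β₁‖ ^ 2 + ‖z‖ ^ 2 * ‖β₂‖ ^ 2 : ℝ) : ℂ) / (β₁ * (starRingEnd ℂ) β₁) := by
      rw [hb1, ← Complex.ofReal_div]
      congr 1
      have := norm_pos_iff.2 hβ
      rw [norm_mul, norm_div]
      field_simp
    have e2 : ((‖(s : ℂ)‖ ^ 2 * (‖β₁‖ ^ 2 / (2 * l.im)) +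
        ‖z * s‖ ^ 2 * (‖β₂‖ ^ 2 / (2 * l.im)) : ℝ) : ℂ) =
        (s : ℂ) ^ 2 * ((‖β₁‖ ^ 2 + ‖z‖ ^ 2 * ‖β₂‖ ^ 2 : ℝ) : ℂ) / (2 * l.im) := by
      rw [norm_mul, mul_pow, Complex.norm_real, Real.norm_eq_abs, sq_abs]
      push_cast
      field_simp
    have hD' : ((‖β₁‖ ^ 2 + ‖z‖ ^ 2 * ‖β₂‖ ^ 2 : ℝ) : ℂ) ≠ 0 := by exact_mod_cast hD.ne'
    rw [e2, profile, e1]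
    simp only [star_mul', Complex.star_def, map_mul, map_div₀, Complex.conj_ofReal]
    generalize ((‖β₁‖ ^ 2 + ‖z‖ ^ 2 * ‖β₂‖ ^ 2 : ℝ) : ℂ) = D at hD'
    field_simp
    ring
  rw [hsol, hprof, ← mul_sub, norm_mul]
  have h2 : ‖(-2 * Complex.I : ℂ)‖ = 2 := by simp
  rw [h2]
  calc _ ≤ 2 * (K₂ * ((K₁ + R) * (Real.log t / t))) := by gcongr
    _ = _ := by ring

end

end Hirota

namespace Hirota

noncomputable section

open Matrix

variable {k : ℕ} (n : Fin k → ℕ) (lam : Fin k → ℂ) (a : Fin k → ℕ → ℂ) (γ δ : ℝ)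

/-! ### The centres of the solitons and the nearest soliton -/

/-- The exponent of `t` in `mixRatio`, as a real number (it can be negative). -/
def expoDiff (u : Idx n) : ℝ := (u.2.val : ℝ) - (Fin.rev u.2).val

/-- The coefficient of `log t` in the position of the soliton `u`. -/
def centerLog (u : Idx n) : ℝ := expoDiff n u / (2 * (lam u.1).im)

/-- The constant in the position of the soliton `u`. -/
def centerConst (u : Idx n) : ℝ :=
  (2 * (a u.1 0).re + Real.log ‖antiEntry u.2‖ +
    expoDiff n u * Real.log ‖charCoeff γ δ (lam u.1)‖) / (2 * (lam u.1).im)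

/-- The position, for `t > 0`, where `mixRatio` has modulus `1`. -/
def center (u : Idx n) (t : ℝ) : ℝ :=
  velocity γ δ (lam u.1) * t + centerLog n lam u * Real.log t + centerConst n lam a γ δ u

theorem norm_mixRatio (hγδ : γ ≠ 0 ∨ δ ≠ 0) (hlam : ∀ i, 0 < (lam i).im) {t : ℝ} (ht : 0 < t)
    (x : ℝ) (u : Idx n) :
    ‖mixRatio n lam a γ δ x t u‖ =
      Real.exp (-(2 * (lam u.1).im * (x - center n lam a γ δ u t))) := by
  have hl := hlam u.1
  have hc : 0 < ‖charCoeff γ δ (lam u.1)‖ := norm_pos_iff.2 (charCoeff_ne_zero hγδ hl)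
  have hA : 0 < ‖antiEntry u.2‖ := norm_pos_iff.2 (antiEntry_ne_zero u.2)
  have hpow : ∀ m : ℕ, (‖charCoeff γ δ (lam u.1)‖ * t) ^ m =
      Real.exp (m * (Real.log ‖charCoeff γ δ (lam u.1)‖ + Real.log t)) := by
    intro m
    rw [← Real.log_mul hc.ne' ht.ne', Real.exp_nat_mul, Real.exp_log (by positivity)]
  rw [mixRatio, norm_div, norm_mul, norm_mul, norm_pow, norm_pow, norm_mul, Complex.norm_real,
    Real.norm_of_nonneg ht.le, hpow, hpow,
    norm_exp_two_mul_theta n lam a γ δ x t u.1 u.2.pos, ← Real.exp_log hA, ← Real.exp_add,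
    ← Real.exp_add, ← Real.exp_sub]
  congr 1
  simp only [center, centerLog, centerConst, expoDiff]
  field_simp
  ring

/-- The order of the solitons from the left to the right for large positive times. -/
def Precedes (u w : Idx n) : Prop :=
  velocity γ δ (lam u.1) < velocity γ δ (lam w.1) ∨ (u.1 = w.1 ∧ u.2.val < w.2.val)

theorem precedes_of_lt_lowOrders {u w : Idx n} (huw : u ≠ w)
    (h : u.2.val < lowOrders (fun j => velocity γ δ (lam j)) w u.1) :
    Precedes n lam γ δ u w := by
  unfold lowOrders at h
  split_ifs at h with h1 h2
  · exact Or.inl h1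
  · refine Or.inr ⟨h2, lt_of_le_of_ne (Nat.lt_succ_iff.1 h) fun h3 => huw (Idx.ext' h2 h3)⟩
  · exact absurd h (Nat.not_lt_zero _)

theorem precedes_of_lowOrders_le (hv : Function.Injective fun j => velocity γ δ (lam j))
    {u w : Idx n} (h : lowOrders (fun j => velocity γ δ (lam j)) w u.1 ≤ u.2.val) :
    Precedes n lam γ δ w u := by
  unfold lowOrders at h
  split_ifs at h with h1 h2
  · exact absurd u.2.isLt (not_lt.2 h)
  · exact Or.inr ⟨h2.symm, h⟩
  · exact Or.inl (lt_of_le_of_ne (not_lt.1 h1) fun h3 => h2 (hv h3).symm)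

theorem eventually_log_le (A B d l : ℝ) (hd : 0 < d) (hl : 0 < l) :
    ∀ᶠ t : ℝ in Filter.atTop, Real.log t ≤ l * (d * t + A * Real.log t + B) := by
  have hlim : Filter.Tendsto (fun t : ℝ => (|1 - l * A| + |l * B|) * (Real.log t / t)) Filter.atTop
      (nhds ((|1 - l * A| + |l * B|) * 0)) :=
    (Real.isLittleO_log_id_atTop.tendsto_div_nhds_zero).const_mul _
  rw [mul_zero] at hlim
  filter_upwards [hlim.eventually (ge_mem_nhds (show 0 < l * d by positivity)),
    Filter.eventually_ge_atTop 3] with t h1 ht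
  have ht0 : 0 < t := by linarith
  have hlog := one_le_log_of_three_le ht
  rw [mul_div_assoc', div_le_iff₀ ht0] at h1
  have e1 : (1 - l * A) * Real.log t ≤ |1 - l * A| * Real.log t := by
    have := le_abs_self (1 - l * A)
    gcongr
  have e2 : -(l * B) ≤ |l * B| * Real.log t := by
    have := neg_abs_le (l * B)
    nlinarith [abs_nonneg (l * B)]
  nlinarith

/-- Different solitons separate at least logarithmically. -/
theorem exists_center_gap (hlam : ∀ i, 0 < (lam i).im) :
    ∃ K : ℝ, ∀ᶠ t : ℝ in Filter.atTop, ∀ u w : Idx n, Precedes n lam γ δ u w →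
      Real.log t - K ≤ (lam u.1).im * (center n lam a γ δ w t - center n lam a γ δ u t) ∧
      Real.log t - K ≤ (lam w.1).im * (center n lam a γ δ w t - center n lam a γ δ u t) := by
  obtain ⟨K, hK⟩ := Finite.exists_le fun p : Idx n × Idx n =>
    |(lam p.1.1).im * (centerConst n lam a γ δ p.2 - centerConst n lam a γ δ p.1)|
  refine ⟨K, ?_⟩
  rw [Filter.eventually_all]
  intro u
  rw [Filter.eventually_all]
  intro w
  by_cases hp : Precedes n lam γ δ u w
  swap
  · exact Filter.Eventually.of_forall fun t h => absurd h hp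
  have hK' := hK (u, w)
  have hK0 : 0 ≤ K := (abs_nonneg _).trans hK'
  rcases hp with hvl | ⟨h1, h2⟩
  · filter_upwards [eventually_log_le (centerLog n lam w - centerLog n lam u)
        (centerConst n lam a γ δ w - centerConst n lam a γ δ u) _ _ (sub_pos.2 hvl) (hlam u.1),
      eventually_log_le (centerLog n lam w - centerLog n lam u)
        (centerConst n lam a γ δ w - centerConst n lam a γ δ u) _ _ (sub_pos.2 hvl) (hlam w.1)]
      with t ht1 ht2 _
    simp only [center]
    constructor
    · linarith
    · linarith
  · filter_upwards [Filter.eventually_ge_atTop 3] with t ht _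
    have hlog := one_le_log_of_three_le ht
    have key : Real.log t - K ≤
        (lam u.1).im * (center n lam a γ δ w t - center n lam a γ δ u t) := by
      have hl := hlam u.1
      have e1 : (expoDiff n w : ℝ) - expoDiff n u = 2 * ((w.2.val : ℝ) - u.2.val) := by
        have e : n u.1 = n w.1 := by rw [h1]
        have hu := u.2.isLt
        have hw := w.2.isLt
        simp only [expoDiff, Fin.val_rev]
        have e' : (n u.1 : ℝ) = n w.1 := by exact_mod_cast e
        rw [Nat.cast_sub hu, Nat.cast_sub hw]
        push_cast
        linarith
      have e2 : (1 : ℝ) ≤ (w.2.val : ℝ) - u.2.val := by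
        have : (u.2.val : ℝ) + 1 ≤ w.2.val := by exact_mod_cast h2
        linarith
      have e3 : (lam u.1).im * (centerLog n lam w - centerLog n lam u) =
          (w.2.val : ℝ) - u.2.val := by
        have : (expoDiff n w : ℝ) = expoDiff n u + 2 * ((w.2.val : ℝ) - u.2.val) := by linarith
        simp only [centerLog, this, ← h1]
        field_simp
        ring
      have e4 := neg_abs_le
        ((lam u.1).im * (centerConst n lam a γ δ w - centerConst n lam a γ δ u))
      have e5 : (lam u.1).im * (center n lam a γ δ w t - center n lam a γ δ u t) =
          (lam u.1).im * (centerLog n lam w - centerLog n lam u) * Real.log t +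
          (lam u.1).im * (centerConst n lam a γ δ w - centerConst n lam a γ δ u) := by
        simp only [center, ← h1]
        ring
      rw [e5, e3]
      simp only at hK'
      nlinarith
    exact ⟨key, h1 ▸ key⟩

theorem norm_profile (l c : ℂ) (hl : 0 < l.im) :
    ‖profile l c‖ = 4 * l.im * (‖c‖ / (1 + ‖c‖ ^ 2)) := by
  rw [profile, norm_div, norm_mul, norm_mul, norm_mul, Complex.norm_real, Complex.norm_real,
    Real.norm_of_nonneg hl.le, Real.norm_of_nonneg (by positivity), Complex.norm_conj,
    Complex.norm_I]
  simp
  ring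

theorem norm_profile_le (l c : ℂ) (hl : 0 < l.im) : ‖profile l c‖ ≤ 4 * l.im * ‖c‖ := by
  rw [norm_profile l c hl]
  gcongr
  exact div_le_self (norm_nonneg _) (by nlinarith [norm_nonneg c])

theorem norm_profile_le_inv (l c : ℂ) (hl : 0 < l.im) (hc : c ≠ 0) :
    ‖profile l c‖ ≤ 4 * l.im * ‖c‖⁻¹ := by
  have := norm_pos_iff.2 hc
  rw [norm_profile l c hl]
  gcongr
  rw [div_le_iff₀ (by positivity)]
  field_simp
  nlinarith

theorem sub_le_of_abs_sub_le {x p q : ℝ} (hpq : p < q) (h : |x - q| ≤ |x - p|) :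
    q - p ≤ 2 * (x - p) := by
  rcases abs_cases (x - q) with h1 | h1 <;> rcases abs_cases (x - p) with h2 | h2 <;> linarith

theorem sub_le_of_abs_sub_le' {x p q : ℝ} (hpq : p < q) (h : |x - p| ≤ |x - q|) :
    q - p ≤ 2 * (q - x) := by
  rcases abs_cases (x - q) with h1 | h1 <;> rcases abs_cases (x - p) with h2 | h2 <;> linarith

/-- For large positive times the soliton is close to the sum of the single solitons. -/
theorem soliton_near_sum (hγδ : γ ≠ 0 ∨ δ ≠ 0) (hn : ∀ i, 1 ≤ n i)
    (hlam : ∀ i, 0 < (lam i).im)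
    (hv : Function.Injective fun j => velocity γ δ (lam j)) :
    ∃ K T : ℝ, 1 < T ∧ ∀ x t : ℝ, T ≤ t →
      ‖soliton n lam a γ δ x t -
        ∑ u : Idx n, profile (lam u.1) (waveRatio n lam a γ δ x t u)‖ ≤ K * (Real.log t / t) := by
  have hinj : Function.Injective lam := fun i j h => hv (by simp only [h])
  rcases isEmpty_or_nonempty (Idx n) with hE | hne
  · refine ⟨0, 2, by norm_num, fun x t _ => ?_⟩
    simp [soliton, dotProduct]
  set v : Fin k → ℝ := fun j => velocity γ δ (lam j) with hvdef
  obtain ⟨K₀, hgap⟩ := exists_center_gap n lam a γ δ hlam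
  obtain ⟨T₀, hT₀⟩ := Filter.eventually_atTop.1 hgap
  obtain ⟨K₁, hK₁, T₁, hT₁, hnear⟩ := soliton_near_profile n lam a γ δ hγδ hn hlam hv
    (Real.exp K₀) (Real.exp_pos _)
  set b : Idx n → ℂ := fun u => blaschke (highOrders v u) lam u.1 / blaschke (lowOrders v u) lam u.1
    with hb
  have hb0 : ∀ u, b u ≠ 0 := fun u =>
    div_ne_zero (blaschke_ne_zero hlam hinj _) (blaschke_ne_zero hlam hinj _)
  set B : Idx n → ℝ := fun u => 4 * (lam u.1).im * ((‖b u‖ + ‖b u‖⁻¹) * Real.exp K₀) with hB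
  have hB0 : ∀ u, 0 ≤ B u := fun u => by
    have := hlam u.1
    positivity
  refine ⟨K₁ + ∑ u, B u, max (max T₀ T₁) (Real.exp (K₀ + 1)),
    lt_max_of_lt_left (lt_max_of_lt_right (by linarith)), ?_⟩
  intro x t ht
  have ht₀ : T₀ ≤ t := ((le_max_left _ _).trans (le_max_left _ _)).trans ht
  have ht₁ : T₁ ≤ t := ((le_max_right _ _).trans (le_max_left _ _)).trans ht
  have ht3 : 3 ≤ t := hT₁.trans ht₁
  have ht0 : 0 < t := by linarith
  have hlog := one_le_log_of_three_le ht3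
  -- the soliton nearest to `x`; all others are at a distance of at least half of their gap to it
  obtain ⟨u₀, hu₀⟩ := Finite.exists_min fun u : Idx n => |x - center n lam a γ δ u t|
  have hRt : Real.exp K₀ / t = Real.exp (K₀ - Real.log t) := by
    rw [Real.exp_sub, Real.exp_log ht0]
  have hK₀ : K₀ < Real.log t := by
    have := (Real.le_log_iff_exp_le ht0).2 ((le_max_right _ _).trans ht)
    linarith
  have hlow : ∀ u : Idx n, u ≠ u₀ → u.2.val < lowOrders v u₀ u.1 →
      ‖mixRatio n lam a γ δ x t u‖ ≤ Real.exp K₀ / t := by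
    intro u hu h
    have hg := (hT₀ t ht₀ u u₀ (precedes_of_lt_lowOrders n lam γ δ hu h)).1
    have hl := hlam u.1
    have hlt : center n lam a γ δ u t < center n lam a γ δ u₀ t := by
      by_contra hcon
      nlinarith
    have hmid := sub_le_of_abs_sub_le hlt (hu₀ u)
    rw [norm_mixRatio n lam a γ δ hγδ hlam ht0, hRt]
    apply Real.exp_le_exp.2
    nlinarith
  have hhigh : ∀ u : Idx n, u ≠ u₀ → lowOrders v u₀ u.1 ≤ u.2.val →
      ‖mixRatio n lam a γ δ x t u‖⁻¹ ≤ Real.exp K₀ / t := by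
    intro u _ h
    have hg := (hT₀ t ht₀ u₀ u (precedes_of_lowOrders_le n lam γ δ hv h)).2
    have hl := hlam u.1
    have hlt : center n lam a γ δ u₀ t < center n lam a γ δ u t := by
      by_contra hcon
      nlinarith
    have hmid := sub_le_of_abs_sub_le' hlt (hu₀ u)
    rw [norm_mixRatio n lam a γ δ hγδ hlam ht0, hRt, ← Real.exp_neg]
    apply Real.exp_le_exp.2
    nlinarith
  have hmain := hnear t ht₁ x u₀ hlow hhigh
  have hother : ∀ u : Idx n, u ≠ u₀ →
      ‖profile (lam u.1) (waveRatio n lam a γ δ x t u)‖ ≤ B u * (Real.log t / t) := by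
    intro u hu
    have hl := hlam u.1
    have hc0 := mixRatio_ne_zero n lam a γ δ hγδ (x := x) ht0.ne' u hl
    have hw : waveRatio n lam a γ δ x t u = mixRatio n lam a γ δ x t u * b u := rfl
    have hbn := norm_pos_iff.2 (hb0 u)
    have hle : B u * (1 / t) ≤ B u * (Real.log t / t) := by
      have := hB0 u
      gcongr
    refine le_trans ?_ hle
    have hBt : B u * (1 / t) =
        4 * (lam u.1).im * ((‖b u‖ + ‖b u‖⁻¹) * (Real.exp K₀ / t)) := by
      simp only [hB]
      ring
    rw [hBt]
    have hRp : 0 < Real.exp K₀ / t := by positivity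
    have hbi : 0 < ‖b u‖⁻¹ := inv_pos.2 hbn
    rcases lt_or_ge u.2.val (lowOrders v u₀ u.1) with h | h
    · refine (norm_profile_le _ _ hl).trans ?_
      gcongr
      rw [hw, norm_mul]
      have := hlow u hu h
      nlinarith
    · refine (norm_profile_le_inv _ _ hl (by rw [hw]; exact mul_ne_zero hc0 (hb0 u))).trans ?_
      gcongr
      rw [hw, norm_mul, mul_inv]
      have := hhigh u hu h
      nlinarith
  have hL0 : 0 ≤ Real.log t / t := by positivity
  rw [← Finset.add_sum_erase _ _ (Finset.mem_univ u₀), ← sub_sub]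
  refine (norm_sub_le _ _).trans ?_
  have h2 : ‖∑ u ∈ Finset.univ.erase u₀, profile (lam u.1) (waveRatio n lam a γ δ x t u)‖ ≤
      (∑ u, B u) * (Real.log t / t) := by
    refine (norm_sum_le_of_le _ fun u hu => hother u (Finset.ne_of_mem_erase hu)).trans ?_
    rw [← Finset.sum_mul]
    gcongr
    · exact fun u _ _ => hB0 u
    · exact Finset.subset_univ _
  linarith

end

end Hirota

namespace Hirota

noncomputable section

open Matrix

variable {k : ℕ} (n : Fin k → ℕ) (lam : Fin k → ℂ) (a : Fin k → ℕ → ℂ) (γ δ : ℝ)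

/-! ### Reversal of time -/

/-- The phase is unchanged when `γ`, `δ` and `t` are multiplied by the same sign. -/
theorem theta_scale {σ : ℝ} (hσ : σ * σ = 1) (x t : ℝ) (i : Fin k) (z : ℂ) :
    theta n lam a (σ * γ) (σ * δ) x (σ * t) i z = theta n lam a γ δ x t i z := by
  have h : (σ : ℂ) * σ = 1 := by exact_mod_cast hσ
  unfold theta
  push_cast
  linear_combination (Complex.I * z * (2 * γ * z + 4 * δ * z ^ 2) * t) * h

theorem soliton_scale {σ : ℝ} (hσ : σ * σ = 1) (x t : ℝ) :
    soliton n lam a (σ * γ) (σ * δ) x (σ * t) = soliton n lam a γ δ x t := by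
  have hPhi : Phi n lam a (σ * γ) (σ * δ) x (σ * t) = Phi n lam a γ δ x t := by
    ext i m
    simp only [Phi, theta_scale n lam a γ δ hσ]
  simp only [soliton, M, Y, X, hPhi]

theorem velocity_scale (σ : ℝ) (l : ℂ) : velocity (σ * γ) (σ * δ) l = σ * velocity γ δ l := by
  unfold velocity
  ring

theorem charCoeff_scale (σ : ℝ) (l : ℂ) : charCoeff (σ * γ) (σ * δ) l = σ * charCoeff γ δ l := by
  have : curlyC (σ * γ) (σ * δ) l = σ * curlyC γ δ l := by
    unfold curlyC
    push_cast
    ring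
  rw [charCoeff, charCoeff, this, map_mul, Complex.conj_ofReal]
  ring

/-! ### The left and right families of single solitons -/

variable {n} in
/-- The right family continues the left one: `κ ↦ n_i + 1 - κ` changes the sign of `μ` and inverts
the quotient of factorials, and the phases agree modulo `2 π`. -/
theorem waveR_eq_waveL (σ : ℝ) (i : Fin k) {κ : ℕ} (h1 : 1 ≤ κ) (h2 : κ ≤ n i) (x t : ℝ) :
    waveR n lam a γ δ σ i κ x t = waveL n lam a γ δ σ i (n i + 1 - κ) x t := by
  have hc : ((n i + 1 - κ : ℕ) : ℝ) = (n i : ℝ) + 1 - κ := by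
    rw [Nat.cast_sub (by omega)]
    push_cast
    ring
  have hmu : mu n i (n i + 1 - κ) = -mu n i κ := by
    unfold mu
    rw [hc]
    ring
  have hs : sL n lam γ δ σ i (n i + 1 - κ) x t = sR n lam γ δ σ i κ x t := by
    unfold sL sR
    rw [hmu]
    ring
  have hD : DeltaL n lam γ δ i (n i + 1 - κ) = -DeltaR n lam γ δ i κ := by
    unfold DeltaL DeltaR
    rw [hmu, show n i - (n i + 1 - κ) = κ - 1 by omega, show n i + 1 - κ - 1 = n i - κ by omega,
      ← inv_div, Real.log_inv]
    ring
  unfold waveR waveL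
  rw [hs, hD, hmu, hc]
  congr 1
  · congr 4
    ring
  · rw [Complex.exp_eq_exp_iff_exists_int]
    refine ⟨(κ : ℤ) - 1, ?_⟩
    push_cast
    ring

theorem asymptotics_eq (σ x t : ℝ) : asymptotics n lam a γ δ σ x t =
    ∑ i, ∑ κ ∈ Finset.Icc 1 (n i), waveL n lam a γ δ σ i κ x t := by
  rw [asymptotics, ← Finset.sum_add_distrib]
  refine Finset.sum_congr rfl fun i _ => ?_
  have h : ∑ κ ∈ Finset.Icc 1 (n i / 2), waveR n lam a γ δ σ i κ x t =
      ∑ κ ∈ Finset.Icc ((n i + 1) / 2 + 1) (n i), waveL n lam a γ δ σ i κ x t := by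
    refine Finset.sum_bij' (fun κ _ => n i + 1 - κ) (fun κ _ => n i + 1 - κ) ?_ ?_ ?_ ?_ ?_
    · intro κ hκ
      rw [Finset.mem_Icc] at hκ ⊢
      omega
    · intro κ hκ
      rw [Finset.mem_Icc] at hκ ⊢
      omega
    · intro κ hκ
      rw [Finset.mem_Icc] at hκ
      omega
    · intro κ hκ
      rw [Finset.mem_Icc] at hκ
      omega
    · intro κ hκ
      rw [Finset.mem_Icc] at hκ
      exact waveR_eq_waveL lam a γ δ σ i hκ.1 (by omega) x t
  rw [h, ← Finset.sum_union]
  · congr 1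
    ext κ
    simp only [Finset.mem_union, Finset.mem_Icc]
    omega
  · rw [Finset.disjoint_left]
    intro κ hκ
    simp only [Finset.mem_Icc] at hκ ⊢
    omega

theorem sum_fin_eq_sum_Icc {β : Type*} [AddCommMonoid β] (N : ℕ) (f : ℕ → β) :
    ∑ q : Fin N, f (q.val + 1) = ∑ κ ∈ Finset.Icc 1 N, f κ := by
  rw [Fin.sum_univ_eq_sum_range (fun q => f (q + 1)) N, Finset.range_eq_Ico,
    Finset.sum_Ico_add' f 0 N 1]
  rfl

theorem sum_fin_rev_eq_sum_Icc {β : Type*} [AddCommMonoid β] (N : ℕ) (f : ℕ → β) :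
    ∑ q : Fin N, f ((Fin.rev q).val + 1) = ∑ κ ∈ Finset.Icc 1 N, f κ := by
  rw [← sum_fin_eq_sum_Icc]
  exact Equiv.sum_comp Fin.revPerm fun q : Fin N => f (q.val + 1)

/-! ### Identification of the single solitons -/

theorem profile_eq_sech (l c : ℂ) (R φ : ℝ)
    (hc : c = Complex.exp (-R - Complex.I * (φ + Real.pi / 2))) :
    profile l c = ((2 * l.im * sech R : ℝ) : ℂ) * Complex.exp (Complex.I * φ) := by
  have hn : ‖c‖ = Real.exp (-R) := by
    rw [hc, Complex.norm_exp]
    congr 1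
    simp
  have hcc : (starRingEnd ℂ) c =
      Complex.I * ((Real.exp (-R) : ℝ) : ℂ) * Complex.exp (Complex.I * φ) := by
    rw [hc, ← Complex.exp_conj]
    have : (starRingEnd ℂ) (-R - Complex.I * (φ + Real.pi / 2) : ℂ) =
        (Real.pi / 2 * Complex.I) + ((-R : ℝ) : ℂ) + Complex.I * φ := by
      simp only [map_sub, map_neg, map_mul, map_add, map_div₀, Complex.conj_ofReal, Complex.conj_I,
        Complex.conj_ofNat]
      push_cast
      ring
    rw [this, Complex.exp_add, Complex.exp_add, Complex.exp_pi_div_two_mul_I, Complex.ofReal_exp]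
  have hpos := Real.exp_pos R
  have hs : (2 * l.im * sech R : ℝ) = 4 * l.im * Real.exp (-R) / (1 + Real.exp (-R) ^ 2) := by
    rw [sech, Real.cosh_eq, Real.exp_neg]
    field_simp
    ring
  rw [profile, hcc, hn, hs]
  push_cast
  have hI := Complex.I_sq
  linear_combination (-4 * l.im * Complex.exp (-R) * Complex.exp (Complex.I * φ) /
    (1 + Complex.exp (-R) ^ 2)) * hI

theorem blaschke_lowOrders (v : Fin k → ℝ) (u : Idx n) :
    blaschke (lowOrders v u) lam u.1 =
      (∏ j ∈ Finset.univ.erase u.1, if v j < v u.1 then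
        ((lam u.1 - lam j) / (lam u.1 - (starRingEnd ℂ) (lam j))) ^ n j else 1) *
      ((2 * Complex.I * (lam u.1).im) ^ u.2.val)⁻¹ := by
  have hd : lam u.1 - (starRingEnd ℂ) (lam u.1) = 2 * Complex.I * (lam u.1).im := by
    rw [Complex.sub_conj]
    push_cast
    ring
  rw [blaschke, ← Finset.mul_prod_erase _ _ (Finset.mem_univ u.1), Function.update_self,
    lowOrders_self, Nat.add_sub_cancel, hd, mul_comm ((2 * Complex.I * _) ^ _), ← div_div,
    div_eq_mul_inv _ ((2 * Complex.I * _) ^ _), ← Finset.prod_div_distrib]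
  congr 1
  refine Finset.prod_congr rfl fun j hj => ?_
  have hne := Finset.ne_of_mem_erase hj
  rw [Function.update_of_ne hne, ← div_pow, lowOrders, if_neg hne]
  split_ifs
  · rfl
  · rw [pow_zero]

theorem exp_log_norm_sub_arg_inv {w : ℂ} (hw : w ≠ 0) :
    Complex.exp (Real.log ‖w‖ - Complex.I * Complex.arg w⁻¹) = w := by
  have h : Complex.exp (-(Complex.log w⁻¹)) = w := by
    rw [Complex.exp_neg, Complex.exp_log (inv_ne_zero hw), inv_inv]
  have h2 : (Real.log ‖w‖ - Complex.I * Complex.arg w⁻¹ : ℂ) = -(Complex.log w⁻¹) := by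
    rw [Complex.log, norm_inv, Real.log_inv]
    push_cast
    ring
  rw [h2, h]

theorem exp_log_norm_sub_arg {w : ℂ} (hw : w ≠ 0) :
    Complex.exp (Real.log ‖w‖ - Complex.I * Complex.arg w) = (starRingEnd ℂ) w := by
  conv_rhs => rw [← Complex.exp_log hw, ← Complex.exp_conj]
  congr 1
  rw [Complex.log]
  simp [Complex.conj_ofReal]
  ring

/-- The shifts of position and phase are the modulus and the argument of a quotient of Blaschke
factors. -/
theorem exp_shift (hlam : ∀ i, 0 < (lam i).im) (hinj : Function.Injective lam) {σ : ℝ}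
    (v : Fin k → ℝ) (i : Fin k)
    (hv : ∀ j, j ≠ i → (v j < v i ∧ σ * sgn j i = -1) ∨ (v i < v j ∧ σ * sgn j i = 1)) :
    Complex.exp (σ * (positionShift n lam i - Complex.I * phaseShift n lam i)) =
      (∏ j ∈ Finset.univ.erase i, if v i < v j then
        ((lam i - lam j) / (lam i - (starRingEnd ℂ) (lam j))) ^ n j else 1) /
      (∏ j ∈ Finset.univ.erase i, if v j < v i then
        ((lam i - lam j) / (lam i - (starRingEnd ℂ) (lam j))) ^ n j else 1) := by
  have h1 : (σ * (positionShift n lam i - Complex.I * phaseShift n lam i) : ℂ) =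
      ∑ j ∈ Finset.univ.erase i, ((σ * sgn j i : ℝ) : ℂ) * (n j *
        (Real.log ‖(lam i - lam j) / (lam i - (starRingEnd ℂ) (lam j))‖ - Complex.I *
          Complex.arg ((lam i - lam j) / (lam i - (starRingEnd ℂ) (lam j)))⁻¹)) := by
    unfold positionShift phaseShift
    push_cast
    rw [Finset.mul_sum, ← Finset.sum_sub_distrib, Finset.mul_sum]
    refine Finset.sum_congr rfl fun j _ => ?_
    rw [inv_div]
    ring
  rw [h1, Complex.exp_sum, ← Finset.prod_div_distrib]
  refine Finset.prod_congr rfl fun j hj => ?_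
  have hne := Finset.ne_of_mem_erase hj
  have hw : (lam i - lam j) / (lam i - (starRingEnd ℂ) (lam j)) ≠ 0 :=
    div_ne_zero (sub_ne_zero.2 fun h => hne (hinj h).symm) (sub_conj_ne_zero hlam i j)
  rcases hv j hne with ⟨h, hs⟩ | ⟨h, hs⟩
  · rw [hs, if_pos h, if_neg (not_lt.2 h.le)]
    push_cast
    rw [neg_one_mul, Complex.exp_neg, Complex.exp_nat_mul, exp_log_norm_sub_arg_inv hw, one_div]
  · rw [hs, if_pos h, if_neg (not_lt.2 h.le)]
    push_cast
    rw [one_mul, Complex.exp_nat_mul, exp_log_norm_sub_arg_inv hw, div_one]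

theorem two_mul_re_theta (x t : ℝ) (i : Fin k) (hi : 1 ≤ n i) :
    2 * (theta n lam a γ δ x t i (lam i)).re =
      2 * (a i 0).re - 2 * (lam i).im * (x - velocity γ δ (lam i) * t) := by
  have h := norm_exp_two_mul_theta n lam a γ δ x t i hi
  rw [Complex.norm_exp] at h
  rw [← Real.exp_injective h]
  simp

/-- The single soliton with the phase factor `waveRatio` is a hyperbolic secant; its number in the
block depends on the direction of time. -/
theorem profile_waveRatio (hγδ : γ ≠ 0 ∨ δ ≠ 0) (hlam : ∀ i, 0 < (lam i).im)
    (hv : StrictMono fun i => velocity γ δ (lam i)) {σ : ℝ} (x : ℝ) {t : ℝ} (ht : 0 < σ * t)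
    (u : Idx n) {κ : ℕ}
    (hκ : (σ = 1 ∧ κ = (Fin.rev u.2).val + 1) ∨ (σ = -1 ∧ κ = u.2.val + 1)) :
    profile (lam u.1) (waveRatio n lam a (σ * γ) (σ * δ) x (σ * t) u) =
      waveL n lam a γ δ σ u.1 κ x t := by
  have hinj : Function.Injective lam := fun i j h => hv.injective (by simp only [h])
  have hσ : σ = 1 ∨ σ = -1 := hκ.imp And.left And.left
  have hσσ : σ * σ = 1 := by rcases hσ with rfl | rfl <;> norm_num
  have habs : |t| = σ * t := by
    rcases hσ with rfl | rfl
    · rw [abs_of_pos (by linarith)]; ring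
    · rw [abs_of_neg (by linarith)]; ring
  have hl := hlam u.1
  set v : Fin k → ℝ := fun j => velocity (σ * γ) (σ * δ) (lam j) with hvdef
  have hvs : ∀ j, j ≠ u.1 → (v j < v u.1 ∧ σ * sgn j u.1 = -1) ∨
      (v u.1 < v j ∧ σ * sgn j u.1 = 1) := by
    intro j hj
    simp only [hvdef, velocity_scale, sgn]
    rcases lt_or_gt_of_ne hj with h | h
    · have h1 : ((j.val : ℝ) - (u.1).val) < 0 := by
        have : (j.val : ℝ) < (u.1).val := by exact_mod_cast h
        linarith
      have h2 := hv h
      simp only at h2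
      rw [Real.sign_of_neg h1]
      rcases hσ with rfl | rfl
      · left; constructor <;> linarith
      · right; constructor <;> linarith
    · have h1 : 0 < ((j.val : ℝ) - (u.1).val) := by
        have : ((u.1).val : ℝ) < j.val := by exact_mod_cast h
        linarith
      have h2 := hv h
      simp only at h2
      rw [Real.sign_of_pos h1]
      rcases hσ with rfl | rfl
      · right; constructor <;> linarith
      · left; constructor <;> linarith
  have hshift := exp_shift n lam hlam hinj (σ := σ) v u.1 hvs
  have hlow := blaschke_lowOrders n lam v u
  have hhigh : blaschke (highOrders v u) lam u.1 =
      (∏ j ∈ Finset.univ.erase u.1, if v u.1 < v j then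
        ((lam u.1 - lam j) / (lam u.1 - (starRingEnd ℂ) (lam j))) ^ n j else 1) *
      ((2 * Complex.I * (lam u.1).im) ^ (Fin.rev u.2).val)⁻¹ := by
    have := blaschke_lowOrders n lam (fun j => -v j) (revIdx u)
    simp only [neg_lt_neg_iff] at this
    exact this
  have hC : curlyC γ δ (lam u.1) ≠ 0 := by
    have := charCoeff_ne_zero hγδ hl
    intro h
    rw [charCoeff, h] at this
    simp at this
  have hCn := norm_pos_iff.2 hC
  -- `G` is the quantity whose powers separate the solitons of one block
  set G : ℂ := 2 * (lam u.1).im * (starRingEnd ℂ) (curlyC γ δ (lam u.1)) * ((σ * t : ℝ) : ℂ) with hG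
  have hG0 : G ≠ 0 := by
    refine mul_ne_zero (mul_ne_zero (mul_ne_zero two_ne_zero ?_) ((map_ne_zero _).2 hC)) ?_
    · exact_mod_cast hl.ne'
    · exact_mod_cast ht.ne'
  have hGexp : G = Complex.exp (((Real.log (2 * (lam u.1).im) +
      Real.log ‖curlyC γ δ (lam u.1)‖ + Real.log |t| : ℝ) : ℂ) -
      Complex.I * Complex.arg (curlyC γ δ (lam u.1))) := by
    have e : (((Real.log (2 * (lam u.1).im) + Real.log ‖curlyC γ δ (lam u.1)‖ +
        Real.log |t| : ℝ) : ℂ) - Complex.I * Complex.arg (curlyC γ δ (lam u.1))) =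
        ((Real.log (2 * (lam u.1).im) : ℝ) : ℂ) + ((Real.log |t| : ℝ) : ℂ) +
        (Real.log ‖curlyC γ δ (lam u.1)‖ -
          Complex.I * Complex.arg (curlyC γ δ (lam u.1))) := by
      push_cast
      ring
    rw [e, Complex.exp_add, Complex.exp_add, exp_log_norm_sub_arg hC, ← Complex.ofReal_exp,
      ← Complex.ofReal_exp, habs, Real.exp_log (by positivity), Real.exp_log ht, hG]
    push_cast
    ring
  have hθ : theta n lam a (σ * γ) (σ * δ) x (σ * t) u.1 (lam u.1) =
      theta n lam a γ δ x t u.1 (lam u.1) := theta_scale n lam a γ δ hσσ x t u.1 _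
  obtain ⟨q, hq⟩ : ∃ q, q = u.2.val := ⟨_, rfl⟩
  obtain ⟨r, hr⟩ : ∃ r, r = (Fin.rev u.2).val := ⟨_, rfl⟩
  have hqr : q + r + 1 = n u.1 := by
    have := u.2.isLt
    rw [hr, hq, Fin.val_rev]
    omega
  have hκ' : (σ = 1 ∧ κ = r + 1) ∨ (σ = -1 ∧ κ = q + 1) := by rw [hq, hr]; exact hκ
  have hanti : antiEntry u.2 = (-1) ^ r * (r.factorial : ℂ) / q.factorial := by
    rw [hr, hq]
    rfl
  have hn1 : (n u.1 : ℝ) = q + r + 1 := by exact_mod_cast hqr.symm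
  have hmu : σ * mu n u.1 κ = (q : ℝ) - r := by
    unfold mu
    rw [hn1]
    rcases hκ' with ⟨rfl, rfl⟩ | ⟨rfl, rfl⟩ <;> push_cast <;> ring
  have hfac : σ * Real.log (((n u.1 - κ).factorial : ℝ) / ((κ - 1).factorial : ℝ)) =
      -Real.log ((r.factorial : ℝ) / q.factorial) := by
    rcases hκ' with ⟨rfl, rfl⟩ | ⟨rfl, rfl⟩
    · rw [show n u.1 - (r + 1) = q by omega, Nat.add_sub_cancel, ← Real.log_inv, inv_div, one_mul]
    · rw [show n u.1 - (q + 1) = r by omega, Nat.add_sub_cancel, neg_one_mul]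
  have hsign : (-1 : ℂ) ^ r * ((σ : ℂ) ^ q / (σ : ℂ) ^ r) =
      Complex.exp (-(Real.pi * Complex.I) * (κ + 1)) := by
    have e : (-(Real.pi * Complex.I) * (κ + 1) : ℂ) =
        ((κ + 1 : ℕ) : ℂ) * (-(Real.pi * Complex.I)) := by
      push_cast
      ring
    rw [e, Complex.exp_nat_mul, Complex.exp_neg, Complex.exp_pi_mul_I]
    rcases hκ' with ⟨rfl, rfl⟩ | ⟨rfl, rfl⟩
    · norm_num [pow_succ]
    · have : ((-1 : ℂ) ^ r) ≠ 0 := pow_ne_zero _ (by norm_num)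
      push_cast
      rw [mul_div_cancel₀ _ this]
      norm_num [pow_succ]
  have hfacexp : ((r.factorial : ℂ) / q.factorial) =
      Complex.exp (Real.log ((r.factorial : ℝ) / q.factorial)) := by
    rw [← Complex.ofReal_exp, Real.exp_log (by positivity)]
    push_cast
    rfl
  set c := charCoeff (σ * γ) (σ * δ) (lam u.1) * ((σ * t : ℝ) : ℂ) with hcdef
  set d : ℂ := 2 * Complex.I * (lam u.1).im with hd
  have hd0 : d ≠ 0 := by
    have : ((lam u.1).im : ℂ) ≠ 0 := by exact_mod_cast hl.ne'
    simp [hd, this]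
  have hσ0 : (σ : ℂ) ≠ 0 := by
    rcases hσ with rfl | rfl <;> simp
  have hcd : c * d = σ * G := by
    rw [hcdef, charCoeff_scale, charCoeff, hd, hG]
    linear_combination (-2 * σ * (starRingEnd ℂ) (curlyC γ δ (lam u.1)) * ((σ * t : ℝ) : ℂ) *
      (lam u.1).im) * Complex.I_sq
  have hc0 : c ≠ 0 := fun h => mul_ne_zero hσ0 hG0 (by rw [← hcd, h, zero_mul])
  apply profile_eq_sech
  rw [waveRatio, hlow, hhigh, mixRatio, hθ, hanti, ← hq, ← hr]
  generalize (∏ j ∈ Finset.univ.erase u.1, if v u.1 < v j then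
        ((lam u.1 - lam j) / (lam u.1 - (starRingEnd ℂ) (lam j))) ^ n j else 1) = H at hshift
  generalize (∏ j ∈ Finset.univ.erase u.1, if v j < v u.1 then
        ((lam u.1 - lam j) / (lam u.1 - (starRingEnd ℂ) (lam j))) ^ n j else 1) = L at hshift
  have hre := two_mul_re_theta n lam a γ δ x t u.1 (by omega)
  set θ := theta n lam a γ δ x t u.1 (lam u.1) with hθdef
  have hsplit : Complex.exp (2 * θ) * ((-1) ^ r * (r.factorial : ℂ) / q.factorial) * c ^ q / c ^ r *
      (H * (d ^ r)⁻¹ / (L * (d ^ q)⁻¹)) =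
      Complex.exp (2 * θ) * ((-1 : ℂ) ^ r * ((σ : ℂ) ^ q / (σ : ℂ) ^ r)) *
        ((r.factorial : ℂ) / q.factorial) * (G ^ q / G ^ r) * (H / L) := by
    have e : G ^ q / G ^ r * ((σ : ℂ) ^ q / (σ : ℂ) ^ r) = c ^ q / c ^ r * (d ^ q / d ^ r) := by
      rw [div_mul_div_comm, div_mul_div_comm, ← mul_pow, ← mul_pow, ← mul_pow, ← mul_pow, hcd,
        mul_comm G]
    have e2 : H * (d ^ r)⁻¹ / (L * (d ^ q)⁻¹) = H / L * (d ^ q / d ^ r) := by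
      rw [mul_div_mul_comm, inv_div_inv]
    rw [e2]
    linear_combination (-(Complex.exp (2 * θ) * (-1) ^ r * (r.factorial : ℂ) / q.factorial *
      (H / L))) * e
  have hGpow : G ^ q / G ^ r = Complex.exp (((q : ℂ) - r) *
      (((Real.log (2 * (lam u.1).im) + Real.log ‖curlyC γ δ (lam u.1)‖ + Real.log |t| : ℝ) : ℂ) -
      Complex.I * Complex.arg (curlyC γ δ (lam u.1)))) := by
    rw [sub_mul, Complex.exp_sub, Complex.exp_nat_mul, Complex.exp_nat_mul, ← hGexp]
  refine hsplit.trans ?_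
  rw [hGpow, ← hshift, hsign, hfacexp, ← Complex.exp_add, ← Complex.exp_add, ← Complex.exp_add,
    ← Complex.exp_add]
  congr 1
  have hR : 2 * (lam u.1).im * sL n lam γ δ σ u.1 κ x t + σ * DeltaL n lam γ δ u.1 κ -
      2 * (a u.1 0).re = -(2 * θ.re) - ((q : ℝ) - r) * (Real.log (2 * (lam u.1).im) +
        Real.log ‖curlyC γ δ (lam u.1)‖ + Real.log |t|) -
        Real.log ((r.factorial : ℝ) / q.factorial) - σ * positionShift n lam u.1 := by
    rw [hre, ← hmu]
    unfold sL DeltaL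
    have e : 2 * (lam u.1).im * (σ * (mu n u.1 κ / (2 * (lam u.1).im)) * Real.log |t|) =
        σ * mu n u.1 κ * Real.log |t| := by
      field_simp
    linear_combination hfac - e
  rw [hR, hmu]
  have hθs : (θ : ℂ) = θ.re + θ.im * Complex.I := (Complex.re_add_im θ).symm
  rw [congrArg (fun z : ℂ => 2 * z) hθs]
  push_cast
  ring

theorem sum_profile_eq_asymptotics (hγδ : γ ≠ 0 ∨ δ ≠ 0) (hlam : ∀ i, 0 < (lam i).im)
    (hv : StrictMono fun i => velocity γ δ (lam i)) {σ : ℝ} (hσ : σ = 1 ∨ σ = -1) (x : ℝ) {t : ℝ}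
    (ht : 0 < σ * t) :
    ∑ u : Idx n, profile (lam u.1) (waveRatio n lam a (σ * γ) (σ * δ) x (σ * t) u) =
      asymptotics n lam a γ δ σ x t := by
  rw [asymptotics_eq, Fintype.sum_sigma]
  refine Finset.sum_congr rfl fun i _ => ?_
  rcases hσ with hσ | hσ
  · rw [← sum_fin_rev_eq_sum_Icc]
    exact Finset.sum_congr rfl fun q _ =>
      profile_waveRatio n lam a γ δ hγδ hlam hv x ht ⟨i, q⟩ (Or.inl ⟨hσ, rfl⟩)
  · rw [← sum_fin_eq_sum_Icc]
    exact Finset.sum_congr rfl fun q _ =>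
      profile_waveRatio n lam a γ δ hγδ hlam hv x ht ⟨i, q⟩ (Or.inr ⟨hσ, rfl⟩)

/-- The asymptotics in both directions of time: `σ = -1` is the case of large positive times for
the equation with the parameters `-γ`, `-δ`. -/
theorem soliton_near_asymptotics (hγδ : γ ≠ 0 ∨ δ ≠ 0) (hn : ∀ i, 1 ≤ n i)
    (hlam : ∀ i, 0 < (lam i).im)
    (hv : StrictMono fun i => velocity γ δ (lam i)) {σ : ℝ} (hσ : σ = 1 ∨ σ = -1) :
    ∃ K T : ℝ, 1 < T ∧ ∀ x t : ℝ, T ≤ σ * t →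
      ‖soliton n lam a γ δ x t - asymptotics n lam a γ δ σ x t‖
        ≤ K * (Real.log (σ * t) / (σ * t)) := by
  have hσσ : σ * σ = 1 := by rcases hσ with rfl | rfl <;> norm_num
  have hσ0 : σ ≠ 0 := by rintro rfl; norm_num at hσσ
  obtain ⟨K, T, hT, h⟩ := soliton_near_sum n lam a (σ * γ) (σ * δ)
    (hγδ.imp (mul_ne_zero hσ0) (mul_ne_zero hσ0)) hn hlam (by
      intro i j hij
      simp only [velocity_scale] at hij
      exact hv.injective (mul_left_cancel₀ hσ0 hij))
  refine ⟨K, T, hT, fun x t ht => ?_⟩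
  have h1 := h x (σ * t) ht
  rwa [soliton_scale n lam a γ δ hσσ,
    sum_profile_eq_asymptotics n lam a γ δ hγδ hlam hv hσ x (by linarith)] at h1

end

end Hirota

theorem theorem4p10 (γ δ : ℝ) (hγδ : γ ≠ 0 ∨ δ ≠ 0) (k : ℕ) (n : Fin k → ℕ)
    (hn : ∀ i, 1 ≤ n i) (lam : Fin k → ℂ) (hlam : ∀ i, 0 < (lam i).im)
    (a : Fin k → ℕ → ℂ)
    (hv : StrictMono fun i => Hirota.velocity γ δ (lam i)) :
    (∀ x t : ℝ, IsUnit (Hirota.M n lam a γ δ x t).det) ∧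
    (∃ K T : ℝ, 1 < T ∧ ∀ x t : ℝ, T ≤ t →
      ‖Hirota.soliton n lam a γ δ x t - Hirota.asymptotics n lam a γ δ 1 x t‖
        ≤ K * (Real.log t / t)) ∧
    (∃ K T : ℝ, 1 < T ∧ ∀ x t : ℝ, t ≤ -T →
      ‖Hirota.soliton n lam a γ δ x t - Hirota.asymptotics n lam a γ δ (-1) x t‖
        ≤ K * (Real.log |t| / |t|)) := by
  refine ⟨fun x t => Hirota.isUnit_det_M n lam a γ δ hlam
    (fun i j h => hv.injective (by simp only [h])) x t, ?_, ?_⟩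
  · obtain ⟨K, T, hT, h⟩ := Hirota.soliton_near_asymptotics n lam a γ δ hγδ hn hlam hv
      (σ := 1) (Or.inl rfl)
    refine ⟨K, T, hT, fun x t ht => ?_⟩
    simpa using h x t (by linarith)
  · obtain ⟨K, T, hT, h⟩ := Hirota.soliton_near_asymptotics n lam a γ δ hγδ hn hlam hv
      (σ := -1) (Or.inr rfl)
    refine ⟨K, T, hT, fun x t ht => ?_⟩
    have h1 := h x t (by linarith)
    rwa [neg_one_mul, ← abs_of_neg (show t < 0 by linarith)] at h1
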